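/- Let $(M,g)$ be a closed (compact, connected, without boundary) smooth $n$-dimensional Riemannian manifold with Riemannian distance $d$, let $a\neq 0$ be real, and let $\varphi,\psi$ be two smooth positive solutions on $M\times(0,\infty)$ of the nonlinear heat equation $$\frac{\partial\omega}{\partial t}=\Delta\omega+a\,\omega\ln\omega .$$ Assume that one of the following two cases holds (the inequalities between $\varphi$ and $\psi$ being required at all points of $M\times(0,\infty)$): (i) $a>0$, $0<\varphi<\psi$, and $\mathrm{Ric}\ge 0$; (ii) $a<0$, and there are constants $0<c_0<1$ and $K\ge -\dfrac{\ln c_0}{1-c_0^2}-\dfrac12$ such that $0<c_0\psi<\varphi<\psi$ and $\mathrm{Ric}\ge -aK\,g$. Put $h=\varphi/\psi$. Let $x_1,x_2\in M$ and $0<t_1<t_2$. Then there is a minimal geodesic $\sigma:[0,1]\to M$ from $x_1$ to $x_2$, i.e. a curve with $\sigma(0)=x_1$, $\sigma(1)=x_2$ and $d(\sigma(r),\sigma(s))=|r-s|\,d(x_1,x_2)$ for all $r,s\in[0,1]$; and for every such $\sigma$, with $$\gamma(t)=\sigma\!\left(\frac{e^{at}-e^{at_1}}{e^{at_2}-e^{at_1}}\right),\qquad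 t\in[t_1,t_2],$$ one has $$e^{-at_1}\ln\psi(x_1,t_1)-e^{-at_2}\ln\psi(x_2,t_2)\le\frac a4\cdot\frac{d(x_1,x_2)^2}{e^{at_2}-e^{at_1}}+\frac n2\ln\!\left(\frac{1-e^{-at_2}}{1-e^{-at_1}}\right)-\int_{t_1}^{t_2}e^{-at}\,\frac{|\nabla h|^2}{1-h^2}(\gamma(t),t)\,dt .$$ -/

import Mathlib

open scoped Manifold ContDiff Bundle

noncomputable section RiemannianGeometry

namespace HarnackGeometry

/-! Local Riemannian geometry of an `n`-dimensional Riemannian manifold without boundary,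
written in the coordinates `u = (u₁, …, uₙ)` of the preferred chart at a point. -/

variable {n : ℕ}

/-- The `i`-th standard basis vector of `ℝⁿ`. -/
def stdVec (i : Fin n) : EuclideanSpace ℝ (Fin n) := EuclideanSpace.single i 1

/-- The partial derivative `∂ᵢ F` of a function on `ℝⁿ`. -/
def partialDeriv (i : Fin n) (F : EuclideanSpace ℝ (Fin n) → ℝ)
    (u : EuclideanSpace ℝ (Fin n)) : ℝ :=
  fderiv ℝ F u (stdVec i)

variable {M : Type*} [MetricSpace M] [ChartedSpace (EuclideanSpace ℝ (Fin n)) M]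
  [Bundle.RiemannianBundle (fun x : M => TangentSpace (𝓡 n) x)]

/-- The coordinate vector field `∂/∂uᵢ` of the chart at `p`, at the point with coordinates `u`. -/
def coordVec (p : M) (u : EuclideanSpace ℝ (Fin n)) (i : Fin n) :
    TangentSpace (𝓡 n) ((extChartAt (𝓡 n) p).symm u) :=
  mfderiv 𝓘(ℝ, EuclideanSpace ℝ (Fin n)) (𝓡 n) (extChartAt (𝓡 n) p).symm u (stdVec i)

/-- The matrix `(gᵢⱼ)` of the metric in the chart at `p`, at the point with coordinates `u`. -/
def metricMatrix (p : M) (u : EuclideanSpace ℝ (Fin n)) : Matrix (Fin n) (Fin n) ℝ :=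
  Matrix.of fun i j => inner ℝ (coordVec p u i) (coordVec p u j)

/-- The Christoffel symbol
`Γᵏᵢⱼ = ½ ∑ₗ gᵏˡ (∂ᵢ gⱼₗ + ∂ⱼ gᵢₗ - ∂ₗ gᵢⱼ)` of the chart at `p`. -/
def christoffel (p : M) (k i j : Fin n) (u : EuclideanSpace ℝ (Fin n)) : ℝ :=
  (1 / 2 : ℝ) * ∑ l, (metricMatrix p u)⁻¹ k l *
    (partialDeriv i (fun v => metricMatrix p v j l) u
      + partialDeriv j (fun v => metricMatrix p v i l) u
      - partialDeriv l (fun v => metricMatrix p v i j) u)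

/-- The Ricci component
`Rᵢⱼ = ∑ₖ (∂ₖ Γᵏᵢⱼ - ∂ⱼ Γᵏᵢₖ) + ∑ₖₗ (Γᵏₖₗ Γˡᵢⱼ - Γᵏⱼₗ Γˡᵢₖ)` of the chart at `p`. -/
def ricciComponent (p : M) (i j : Fin n) (u : EuclideanSpace ℝ (Fin n)) : ℝ :=
  ∑ k, (partialDeriv k (christoffel p k i j) u - partialDeriv j (christoffel p k i k) u)
    + ∑ k, ∑ l, (christoffel p k k l u * christoffel p l i j u
      - christoffel p k j l u * christoffel p l i k u)

/-- The `i`-th component of a tangent vector at `x`, in the chart at `x`. -/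
def vecComponent (x : M) (v : TangentSpace (𝓡 n) x) (i : Fin n) : ℝ :=
  (show EuclideanSpace ℝ (Fin n) from
    mfderiv (𝓡 n) 𝓘(ℝ, EuclideanSpace ℝ (Fin n)) (extChartAt (𝓡 n) x) x v) i

/-- The Ricci curvature `Ric(v, w)` at `x`. -/
def ricci (x : M) (v w : TangentSpace (𝓡 n) x) : ℝ :=
  ∑ i, ∑ j, ricciComponent x i j (extChartAt (𝓡 n) x x) * vecComponent x v i * vecComponent x w j

variable (n M) in
/-- `Ric ≥ κ g` on all of `M`. -/
def RicciBoundedBelow (κ : ℝ) : Prop :=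
  ∀ (x : M) (v : TangentSpace (𝓡 n) x), κ * ‖v‖ ^ 2 ≤ ricci x v v

variable (n) in
/-- The Laplace–Beltrami operator `Δf = ∑ᵢⱼ gⁱʲ (∂ᵢ∂ⱼ f - ∑ₖ Γᵏᵢⱼ ∂ₖ f)`
(the trace of the Hessian), evaluated at `x` in the chart at `x`. -/
def laplacian (f : M → ℝ) (x : M) : ℝ :=
  let F : EuclideanSpace ℝ (Fin n) → ℝ := fun u => f ((extChartAt (𝓡 n) x).symm u)
  let u₀ : EuclideanSpace ℝ (Fin n) := extChartAt (𝓡 n) x x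
  ∑ i, ∑ j, (metricMatrix x u₀)⁻¹ i j *
    (partialDeriv i (partialDeriv j F) u₀ - ∑ k, christoffel x k i j u₀ * partialDeriv k F u₀)

variable (n) in
/-- `|∇f|²` at `x`: the squared norm of the differential `df` with respect to the metric. -/
def gradNormSq (f : M → ℝ) (x : M) : ℝ :=
  ‖mvfderiv (𝓡 n) f x‖ ^ 2

variable (n) in
/-- `w` is a (smooth) positive solution of `∂w/∂t = Δw + a w ln w` on `M × (0, ∞)`. -/
structure IsPositiveSolution (a : ℝ) (w : M → ℝ → ℝ) : Prop where
  smooth : ContMDiffOn ((𝓡 n).prod 𝓘(ℝ, ℝ)) 𝓘(ℝ, ℝ) ∞ (fun p : M × ℝ => w p.1 p.2)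
    (Set.univ ×ˢ Set.Ioi 0)
  pos : ∀ x t, 0 < t → 0 < w x t
  equation : ∀ x t, 0 < t →
    HasDerivAt (fun s => w x s) (laplacian n (fun y => w y t) x + a * w x t * Real.log (w x t)) t

/-- `σ : [0, 1] → M` is a minimal geodesic from `x` to `y`, parametrized proportionally to
arc length: `d(σ r, σ s) = |r - s| d(x, y)`. -/
structure IsMinimalGeodesic {X : Type*} [MetricSpace X] (x y : X) (σ : ℝ → X) : Prop where
  source : σ 0 = x
  target : σ 1 = y
  dist_eq : ∀ r ∈ Set.Icc (0 : ℝ) 1, ∀ s ∈ Set.Icc (0 : ℝ) 1,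
    dist (σ r) (σ s) = |r - s| * dist x y

end HarnackGeometry

end RiemannianGeometry

/-! Write `f = ln ψ` and, since `0 < φ < ψ`, `φ = ψ sin θ` with `h = sin θ`. The angle is the right
variable because `|∇θ|² = |∇h|² / (1 - h²)`; the quantity to bound from below is `P = Δf - |∇θ|²`.
The two heat equations become `f_t = Δf + |∇f|² + a f` and `θ_t = Δθ + 2⟨∇f, ∇θ⟩ - tan θ |∇θ|² + a
tan θ ln sin θ`. By Bochner's formula, wherever `∇P = 0`, `P_t = ΔP + 2|Hess f - dθ⊗dθ|² + 2|Hess θ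
+ tan θ dθ⊗dθ|² + 2 Ric(∇f, ∇f) + 2 Ric(∇θ, ∇θ) + aP + a|∇θ|² (1 - 2(1 + ln h / (1 - h²)))`. The
squares close up exactly because `tan' = 1 + tan²`. The first endomorphism has trace `P`, so its
square contributes at least `2P²/n`. The Ricci terms and the last term have a nonnegative sum in
both cases (`curvature_term_nonneg`), because `-ln h / (1 - h²)` is decreasing on `(0, 1)` and at
least `1/2`. Hence `P_t ≥ (2/n) P² + aP` at every spatial minimum (`evolution_lower_bound`,
`harnackQuantity_evolution`).

The Riccati solution issuing from `-∞` at time `0` is `-(n/2) a / (1 - e^{-at})`, and the maximum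
principle on the compact manifold puts `P` above it (`riccatiBarrier_le`).

This bound is then integrated along `γ`. The weight `e^{-at}` removes the term `a f`, Young's
inequality absorbs the spatial variation of `f` into `|∇f|²`, and the exponential parametrization
makes the resulting kinetic term a constant multiple of the speed of the parameter. Since `σ` is
only a metric geodesic, right slopes replace derivatives along the curve (`eventually_slope_lt`,
`integrated_harnack`). Geodesics exist as limits of almost minimizing curves parametrized by arc
length (`exists_isMinimalGeodesic`).

The tensor calculus takes place on an open set with the metric as a field of bilinear forms, free of
indices. `lap_eq_sum` and `ric_eq_sum` identify it with the coordinate formulas of the statement,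
and `laplacian_eq_lap` shows that the Laplacian does not depend on the chart. -/

/-! ### Levi-Civita calculus on an open set and the Bochner formula. -/

noncomputable section LocalRiemannianCalculus

set_option maxSynthPendingDepth 3

namespace LocalMetric

variable {E : Type*} [NormedAddCommGroup E] [NormedSpace ℝ E]

/-- The Koszul form `½ (∂_X g(Y, Z) + ∂_Y g(X, Z) - ∂_Z g(X, Y))`. -/
def koszul (g : E → E →L[ℝ] E →L[ℝ] ℝ) (u : E) : E →L[ℝ] E →L[ℝ] E →L[ℝ] ℝ :=
  (1 / 2 : ℝ) • (fderiv ℝ g u + (fderiv ℝ g u).flip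
    - (ContinuousLinearMap.flipₗᵢ ℝ E E ℝ).toContinuousLinearEquiv.toContinuousLinearMap ∘L
        (fderiv ℝ g u).flip)

/-- The Christoffel map `Γ(X, Y)` of a metric. -/
def chris (g : E → E →L[ℝ] E →L[ℝ] ℝ) (u : E) : E →L[ℝ] E →L[ℝ] E :=
  -- `inverse` is zero where `g u` is not invertible, so the map is total; the defining identity
  -- `apply_chris` needs nondegeneracy.
  (ContinuousLinearMap.compL ℝ E (E →L[ℝ] ℝ) E (g u).inverse) ∘L koszul g u

/-- The gradient of a function. -/
def grad (g : E → E →L[ℝ] E →L[ℝ] ℝ) (F : E → ℝ) (u : E) : E :=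
  (g u).inverse (fderiv ℝ F u)

/-- The Hessian of a function, as an endomorphism. -/
def hess (g : E → E →L[ℝ] E →L[ℝ] ℝ) (F : E → ℝ) (u : E) : E →L[ℝ] E :=
  -- The covariant derivative `∇_X V = D_X V + Γ(X, V)` of `V = grad F`. As an endomorphism it has a
  -- trace without any choice of orthonormal frame.
  fderiv ℝ (grad g F) u + (chris g u).flip (grad g F u)

/-- The trace, as a continuous linear map on the continuous endomorphisms. -/
def tr (E : Type*) [NormedAddCommGroup E] [NormedSpace ℝ E] [FiniteDimensional ℝ E] :
    (E →L[ℝ] E) →L[ℝ] ℝ :=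
  LinearMap.toContinuousLinearMap (LinearMap.trace ℝ E ∘ₗ ContinuousLinearMap.coeLM ℝ)

/-- The Laplacian of a function. -/
def lap [FiniteDimensional ℝ E] (g : E → E →L[ℝ] E →L[ℝ] ℝ) (F : E → ℝ) (u : E) : ℝ :=
  tr E (hess g F u)

/-- The endomorphism `X ↦ R(X, V) V`. -/
def jacobi (g : E → E →L[ℝ] E →L[ℝ] ℝ) (u V : E) : E →L[ℝ] E :=
  -- At `X` the four terms are `(D_X Γ)(V, V)`, `(D_V Γ)(X, V)`, `Γ(X, Γ(V, V))` and `Γ(V, Γ(X,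
  -- V))`.
  ((fderiv ℝ (chris g) u).flip V).flip V - (fderiv ℝ (chris g) u V).flip V
    + (chris g u).flip (chris g u V V) - chris g u V ∘L (chris g u).flip V

/-- The Ricci curvature `Ric(V, V)`. -/
def ric [FiniteDimensional ℝ E] (g : E → E →L[ℝ] E →L[ℝ] ℝ) (u V : E) : ℝ :=
  tr E (jacobi g u V)

/-- `g` is a smooth Riemannian metric on the open set `U`. -/
structure IsMetricOn (g : E → E →L[ℝ] E →L[ℝ] ℝ) (U : Set E) : Prop where
  isOpen : IsOpen U
  smooth : ∀ u ∈ U, ContDiffAt ℝ ∞ g u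
  symm : ∀ u ∈ U, ∀ X Y, g u X Y = g u Y X
  pos : ∀ u ∈ U, ∀ X, X ≠ 0 → 0 < g u X X

lemma koszul_apply (g : E → E →L[ℝ] E →L[ℝ] ℝ) (u X Y Z : E) :
    koszul g u X Y Z =
      1 / 2 * (fderiv ℝ g u X Y Z + fderiv ℝ g u Y X Z - fderiv ℝ g u Z X Y) := by
  simp [koszul]

lemma hess_apply (g : E → E →L[ℝ] E →L[ℝ] ℝ) (F : E → ℝ) (u X : E) :
    hess g F u X = fderiv ℝ (grad g F) u X + chris g u X (grad g F u) := by
  simp [hess]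

section Trace

variable [FiniteDimensional ℝ E]

lemma tr_apply (A : E →L[ℝ] E) : tr E A = LinearMap.trace ℝ E A := rfl

lemma tr_comp_comm (A B : E →L[ℝ] E) : tr E (A ∘L B) = tr E (B ∘L A) := by
  exact LinearMap.trace_mul_comm ℝ (A : E →ₗ[ℝ] E) (B : E →ₗ[ℝ] E)

lemma tr_smulRight (l : E →L[ℝ] ℝ) (v : E) : tr E (l.smulRight v) = l v := by
  rw [tr_apply]
  exact LinearMap.trace_smulRight (l : E →ₗ[ℝ] ℝ) v

end Trace

namespace IsMetricOn

variable {g : E → E →L[ℝ] E →L[ℝ] ℝ} {U : Set E} (hg : IsMetricOn g U) {u : E} (hu : u ∈ U)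

include hg

lemma mono {W : Set E} (hW : IsOpen W) (h : W ⊆ U) : IsMetricOn g W where
  isOpen := hW
  smooth u hu := hg.smooth u (h hu)
  symm u hu := hg.symm u (h hu)
  pos u hu := hg.pos u (h hu)

include hu

lemma mem_nhds : U ∈ nhds u := hg.isOpen.mem_nhds hu

/-- Positive definiteness gives nondegeneracy, so identities between vectors can be checked after
pairing, without coordinates. -/
lemma ext {X Y : E} (h : ∀ Z, g u X Z = g u Y Z) : X = Y := by
  by_contra hne
  have := hg.pos u hu (X - Y) (sub_ne_zero.2 hne)
  have h' := h (X - Y)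
  simp only [map_sub, sub_apply] at this h'
  linarith

lemma nonneg (X : E) : 0 ≤ g u X X := by
  rcases eq_or_ne X 0 with rfl | h
  · simp
  · exact (hg.pos u hu X h).le

lemma fderiv_symm (Z X Y : E) : fderiv ℝ g u Z X Y = fderiv ℝ g u Z Y X := by
  have hd : DifferentiableAt ℝ g u := (hg.smooth u hu).differentiableAt (by simp)
  have h1 : HasFDerivAt (fun v => g v X Y) _ u :=
    (hd.hasFDerivAt.clm_apply (hasFDerivAt_const X u)).clm_apply (hasFDerivAt_const Y u)
  have h2 : HasFDerivAt (fun v => g v Y X) _ u :=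
    (hd.hasFDerivAt.clm_apply (hasFDerivAt_const Y u)).clm_apply (hasFDerivAt_const X u)
  have h3 := h1.congr_of_eventuallyEq (f₁ := fun v => g v Y X) (by
    filter_upwards [hg.mem_nhds hu] with v hv using hg.symm v hv Y X)
  have := congr($(h3.unique h2) Z)
  simpa using this

lemma contDiffAt_koszul : ContDiffAt ℝ ∞ (koszul g) u := by
  have h : ContDiffAt ℝ ∞ (fderiv ℝ g) u := (hg.smooth u hu).fderiv_right (by simp)
  have hf : ContDiffAt ℝ ∞ (fun v => (fderiv ℝ g v).flip) u :=
    (ContinuousLinearMap.flipₗᵢ ℝ E E (E →L[ℝ] ℝ)).toContinuousLinearEquiv.contDiff.contDiffAt.comp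
      u h
  exact ((h.add hf).sub (contDiffAt_const.clm_comp hf)).const_smul (1 / 2 : ℝ)

variable [FiniteDimensional ℝ E]

/-- Nondegeneracy is injectivity into a dual space of the same dimension. This makes `inverse` a
true inverse, depending smoothly on the point. -/
lemma exists_equiv : ∃ e : E ≃L[ℝ] (E →L[ℝ] ℝ), (e : E →L[ℝ] E →L[ℝ] ℝ) = g u := by
  have hinj : Function.Injective (g u : E →ₗ[ℝ] (E →L[ℝ] ℝ)) := fun X Y h =>
    hg.ext hu fun Z => by
      have : g u X = g u Y := h
      rw [this]
  have hfin : Module.finrank ℝ E = Module.finrank ℝ (E →L[ℝ] ℝ) := by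
    rw [← (LinearMap.toContinuousLinearMap : (E →ₗ[ℝ] ℝ) ≃ₗ[ℝ] (E →L[ℝ] ℝ)).finrank_eq]
    exact (Subspace.dual_finrank_eq (K := ℝ) (V := E)).symm
  refine ⟨(LinearEquiv.ofInjectiveOfFinrankEq _ hinj hfin).toContinuousLinearEquiv, ?_⟩
  ext X Y
  rfl

lemma apply_inverse (l : E →L[ℝ] ℝ) : g u ((g u).inverse l) = l := by
  obtain ⟨e, he⟩ := hg.exists_equiv hu
  rw [← he, ContinuousLinearMap.inverse_equiv]
  exact e.apply_symm_apply l

lemma contDiffAt_inverse : ContDiffAt ℝ ∞ (fun v => (g v).inverse) u := by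
  have := FiniteDimensional.complete ℝ E
  obtain ⟨e, he⟩ := hg.exists_equiv hu
  have h : ContDiffAt ℝ ∞ ContinuousLinearMap.inverse (g u) := he ▸ contDiffAt_map_inverse e
  exact h.comp u (hg.smooth u hu)

lemma apply_chris (X Y Z : E) : g u (chris g u X Y) Z = koszul g u X Y Z := by
  rw [chris]
  simp [hg.apply_inverse hu]

lemma chris_symm (X Y : E) : chris g u X Y = chris g u Y X := by
  refine hg.ext hu fun Z => ?_
  rw [hg.apply_chris hu, hg.apply_chris hu, koszul_apply, koszul_apply, hg.fderiv_symm hu Z X Y]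
  ring

/-- Compatibility of the connection with the metric: in the sum of the two Koszul forms every
derivative cancels except the one along `Z`. -/
lemma fderiv_eq (Z X Y : E) :
    fderiv ℝ g u Z X Y = g u (chris g u Z X) Y + g u X (chris g u Z Y) := by
  rw [hg.symm u hu X, hg.apply_chris hu, hg.apply_chris hu, koszul_apply, koszul_apply,
    hg.fderiv_symm hu Z Y X, hg.fderiv_symm hu Y Z X, hg.fderiv_symm hu X Z Y]
  ring

lemma contDiffAt_chris : ContDiffAt ℝ ∞ (chris g) u := by
  refine ContDiffAt.clm_comp ?_ (hg.contDiffAt_koszul hu)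
  exact (ContinuousLinearMap.compL ℝ E (E →L[ℝ] ℝ) E).contDiff.contDiffAt.comp u
    (hg.contDiffAt_inverse hu)

lemma apply_grad (F : E → ℝ) (X : E) : g u (grad g F u) X = fderiv ℝ F u X := by
  rw [grad, hg.apply_inverse hu]

lemma contDiffAt_grad {F : E → ℝ} (hF : ContDiffAt ℝ ∞ F u) : ContDiffAt ℝ ∞ (grad g F) u :=
  (hg.contDiffAt_inverse hu).clm_apply (hF.fderiv_right (by simp))

lemma contDiffAt_hess {F : E → ℝ} (hF : ContDiffAt ℝ ∞ F u) : ContDiffAt ℝ ∞ (hess g F) u := by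
  refine ((hg.contDiffAt_grad hu hF).fderiv_right (by simp)).add ?_
  exact ((ContinuousLinearMap.flipₗᵢ ℝ E E E).toContinuousLinearEquiv.contDiff.contDiffAt.comp u
    (hg.contDiffAt_chris hu)).clm_apply (hg.contDiffAt_grad hu hF)

lemma contDiffAt_lap {F : E → ℝ} (hF : ContDiffAt ℝ ∞ F u) : ContDiffAt ℝ ∞ (lap g F) u :=
  (tr E).contDiff.contDiffAt.comp u (hg.contDiffAt_hess hu hF)

/-- The derivative of a pairing of vector fields. -/
lemma hasFDerivAt_pairing {V W : E → E} (hV : DifferentiableAt ℝ V u)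
    (hW : DifferentiableAt ℝ W u) (X : E) :
    fderiv ℝ (fun v => g v (V v) (W v)) u X
      = g u (fderiv ℝ V u X + chris g u X (V u)) (W u)
        + g u (V u) (fderiv ℝ W u X + chris g u X (W u)) := by
  have hd : DifferentiableAt ℝ g u := (hg.smooth u hu).differentiableAt (by simp)
  have h := ((hd.hasFDerivAt.clm_apply hV.hasFDerivAt).clm_apply hW.hasFDerivAt).fderiv
  rw [h]
  simp only [add_apply, ContinuousLinearMap.comp_apply,
    ContinuousLinearMap.flip_apply, hg.fderiv_eq hu, map_add]
  ring

/-- Obtained by differentiating `g(grad F, Y) = dF(Y)` with `Y` held constant. -/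
lemma apply_hess {F : E → ℝ} (hF : ContDiffAt ℝ ∞ F u) (X Y : E) :
    g u (hess g F u X) Y = fderiv ℝ (fderiv ℝ F) u X Y - fderiv ℝ F u (chris g u X Y) := by
  have h1 := hg.hasFDerivAt_pairing hu ((hg.contDiffAt_grad hu hF).differentiableAt (by simp))
    (differentiableAt_const Y) X
  have h2 : (fun v => g v (grad g F v) Y) =ᶠ[nhds u] fun v => fderiv ℝ F v Y := by
    filter_upwards [hg.mem_nhds hu] with v hv using hg.apply_grad hv F Y
  have hd : DifferentiableAt ℝ (fderiv ℝ F) u :=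
    (hF.fderiv_right (m := ∞) (by simp)).differentiableAt (by simp)
  rw [h2.fderiv_eq, (hd.hasFDerivAt.clm_apply (hasFDerivAt_const Y u)).fderiv] at h1
  rw [hess_apply, ← hg.apply_grad hu F (chris g u X Y)]
  simp at h1
  simp only [map_add, add_apply]
  linarith

lemma hess_symm {F : E → ℝ} (hF : ContDiffAt ℝ ∞ F u) (X Y : E) :
    g u (hess g F u X) Y = g u (hess g F u Y) X := by
  rw [hg.apply_hess hu hF, hg.apply_hess hu hF, hg.chris_symm hu X Y,
    (hF.isSymmSndFDerivAt (by simp; norm_cast)).eq X Y]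

lemma fderiv_grad_pairing {F G : E → ℝ} (hF : ContDiffAt ℝ ∞ F u) (hG : ContDiffAt ℝ ∞ G u)
    (X : E) :
    fderiv ℝ (fun v => g v (grad g F v) (grad g G v)) u X
      = g u (hess g F u X) (grad g G u) + g u (hess g G u X) (grad g F u) := by
  rw [hg.hasFDerivAt_pairing hu ((hg.contDiffAt_grad hu hF).differentiableAt (by simp))
    ((hg.contDiffAt_grad hu hG).differentiableAt (by simp)), ← hess_apply, ← hess_apply,
    hg.symm u hu (hess g G u X)]

lemma contDiffAt_pairing {F G : E → ℝ} (hF : ContDiffAt ℝ ∞ F u) (hG : ContDiffAt ℝ ∞ G u) :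
    ContDiffAt ℝ ∞ (fun v => g v (grad g F v) (grad g G v)) u :=
  ((hg.smooth u hu).clm_apply (hg.contDiffAt_grad hu hF)).clm_apply (hg.contDiffAt_grad hu hG)

/-- Self-adjointness of the Hessian moves it from the test vector to the gradient. -/
lemma grad_normSq {F : E → ℝ} (hF : ContDiffAt ℝ ∞ F u) :
    grad g (fun v => g v (grad g F v) (grad g F v)) u = (2 : ℝ) • hess g F u (grad g F u) := by
  refine hg.ext hu fun X => ?_
  rw [hg.apply_grad hu, hg.fderiv_grad_pairing hu hF hF, hg.hess_symm hu hF X]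
  simp
  ring

/-- The Bochner formula. -/
theorem bochner {F : E → ℝ} (hF : ∀ v ∈ U, ContDiffAt ℝ ∞ F v) :
    lap g (fun v => g v (grad g F v) (grad g F v)) u =
      2 * tr E (hess g F u ∘L hess g F u) + 2 * fderiv ℝ (lap g F) u (grad g F u)
        + 2 * ric g u (grad g F u) := by
  set V := grad g F with hVdef
  set A := hess g F with hAdef
  have hVs : ContDiffAt ℝ ∞ V u := hg.contDiffAt_grad hu (hF u hu)
  have hVd : DifferentiableAt ℝ V u := hVs.differentiableAt (by simp)
  have hAs : ContDiffAt ℝ ∞ A u := hg.contDiffAt_hess hu (hF u hu)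
  have hAd : DifferentiableAt ℝ A u := hAs.differentiableAt (by simp)
  have hV' : DifferentiableAt ℝ (fderiv ℝ V) u :=
    (hVs.fderiv_right (m := ∞) (by simp)).differentiableAt (by simp)
  have hΓ : DifferentiableAt ℝ (chris g) u := (hg.contDiffAt_chris hu).differentiableAt (by simp)
  have hDA : ∀ X Y, fderiv ℝ A u X Y = fderiv ℝ (fderiv ℝ V) u X Y
      + fderiv ℝ (chris g) u X Y (V u) + chris g u Y (fderiv ℝ V u X) := by
    intro X Y
    have h1 : HasFDerivAt (fun v => A v Y) _ u :=
      hAd.hasFDerivAt.clm_apply (hasFDerivAt_const Y u)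
    have h2 : HasFDerivAt (fun v => A v Y) _ u :=
      ((hV'.hasFDerivAt.clm_apply (hasFDerivAt_const Y u)).add
        ((hΓ.hasFDerivAt.clm_apply (hasFDerivAt_const Y u)).clm_apply
          hVd.hasFDerivAt)).congr_of_eventuallyEq (Filter.Eventually.of_forall fun v => by
            simp [hAdef, hess_apply, hVdef])
    have := congr($(h1.unique h2) X)
    simp at this
    rw [this]
    abel
  have hgrad : grad g (fun v => g v (V v) (V v)) =ᶠ[nhds u] fun v => (2 : ℝ) • A v (V v) := by
    filter_upwards [hg.mem_nhds hu] with v hv using hg.grad_normSq hv (hF v hv)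
  have hD : ∀ X, fderiv ℝ (grad g (fun v => g v (V v) (V v))) u X
      = (2 : ℝ) • (fderiv ℝ A u X (V u) + A u (fderiv ℝ V u X)) := by
    intro X
    have h : HasFDerivAt (fun v => (2 : ℝ) • A v (V v)) _ u :=
      (hAd.hasFDerivAt.clm_apply hVd.hasFDerivAt).const_smul (2 : ℝ)
    rw [hgrad.fderiv_eq, h.fderiv]
    simp [add_comm]
  -- Commuting the second derivatives of `V` produces the curvature term `R(X, V)V`. The final
  -- commutator is the difference between the covariant and the ordinary derivative of `A` along
  -- `V`, and the trace kills it.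
  have key : hess g (fun v => g v (V v) (V v)) u
      = (2 : ℝ) • (A u ∘L A u + fderiv ℝ A u (V u) + jacobi g u (V u)
        + (chris g u (V u) ∘L A u - A u ∘L chris g u (V u))) := by
    ext1 X
    rw [hess_apply, hD, hgrad.eq_of_nhds]
    have hAX : ∀ X, A u X = fderiv ℝ V u X + chris g u X (V u) := fun X => hess_apply g F u X
    have hsym : fderiv ℝ (fderiv ℝ V) u X (V u) = fderiv ℝ (fderiv ℝ V) u (V u) X :=
      (hVs.isSymmSndFDerivAt (by simp; norm_cast)).eq X (V u)
    simp only [jacobi, add_apply, sub_apply,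
      smul_apply, ContinuousLinearMap.comp_apply,
      ContinuousLinearMap.flip_apply, hDA, map_smul, ← smul_add]
    congr 1
    rw [hsym]
    simp only [hAX, map_add, add_apply, hg.chris_symm hu X (V u),
      hg.chris_symm hu (V u) (fderiv ℝ V u X)]
    abel
  have htr : fderiv ℝ (lap g F) u (V u) = tr E (fderiv ℝ A u (V u)) := by
    have : HasFDerivAt (lap g F) ((tr E) ∘L fderiv ℝ A u) u :=
      (tr E).hasFDerivAt.comp u hAd.hasFDerivAt
    rw [this.fderiv]
    rfl
  rw [lap, key, htr, ric]
  simp only [map_smul, map_add, map_sub, tr_comp_comm (A u) (chris g u (V u)), smul_eq_mul]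
  ring

end IsMetricOn

end LocalMetric

end LocalRiemannianCalculus

/-! ### Trace inequalities, product and chain rules, time derivatives. -/

noncomputable section LocalDifferentialOperators
set_option maxSynthPendingDepth 3
namespace LocalMetric
variable {E : Type*} [NormedAddCommGroup E] [NormedSpace ℝ E]

section TraceInequalities

variable [FiniteDimensional ℝ E]

/-- The trace of an endomorphism that is nonnegative for some inner product is nonnegative. -/
lemma tr_nonneg {b : E →L[ℝ] E →L[ℝ] ℝ} (hs : ∀ X Y, b X Y = b Y X)
    (hp : ∀ X, X ≠ 0 → 0 < b X X) {A : E →L[ℝ] E} (hA : ∀ X, 0 ≤ b (A X) X) : 0 ≤ tr E A := by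
  let B : LinearMap.BilinForm ℝ E := LinearMap.mk₂ ℝ (fun X Y => b X Y) (by simp) (by simp)
    (by simp) (by simp)
  have hBs : LinearMap.IsSymm B := ⟨fun X Y => hs X Y⟩
  -- Orthogonality suffices, without normalization: the `i`-th diagonal entry of `A` times `b(vᵢ,
  -- vᵢ) > 0` is `b(A vᵢ, vᵢ)`.
  obtain ⟨v, hv⟩ := LinearMap.BilinForm.exists_orthogonal_basis hBs
  have hvo : ∀ i j, i ≠ j → b (v i) (v j) = 0 := fun i j hij => hv hij
  have hrepr : ∀ X i, v.repr X i * b (v i) (v i) = b X (v i) := by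
    intro X i
    conv_rhs => rw [← v.sum_repr X]
    rw [map_sum, sum_apply, Finset.sum_eq_single i]
    · simp
    · intro j _ hj
      simp [hvo j i hj]
    · simp
  rw [tr_apply, LinearMap.trace_eq_matrix_trace ℝ v, Matrix.trace]
  refine Finset.sum_nonneg fun i _ => ?_
  have h1 := hp (v i) (v.ne_zero i)
  rw [Matrix.diag_apply, LinearMap.toMatrix_apply]
  have h2 := hrepr (A (v i)) i
  have h3 := hA (v i)
  rw [← h2] at h3
  exact nonneg_of_mul_nonneg_left h3 h1

/-- `(tr B)² ≤ n tr(B²)` for a self-adjoint endomorphism `B`. -/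
lemma sq_tr_le {b : E →L[ℝ] E →L[ℝ] ℝ} (hs : ∀ X Y, b X Y = b Y X)
    (hp : ∀ X, X ≠ 0 → 0 < b X X) {B : E →L[ℝ] E} (hB : ∀ X Y, b (B X) Y = b (B Y) X) {n : ℕ}
    (hn : Module.finrank ℝ E = n) (hn0 : n ≠ 0) : tr E B ^ 2 / n ≤ tr E (B ∘L B) := by
  have hnn : (0 : ℝ) < n := by positivity
  have hnonneg : ∀ X, 0 ≤ b X X := fun X => by
    rcases eq_or_ne X 0 with rfl | h
    · simp
    · exact (hp X h).le
  have hid : tr E (ContinuousLinearMap.id ℝ E) = n := by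
    rw [tr_apply, ← hn]
    exact LinearMap.trace_id ℝ E
  -- The mean eigenvalue. `B - c · id` is self-adjoint, so its square has nonnegative trace, and
  -- expanding that trace gives the claim.
  set c : ℝ := tr E B / n with hc
  have h := tr_nonneg hs hp (A := (B - c • ContinuousLinearMap.id ℝ E) ∘L
    (B - c • ContinuousLinearMap.id ℝ E)) fun X => by
      have : ∀ X Y, b ((B - c • ContinuousLinearMap.id ℝ E) X) Y
          = b ((B - c • ContinuousLinearMap.id ℝ E) Y) X := by
        intro X Y
        simp [hB X Y, hs X Y]
      rw [ContinuousLinearMap.comp_apply, this]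
      exact hnonneg _
  have he : (B - c • ContinuousLinearMap.id ℝ E) ∘L (B - c • ContinuousLinearMap.id ℝ E)
      = B ∘L B - (2 * c) • B + (c * c) • ContinuousLinearMap.id ℝ E := by
    ext X
    simp [two_mul, add_smul, smul_sub, mul_smul]
    abel
  rw [he] at h
  simp only [map_add, map_sub, map_smul, smul_eq_mul, hid] at h
  have hcn : c * n = tr E B := by rw [hc]; field_simp
  have : tr E B ^ 2 / n = c * tr E B := by rw [hc]; ring
  rw [this]
  have e2 : c * c * n = c * tr E B := by rw [mul_assoc, hcn]
  linarith

end TraceInequalities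

section Rules

variable {g : E → E →L[ℝ] E →L[ℝ] ℝ} {u : E}

lemma grad_congr {F G : E → ℝ} (h : F =ᶠ[nhds u] G) :
    grad g F u = grad g G u := by
  rw [grad, grad, h.fderiv_eq]

lemma hess_congr {F G : E → ℝ} (h : F =ᶠ[nhds u] G) :
    hess g F u = hess g G u := by
  have h' : grad g F =ᶠ[nhds u] grad g G := by
    filter_upwards [h.eventuallyEq_nhds] with v hv using grad_congr hv
  rw [hess, hess, h'.fderiv_eq, grad_congr h]

lemma grad_add {F G : E → ℝ} (hF : DifferentiableAt ℝ F u)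
    (hG : DifferentiableAt ℝ G u) :
    grad g (fun v => F v + G v) u = grad g F u + grad g G u := by
  rw [grad, fderiv_fun_add hF hG, map_add, grad, grad]

lemma grad_mul {F G : E → ℝ} (hF : DifferentiableAt ℝ F u)
    (hG : DifferentiableAt ℝ G u) :
    grad g (fun v => F v * G v) u = F u • grad g G u + G u • grad g F u := by
  rw [grad, fderiv_fun_mul hF hG, map_add, map_smul, map_smul, grad, grad]

lemma grad_comp {F : E → ℝ} {η : ℝ → ℝ} {c : ℝ} (hF : DifferentiableAt ℝ F u)
    (hη : HasDerivAt η c (F u)) : grad g (fun v => η (F v)) u = c • grad g F u := by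
  have h : HasFDerivAt (fun v => η (F v)) (c • fderiv ℝ F u) u :=
    hη.comp_hasFDerivAt u hF.hasFDerivAt
  rw [grad, h.fderiv, map_smul, grad]

variable [FiniteDimensional ℝ E]

lemma lap_congr {F G : E → ℝ} (h : F =ᶠ[nhds u] G) : lap g F u = lap g G u := by
  rw [lap, lap, hess_congr h]

namespace IsMetricOn

variable {U : Set E} (hg : IsMetricOn g U) (hu : u ∈ U)

include hg hu

lemma hess_add {F G : E → ℝ} (hF : ∀ v ∈ U, ContDiffAt ℝ ∞ F v)
    (hG : ∀ v ∈ U, ContDiffAt ℝ ∞ G v) :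
    hess g (fun v => F v + G v) u = hess g F u + hess g G u := by
  have h : grad g (fun v => F v + G v) =ᶠ[nhds u] fun v => grad g F v + grad g G v := by
    filter_upwards [hg.mem_nhds hu] with v hv using
      grad_add ((hF v hv).differentiableAt (by simp)) ((hG v hv).differentiableAt (by simp))
  rw [hess, h.fderiv_eq, h.eq_of_nhds, hess, hess, map_add, fderiv_fun_add
    ((hg.contDiffAt_grad hu (hF u hu)).differentiableAt (by simp))
    ((hg.contDiffAt_grad hu (hG u hu)).differentiableAt (by simp))]
  abel

lemma lap_add {F G : E → ℝ} (hF : ∀ v ∈ U, ContDiffAt ℝ ∞ F v)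
    (hG : ∀ v ∈ U, ContDiffAt ℝ ∞ G v) :
    lap g (fun v => F v + G v) u = lap g F u + lap g G u := by
  rw [lap, hg.hess_add hu hF hG, map_add, lap, lap]

lemma hess_mul {F G : E → ℝ} (hF : ∀ v ∈ U, ContDiffAt ℝ ∞ F v)
    (hG : ∀ v ∈ U, ContDiffAt ℝ ∞ G v) :
    hess g (fun v => F v * G v) u = F u • hess g G u + G u • hess g F u
      + (fderiv ℝ F u).smulRight (grad g G u) + (fderiv ℝ G u).smulRight (grad g F u) := by
  have h : grad g (fun v => F v * G v) =ᶠ[nhds u] fun v => F v • grad g G v + G v • grad g F v := by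
    filter_upwards [hg.mem_nhds hu] with v hv using
      grad_mul ((hF v hv).differentiableAt (by simp)) ((hG v hv).differentiableAt (by simp))
  have h1 := (hF u hu).differentiableAt (n := ∞) (by simp)
  have h2 := (hG u hu).differentiableAt (n := ∞) (by simp)
  have h3 := (hg.contDiffAt_grad hu (hF u hu)).differentiableAt (by simp)
  have h4 := (hg.contDiffAt_grad hu (hG u hu)).differentiableAt (by simp)
  have h5 : HasFDerivAt (fun v => F v • grad g G v + G v • grad g F v) _ u :=
    (h1.hasFDerivAt.fun_smul h4.hasFDerivAt).fun_add (h2.hasFDerivAt.fun_smul h3.hasFDerivAt)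
  rw [hess, h.fderiv_eq, h.eq_of_nhds, hess, hess, h5.fderiv]
  ext X
  simp
  abel

lemma lap_mul {F G : E → ℝ} (hF : ∀ v ∈ U, ContDiffAt ℝ ∞ F v)
    (hG : ∀ v ∈ U, ContDiffAt ℝ ∞ G v) :
    lap g (fun v => F v * G v) u
      = F u * lap g G u + G u * lap g F u + 2 * g u (grad g F u) (grad g G u) := by
  rw [lap, hg.hess_mul hu hF hG]
  simp only [map_add, map_smul, tr_smulRight, ← hg.apply_grad hu, lap, smul_eq_mul,
    hg.symm u hu (grad g G u)]
  ring

lemma lap_const_mul (c : ℝ) {F : E → ℝ} (hF : ∀ v ∈ U, ContDiffAt ℝ ∞ F v) :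
    lap g (fun v => c * F v) u = c * lap g F u := by
  have h0 : ∀ v, grad g (fun _ : E => c) v = 0 := fun v => by simp [grad]
  have h1 : lap g (fun _ : E => c) u = 0 := by
    have : grad g (fun _ : E => c) = fun _ => 0 := funext h0
    simp [lap, hess, this]
  rw [hg.lap_mul hu (F := fun _ => c) (fun v _ => contDiffAt_const) hF, h0, h1]
  simp

lemma lap_comp {F : E → ℝ} {η η' : ℝ → ℝ} {c : ℝ} (hF : ∀ v ∈ U, ContDiffAt ℝ ∞ F v)
    (hη : ∀ v ∈ U, HasDerivAt η (η' (F v)) (F v)) (hη' : HasDerivAt η' c (F u)) :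
    lap g (fun v => η (F v)) u
      = η' (F u) * lap g F u + c * g u (grad g F u) (grad g F u) := by
  have h : grad g (fun v => η (F v)) =ᶠ[nhds u] fun v => η' (F v) • grad g F v := by
    filter_upwards [hg.mem_nhds hu] with v hv using
      grad_comp ((hF v hv).differentiableAt (by simp)) (hη v hv)
  have h1 := (hF u hu).differentiableAt (n := ∞) (by simp)
  have h3 := (hg.contDiffAt_grad hu (hF u hu)).differentiableAt (by simp)
  have h4 : HasFDerivAt (fun v => η' (F v)) (c • fderiv ℝ F u) u :=
    hη'.comp_hasFDerivAt u h1.hasFDerivAt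
  have h5 : HasFDerivAt (fun v => η' (F v) • grad g F v) _ u := h4.fun_smul h3.hasFDerivAt
  have h6 : hess g (fun v => η (F v)) u
      = η' (F u) • hess g F u + c • (fderiv ℝ F u).smulRight (grad g F u) := by
    rw [hess, h.fderiv_eq, h.eq_of_nhds, hess, h5.fderiv]
    ext X
    simp [mul_smul]
    abel
  rw [lap, h6]
  simp only [map_add, map_smul, tr_smulRight, ← hg.apply_grad hu, lap, smul_eq_mul]

/-- The Laplacian is nonnegative at a point where the differential vanishes and the second
derivative is nonnegative. -/
lemma lap_nonneg {F : E → ℝ} (hF : ContDiffAt ℝ ∞ F u) (h0 : fderiv ℝ F u = 0)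
    (h2 : ∀ X, 0 ≤ fderiv ℝ (fderiv ℝ F) u X X) : 0 ≤ lap g F u := by
  refine tr_nonneg (hg.symm u hu) (hg.pos u hu) fun X => ?_
  rw [hg.apply_hess hu hF, h0]
  simpa using h2 X

end IsMetricOn

end Rules

section Time

/-- Derivatives in time and in space commute. -/
lemma hasDerivAt_fderiv_swap {W : Type*} [NormedAddCommGroup W] [NormedSpace ℝ W]
    {G : E → ℝ → W} {u : E} {t : ℝ} (hG : ContDiffAt ℝ ∞ (fun q : E × ℝ => G q.1 q.2) (u, t)) :
    HasDerivAt (fun s => fderiv ℝ (fun v => G v s) u)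
      (fderiv ℝ (fun v => deriv (G v) t) u) t := by
  -- Both sides are mixed second derivatives of this joint function, so the claim is the symmetry of
  -- its second derivative.
  set H : E × ℝ → W := fun q => G q.1 q.2 with hH
  have hev : ∀ᶠ q in nhds (u, t), DifferentiableAt ℝ H q := by
    filter_upwards [(hG.of_le (m := 1) (by simp)).eventually (by simp)] with q hq using
      hq.differentiableAt (by simp)
  have hd2 : DifferentiableAt ℝ (fderiv ℝ H) (u, t) :=
    (hG.fderiv_right (m := ∞) (by simp)).differentiableAt (by simp)
  have hs : ∀ᶠ s in nhds t, DifferentiableAt ℝ H (u, s) :=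
    (Continuous.prodMk_right u).continuousAt.eventually hev
  have hv : ∀ᶠ v in nhds u, DifferentiableAt ℝ H (v, t) :=
    (Continuous.prodMk_left t).continuousAt.eventually hev
  have e1 : (fun s => fderiv ℝ (fun v => G v s) u) =ᶠ[nhds t]
      fun s => fderiv ℝ H (u, s) ∘L ContinuousLinearMap.inl ℝ E ℝ := by
    filter_upwards [hs] with s hs
    have : HasFDerivAt (fun v => H (v, s)) _ u :=
      HasFDerivAt.comp (g := H) u hs.hasFDerivAt (hasFDerivAt_prodMk_left (𝕜 := ℝ) u s)
    exact this.fderiv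
  have e2 : (fun v => deriv (G v) t) =ᶠ[nhds u] fun v => fderiv ℝ H (v, t) (0, 1) := by
    filter_upwards [hv] with v hv
    have : HasDerivAt (fun s => H (v, s)) _ t :=
      hv.hasFDerivAt.comp_hasDerivAt t ((hasFDerivAt_prodMk_right v t).hasDerivAt)
    simpa using this.deriv
  have e3 : HasFDerivAt (fun v => fderiv ℝ H (v, t) (0, 1)) _ u :=
    (hd2.hasFDerivAt.comp u (hasFDerivAt_prodMk_left u t)).clm_apply (hasFDerivAt_const (0, 1) u)
  have e4 : HasDerivAt (fun s => fderiv ℝ H (u, s)) _ t :=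
    hd2.hasFDerivAt.comp_hasDerivAt t ((hasFDerivAt_prodMk_right u t).hasDerivAt)
  have e5 := (e4.clm_comp (hasDerivAt_const t (ContinuousLinearMap.inl ℝ E ℝ)))
  rw [e2.fderiv_eq, e3.fderiv]
  refine (e5.congr_of_eventuallyEq e1).congr_deriv ?_
  ext X
  have := (hG.isSymmSndFDerivAt (by simp; norm_cast)).eq (0, 1) (X, 0)
  simpa using this

lemma contDiffAt_slice {W : Type*} [NormedAddCommGroup W] [NormedSpace ℝ W] {F : E → ℝ → W}
    {u : E} {t : ℝ} (hF : ContDiffAt ℝ ∞ (fun q : E × ℝ => F q.1 q.2) (u, t)) :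
    ContDiffAt ℝ ∞ (fun v => F v t) u :=
  hF.comp u (contDiffAt_id.prodMk contDiffAt_const)

lemma contDiffAt_time {W : Type*} [NormedAddCommGroup W] [NormedSpace ℝ W] {F : E → ℝ → W}
    {u : E} {t : ℝ} (hF : ContDiffAt ℝ ∞ (fun q : E × ℝ => F q.1 q.2) (u, t)) :
    ContDiffAt ℝ ∞ (F u) t :=
  hF.comp t (contDiffAt_const.prodMk contDiffAt_id)

lemma contDiffAt_fderiv_slice {W : Type*} [NormedAddCommGroup W] [NormedSpace ℝ W]
    {F : E → ℝ → W} {u : E} {t : ℝ} (hF : ContDiffAt ℝ ∞ (fun q : E × ℝ => F q.1 q.2) (u, t)) :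
    ContDiffAt ℝ ∞ (fun q : E × ℝ => fderiv ℝ (fun v => F v q.2) q.1) (u, t) := by
  refine ContDiffAt.fderiv (f := fun (q : E × ℝ) v => F v q.2) (n := ∞) ?_ contDiffAt_fst (by simp)
  exact hF.comp ((u, t), u) (contDiffAt_snd.prodMk (contDiffAt_snd.comp _ contDiffAt_fst))

lemma hasDerivAt_grad {g : E → E →L[ℝ] E →L[ℝ] ℝ} {F : E → ℝ → ℝ} {u : E} {t : ℝ}
    (hF : ContDiffAt ℝ ∞ (fun q : E × ℝ => F q.1 q.2) (u, t)) :
    HasDerivAt (fun s => grad g (fun v => F v s) u) (grad g (fun v => deriv (F v) t) u) t :=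
  ((g u).inverse.hasFDerivAt.comp_hasDerivAt t (hasDerivAt_fderiv_swap hF))

namespace IsMetricOn

variable [FiniteDimensional ℝ E] {g : E → E →L[ℝ] E →L[ℝ] ℝ} {U : Set E} (hg : IsMetricOn g U)
  {u : E} (hu : u ∈ U) {F G : E → ℝ → ℝ} {t : ℝ}

include hg hu

lemma contDiffAt_grad_slice (hF : ContDiffAt ℝ ∞ (fun q : E × ℝ => F q.1 q.2) (u, t)) :
    ContDiffAt ℝ ∞ (fun q : E × ℝ => grad g (fun v => F v q.2) q.1) (u, t) :=
  ContDiffAt.clm_apply (f := fun q : E × ℝ => (g q.1).inverse)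
    ((hg.contDiffAt_inverse hu).comp (u, t) contDiffAt_fst) (contDiffAt_fderiv_slice hF)

lemma contDiffAt_hess_slice (hF : ContDiffAt ℝ ∞ (fun q : E × ℝ => F q.1 q.2) (u, t)) :
    ContDiffAt ℝ ∞ (fun q : E × ℝ => hess g (fun v => F v q.2) q.1) (u, t) := by
  refine (contDiffAt_fderiv_slice (F := fun v s => grad g (fun v => F v s) v)
    (hg.contDiffAt_grad_slice hu hF)).add ?_
  have h1 : ContDiffAt ℝ ∞ (fun v => (chris g v).flip) u :=
    (ContinuousLinearMap.flipₗᵢ ℝ E E E).toContinuousLinearEquiv.contDiff.contDiffAt.comp u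
      (hg.contDiffAt_chris hu)
  exact (h1.comp (u, t) contDiffAt_fst).clm_apply (hg.contDiffAt_grad_slice hu hF)

lemma contDiffAt_lap_slice (hF : ContDiffAt ℝ ∞ (fun q : E × ℝ => F q.1 q.2) (u, t)) :
    ContDiffAt ℝ ∞ (fun q : E × ℝ => lap g (fun v => F v q.2) q.1) (u, t) :=
  (tr E).contDiff.contDiffAt.comp (u, t) (hg.contDiffAt_hess_slice hu hF)

lemma contDiffAt_pairing_slice (hF : ContDiffAt ℝ ∞ (fun q : E × ℝ => F q.1 q.2) (u, t))
    (hG : ContDiffAt ℝ ∞ (fun q : E × ℝ => G q.1 q.2) (u, t)) :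
    ContDiffAt ℝ ∞ (fun q : E × ℝ =>
      g q.1 (grad g (fun v => F v q.2) q.1) (grad g (fun v => G v q.2) q.1)) (u, t) :=
  (((hg.smooth u hu).comp (u, t) contDiffAt_fst).clm_apply
    (hg.contDiffAt_grad_slice hu hF)).clm_apply (hg.contDiffAt_grad_slice hu hG)

/-- The metric is independent of time, so time differentiation passes through the gradient, the
Christoffel map and the trace. -/
lemma hasDerivAt_lap (hF : ∀ v ∈ U, ContDiffAt ℝ ∞ (fun q : E × ℝ => F q.1 q.2) (v, t)) :
    HasDerivAt (fun s => lap g (fun v => F v s) u) (lap g (fun v => deriv (F v) t) u) t := by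
  have h1 : HasDerivAt (fun s => fderiv ℝ (grad g (fun v => F v s)) u)
      (fderiv ℝ (grad g (fun v => deriv (F v) t)) u) t := by
    refine (hasDerivAt_fderiv_swap (G := fun v s => grad g (fun v => F v s) v)
      (hg.contDiffAt_grad_slice hu (hF u hu))).congr_deriv ?_
    refine Filter.EventuallyEq.fderiv_eq ?_
    filter_upwards [hg.mem_nhds hu] with v hv using (hasDerivAt_grad (hF v hv)).deriv
  have h2 := (chris g u).flip.hasFDerivAt.comp_hasDerivAt t (hasDerivAt_grad (g := g) (hF u hu))
  exact (tr E).hasFDerivAt.comp_hasDerivAt t (h1.add h2)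

lemma hasDerivAt_normSq (hF : ContDiffAt ℝ ∞ (fun q : E × ℝ => F q.1 q.2) (u, t)) :
    HasDerivAt (fun s => g u (grad g (fun v => F v s) u) (grad g (fun v => F v s) u))
      (2 * fderiv ℝ (fun v => deriv (F v) t) u (grad g (fun v => F v t) u)) t := by
  have h := hasDerivAt_grad (g := g) hF
  have h2 : HasDerivAt (fun s => g u (grad g (fun v => F v s) u) (grad g (fun v => F v s) u)) _ t :=
    ((g u).hasFDerivAt.comp_hasDerivAt t h).clm_apply h
  refine h2.congr_deriv ?_
  rw [Function.comp_apply, hg.symm u hu (grad g (fun v => F v t) u), hg.apply_grad hu]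
  ring

end IsMetricOn

end Time

end LocalMetric
end LocalDifferentialOperators

/-! ### Evolution of `Δ ln ψ - |∇θ|²` and its reaction terms. -/

noncomputable section LocalEvolutionEquations
set_option maxSynthPendingDepth 3
namespace LocalMetric
variable {E : Type*} [NormedAddCommGroup E] [NormedSpace ℝ E] [FiniteDimensional ℝ E]

/-- Expands the two squares to be completed, `Hess f - dθ⊗dθ` and `Hess θ + tan θ dθ⊗dθ`. -/
lemma tr_add_rankOne_sq (A : E →L[ℝ] E) (c : ℝ) (l : E →L[ℝ] ℝ) (V : E) :
    tr E ((A + c • l.smulRight V) ∘L (A + c • l.smulRight V))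
      = tr E (A ∘L A) + 2 * c * l (A V) + (c * l V) ^ 2 := by
  have h1 : tr E (A ∘L l.smulRight V) = l (A V) := by
    have : A ∘L l.smulRight V = l.smulRight (A V) := by
      ext X
      simp
    rw [this, tr_smulRight]
  have h2 : tr E (l.smulRight V ∘L l.smulRight V) = l V * l V := by
    have : l.smulRight V ∘L l.smulRight V = l V • l.smulRight V := by
      ext X
      simp [smul_smul, mul_comm]
    rw [this, map_smul, tr_smulRight, smul_eq_mul]
  have h3 : (A + c • l.smulRight V) ∘L (A + c • l.smulRight V)
      = A ∘L A + c • (A ∘L l.smulRight V) + c • (l.smulRight V ∘L A)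
        + (c * c) • (l.smulRight V ∘L l.smulRight V) := by
    ext X
    simp [smul_smul]
    abel
  rw [h3]
  simp only [map_add, map_smul, tr_comp_comm (l.smulRight V) A, h1, h2, smul_eq_mul]
  ring

namespace IsMetricOn

variable {g : E → E →L[ℝ] E →L[ℝ] ℝ} {U : Set E} (hg : IsMetricOn g U) {u : E} (hu : u ∈ U)
  {f θ : E → ℝ → ℝ} {t : ℝ}

include hg hu

/-- The evolution of `Δf - |∇θ|²` at a point where its differential vanishes. -/
theorem evolution {τ ρ : ℝ → ℝ} {a τ' ρ' : ℝ}
    (hf : ∀ v ∈ U, ContDiffAt ℝ ∞ (fun q : E × ℝ => f q.1 q.2) (v, t))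
    (hθ : ∀ v ∈ U, ContDiffAt ℝ ∞ (fun q : E × ℝ => θ q.1 q.2) (v, t))
    (ef : ∀ v ∈ U, deriv (f v) t = lap g (fun w => f w t) v
      + g v (grad g (fun w => f w t) v) (grad g (fun w => f w t) v) + a * f v t)
    (eθ : ∀ v ∈ U, deriv (θ v) t = lap g (fun w => θ w t) v
      + 2 * g v (grad g (fun w => f w t) v) (grad g (fun w => θ w t) v)
      - τ (θ v t) * g v (grad g (fun w => θ w t) v) (grad g (fun w => θ w t) v)
      + a * ρ (θ v t))
    (hτ : HasDerivAt τ τ' (θ u t)) (hρ : HasDerivAt ρ ρ' (θ u t))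
    (hcrit : fderiv ℝ (fun v => lap g (fun w => f w t) v
      - g v (grad g (fun w => θ w t) v) (grad g (fun w => θ w t) v)) u = 0) :
    HasDerivAt (fun s => lap g (fun w => f w s) u
        - g u (grad g (fun w => θ w s) u) (grad g (fun w => θ w s) u))
      (lap g (fun v => lap g (fun w => f w t) v
          - g v (grad g (fun w => θ w t) v) (grad g (fun w => θ w t) v)) u
        + 2 * tr E (hess g (fun w => f w t) u ∘L hess g (fun w => f w t) u)
        + 2 * tr E (hess g (fun w => θ w t) u ∘L hess g (fun w => θ w t) u)
        - 4 * g u (grad g (fun w => θ w t) u)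
            (hess g (fun w => f w t) u (grad g (fun w => θ w t) u))
        + 4 * τ (θ u t) * g u (grad g (fun w => θ w t) u)
            (hess g (fun w => θ w t) u (grad g (fun w => θ w t) u))
        + 2 * τ' * g u (grad g (fun w => θ w t) u) (grad g (fun w => θ w t) u) ^ 2
        + 2 * ric g u (grad g (fun w => f w t) u) + 2 * ric g u (grad g (fun w => θ w t) u)
        + a * lap g (fun w => f w t) u
        - 2 * a * ρ' * g u (grad g (fun w => θ w t) u) (grad g (fun w => θ w t) u)) t := by
  set f₀ : E → ℝ := fun w => f w t with hf₀
  set θ₀ : E → ℝ := fun w => θ w t with hθ₀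
  have sf : ∀ v ∈ U, ContDiffAt ℝ ∞ f₀ v := fun v hv => contDiffAt_slice (hf v hv)
  have sθ : ∀ v ∈ U, ContDiffAt ℝ ∞ θ₀ v := fun v hv => contDiffAt_slice (hθ v hv)
  have sL : ∀ v ∈ U, ContDiffAt ℝ ∞ (lap g f₀) v := fun v hv => hg.contDiffAt_lap hv (sf v hv)
  have sN : ∀ v ∈ U, ContDiffAt ℝ ∞ (fun v => g v (grad g f₀ v) (grad g f₀ v)) v :=
    fun v hv => hg.contDiffAt_pairing hv (sf v hv) (sf v hv)
  have sQ : ∀ v ∈ U, ContDiffAt ℝ ∞ (fun v => g v (grad g θ₀ v) (grad g θ₀ v)) v :=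
    fun v hv => hg.contDiffAt_pairing hv (sθ v hv) (sθ v hv)
  have h1 : lap g (fun v => deriv (f v) t) u = lap g (lap g f₀) u
      + lap g (fun v => g v (grad g f₀ v) (grad g f₀ v)) u + a * lap g f₀ u := by
    rw [lap_congr (G := fun v => (lap g f₀ v + g v (grad g f₀ v) (grad g f₀ v)) + a * f₀ v)
      (by filter_upwards [hg.mem_nhds hu] with v hv using ef v hv),
      hg.lap_add hu (fun v hv => (sL v hv).add (sN v hv))
        (fun v hv => contDiffAt_const.mul (sf v hv)),
      hg.lap_add hu sL sN, hg.lap_const_mul hu a sf]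
  -- Trading `ΔΔf` for `ΔP` brings in `Δ|∇θ|²`. Its Bochner formula supplies `|Hess θ|²` and
  -- `Ric(∇θ, ∇θ)`, and cancels the term `⟨∇Δθ, ∇θ⟩` coming from `θ_t`.
  have h2 : lap g (fun v => lap g f₀ v - g v (grad g θ₀ v) (grad g θ₀ v)) u
      = lap g (lap g f₀) u - lap g (fun v => g v (grad g θ₀ v) (grad g θ₀ v)) u := by
    have : (fun v => lap g f₀ v - g v (grad g θ₀ v) (grad g θ₀ v))
        = fun v => lap g f₀ v + (-1) * g v (grad g θ₀ v) (grad g θ₀ v) := by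
      ext v
      ring
    rw [this, hg.lap_add hu sL (fun v hv => contDiffAt_const.mul (sQ v hv)),
      hg.lap_const_mul hu _ sQ]
    ring
  -- At a critical point of `P` the third derivatives of `f` reduce to `Hess θ(∇f, ∇θ)`, which
  -- cancels the term that the drift `2⟨∇f, ∇θ⟩` of the angle equation produces.
  have h3 : fderiv ℝ (lap g f₀) u (grad g f₀ u)
      = 2 * g u (hess g θ₀ u (grad g f₀ u)) (grad g θ₀ u) := by
    have hc := congr($hcrit (grad g f₀ u))
    rw [fderiv_fun_sub ((sL u hu).differentiableAt (by simp))
        ((sQ u hu).differentiableAt (by simp)),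
      sub_apply, hg.fderiv_grad_pairing hu (sθ u hu) (sθ u hu)] at hc
    simp only [zero_apply] at hc
    linarith
  have h4 : fderiv ℝ (fun v => deriv (θ v) t) u (grad g θ₀ u)
      = fderiv ℝ (lap g θ₀) u (grad g θ₀ u)
        + 2 * (g u (hess g f₀ u (grad g θ₀ u)) (grad g θ₀ u)
          + g u (hess g θ₀ u (grad g θ₀ u)) (grad g f₀ u))
        - (τ (θ u t) * (2 * g u (hess g θ₀ u (grad g θ₀ u)) (grad g θ₀ u))
          + τ' * g u (grad g θ₀ u) (grad g θ₀ u) ^ 2)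
        + a * (ρ' * g u (grad g θ₀ u) (grad g θ₀ u)) := by
    have e : (fun v => deriv (θ v) t) =ᶠ[nhds u] fun v => lap g θ₀ v
        + 2 * g v (grad g f₀ v) (grad g θ₀ v)
        - τ (θ₀ v) * g v (grad g θ₀ v) (grad g θ₀ v) + a * ρ (θ₀ v) := by
      filter_upwards [hg.mem_nhds hu] with v hv using eθ v hv
    have d1 := ((hg.contDiffAt_lap hu (sθ u hu)).differentiableAt (by simp)).hasFDerivAt
    have d2 := ((hg.contDiffAt_pairing hu (sf u hu) (sθ u hu)).differentiableAt
      (by simp)).hasFDerivAt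
    have d3 := ((hg.contDiffAt_pairing hu (sθ u hu) (sθ u hu)).differentiableAt
      (by simp)).hasFDerivAt
    have d0 := ((sθ u hu).differentiableAt (by simp)).hasFDerivAt
    have d4 : HasFDerivAt (fun v => τ (θ₀ v)) (τ' • fderiv ℝ θ₀ u) u := hτ.comp_hasFDerivAt u d0
    have d5 : HasFDerivAt (fun v => ρ (θ₀ v)) (ρ' • fderiv ℝ θ₀ u) u := hρ.comp_hasFDerivAt u d0
    have d6 := ((d1.fun_add (d2.const_mul 2)).fun_sub (d4.fun_mul d3)).fun_add (d5.const_mul a)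
    rw [e.fderiv_eq, d6.fderiv]
    simp only [add_apply, sub_apply, smul_apply, hg.fderiv_grad_pairing hu (sf u hu) (sθ u hu),
      hg.fderiv_grad_pairing hu (sθ u hu) (sθ u hu), smul_eq_mul, ← hg.apply_grad hu θ₀]
    simp only [hθ₀]
    ring
  have hB1 := hg.bochner hu sf
  have hB2 := hg.bochner hu sθ
  have hmain := (hg.hasDerivAt_lap hu hf).fun_sub (hg.hasDerivAt_normSq hu (hθ u hu))
  refine hmain.congr_deriv ?_
  rw [h1, h2, hB1, hB2, h3, h4, hg.hess_symm hu (sθ u hu) (grad g f₀ u) (grad g θ₀ u),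
    hg.symm u hu (grad g θ₀ u) (hess g f₀ u (grad g θ₀ u)),
    hg.symm u hu (grad g θ₀ u) (hess g θ₀ u (grad g θ₀ u))]
  ring

end IsMetricOn

/-- The reaction term of the angle equation. -/
lemma hasDerivAt_tan_mul_log_sin {x : ℝ} (hx : x ∈ Set.Ioo 0 (Real.pi / 2)) :
    HasDerivAt (fun y => Real.tan y * Real.log (Real.sin y))
      (1 + Real.log (Real.sin x) / Real.cos x ^ 2) x := by
  have hc : Real.cos x ≠ 0 := (Real.cos_pos_of_mem_Ioo ⟨by linarith [hx.1, Real.pi_pos], hx.2⟩).ne'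
  have hs : Real.sin x ≠ 0 :=
    (Real.sin_pos_of_pos_of_lt_pi hx.1 (by linarith [hx.2, Real.pi_pos])).ne'
  refine ((Real.hasDerivAt_tan hc).mul ((Real.hasDerivAt_sin x).log hs)).congr_deriv ?_
  rw [Real.tan_eq_sin_div_cos]
  field_simp
  ring

/-- `-log h / (1 - h²) ≥ 1/2` for `0 < h < 1`. -/
lemma half_le_neg_log_div {h : ℝ} (h0 : 0 < h) (h1 : h < 1) :
    1 / 2 ≤ -Real.log h / (1 - h ^ 2) := by
  have hp : 0 < 1 - h ^ 2 := by nlinarith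
  -- `log x ≤ x - 1` at `x = h²`; the square yields the factor `1/2`.
  have := Real.log_le_sub_one_of_pos (show 0 < h ^ 2 by positivity)
  rw [Real.log_pow] at this
  rw [le_div_iff₀ hp]
  push_cast at this
  linarith

/-- The function `-log h / (1 - h²)` is decreasing on `(0, 1)`. -/
lemma neg_log_div_antitone {c h : ℝ} (hc : 0 < c) (hch : c ≤ h) (h1 : h < 1) :
    -Real.log h / (1 - h ^ 2) ≤ -Real.log c / (1 - c ^ 2) := by
  have h0 : 0 < h := hc.trans_le hch
  have hp : 0 < 1 - h ^ 2 := by nlinarith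
  have hq : 0 < 1 - c ^ 2 := by nlinarith
  rw [div_le_div_iff₀ hp hq]
  -- These weights write `h²` as a convex combination of `c²` and `1`. Monotonicity is concavity of
  -- the logarithm along this segment, with `log 1 = 0`.
  have ha0 : 0 ≤ (1 - h ^ 2) / (1 - c ^ 2) := by positivity
  have hb0 : 0 ≤ (h ^ 2 - c ^ 2) / (1 - c ^ 2) := div_nonneg (by nlinarith) hq.le
  have hab : (1 - h ^ 2) / (1 - c ^ 2) + (h ^ 2 - c ^ 2) / (1 - c ^ 2) = 1 := by
    field_simp
    ring
  have hlogc : ConcaveOn ℝ (Set.Ioi 0) Real.log := strictConcaveOn_log_Ioi.concaveOn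
  have hconc := hlogc.2 (Set.mem_Ioi.2 (show 0 < c ^ 2 by positivity)) (Set.mem_Ioi.2 one_pos)
    ha0 hb0 hab
  have he : (1 - h ^ 2) / (1 - c ^ 2) * c ^ 2 + (h ^ 2 - c ^ 2) / (1 - c ^ 2) * 1 = h ^ 2 := by
    field_simp
    ring
  simp only [smul_eq_mul, Real.log_one, mul_zero, add_zero] at hconc
  rw [mul_one] at he
  rw [mul_one, he, Real.log_pow, Real.log_pow, div_mul_eq_mul_div, div_le_iff₀ hq] at hconc
  push_cast at hconc
  linarith

namespace IsMetricOn

variable {g : E → E →L[ℝ] E →L[ℝ] ℝ} {U : Set E} (hg : IsMetricOn g U) {u : E} (hu : u ∈ U)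

include hg hu

/-- The parabolic differential inequality for `P = Δf - |∇θ|²` at a spatial minimum. -/
theorem evolution_lower_bound {f θ : E → ℝ → ℝ} {t a : ℝ} {n : ℕ}
    (hn : Module.finrank ℝ E = n) (hn0 : n ≠ 0)
    (hf : ∀ v ∈ U, ContDiffAt ℝ ∞ (fun q : E × ℝ => f q.1 q.2) (v, t))
    (hθ : ∀ v ∈ U, ContDiffAt ℝ ∞ (fun q : E × ℝ => θ q.1 q.2) (v, t))
    (ef : ∀ v ∈ U, deriv (f v) t = lap g (fun w => f w t) v
      + g v (grad g (fun w => f w t) v) (grad g (fun w => f w t) v) + a * f v t)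
    (eθ : ∀ v ∈ U, deriv (θ v) t = lap g (fun w => θ w t) v
      + 2 * g v (grad g (fun w => f w t) v) (grad g (fun w => θ w t) v)
      - Real.tan (θ v t) * g v (grad g (fun w => θ w t) v) (grad g (fun w => θ w t) v)
      + a * (Real.tan (θ v t) * Real.log (Real.sin (θ v t))))
    (hrange : θ u t ∈ Set.Ioo 0 (Real.pi / 2))
    (hcrit : fderiv ℝ (fun v => lap g (fun w => f w t) v
      - g v (grad g (fun w => θ w t) v) (grad g (fun w => θ w t) v)) u = 0)
    (hlap : 0 ≤ lap g (fun v => lap g (fun w => f w t) v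
      - g v (grad g (fun w => θ w t) v) (grad g (fun w => θ w t) v)) u)
    (hric : 0 ≤ 2 * ric g u (grad g (fun w => f w t) u) + 2 * ric g u (grad g (fun w => θ w t) u)
      + a * g u (grad g (fun w => θ w t) u) (grad g (fun w => θ w t) u)
        * (1 - 2 * (1 + Real.log (Real.sin (θ u t)) / Real.cos (θ u t) ^ 2))) :
    ∃ d, HasDerivAt (fun s => lap g (fun w => f w s) u
        - g u (grad g (fun w => θ w s) u) (grad g (fun w => θ w s) u)) d t ∧
      2 / n * (lap g (fun w => f w t) u
          - g u (grad g (fun w => θ w t) u) (grad g (fun w => θ w t) u)) ^ 2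
        + a * (lap g (fun w => f w t) u
          - g u (grad g (fun w => θ w t) u) (grad g (fun w => θ w t) u)) ≤ d := by
  have hc : Real.cos (θ u t) ≠ 0 :=
    (Real.cos_pos_of_mem_Ioo ⟨by linarith [hrange.1, Real.pi_pos], hrange.2⟩).ne'
  refine ⟨_, hg.evolution hu hf hθ ef eθ (Real.hasDerivAt_tan hc)
    (hasDerivAt_tan_mul_log_sin hrange) hcrit, ?_⟩
  have sf := contDiffAt_slice (hf u hu)
  have sθ := contDiffAt_slice (hθ u hu)
  have hAf := hg.hess_symm hu sf
  have hAθ := hg.hess_symm hu sθ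
  have hlapf : tr E (hess g (fun w => f w t) u) = lap g (fun w => f w t) u := rfl
  generalize lap g (fun v => lap g (fun w => f w t) v
      - g v (grad g (fun w => θ w t) v) (grad g (fun w => θ w t) v)) u = LP at *
  generalize hess g (fun w => f w t) u = A at *
  generalize hess g (fun w => θ w t) u = B at *
  generalize grad g (fun w => f w t) u = V at *
  generalize grad g (fun w => θ w t) u = W at *
  have hsym : ∀ (T : E →L[ℝ] E) (c : ℝ), (∀ X Y, g u (T X) Y = g u (T Y) X) → ∀ X Y,
      g u ((T + c • (g u W).smulRight W) X) Y = g u ((T + c • (g u W).smulRight W) Y) X := by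
    intro T c hT X Y
    simp only [add_apply, map_add, smul_apply, map_smul, ContinuousLinearMap.smulRight_apply,
      smul_eq_mul, hT X Y]
    ring
  -- The endomorphism `Hess f - dθ⊗dθ` has trace exactly `P`, which is where `(2/n) P²` comes from.
  -- Of the second square only the nonnegativity is used.
  have k1 := sq_tr_le (hg.symm u hu) (hg.pos u hu) (hsym A (-1) hAf) hn hn0
  have k2 := sq_tr_le (hg.symm u hu) (hg.pos u hu) (hsym B (Real.tan (θ u t)) hAθ) hn hn0
  rw [tr_add_rankOne_sq] at k1 k2
  have k3 := (show (0 : ℝ) ≤ tr E (B + Real.tan (θ u t) • (g u W).smulRight W) ^ 2 / n by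
    positivity).trans k2
  simp only [map_add, map_smul, tr_smulRight, hlapf, smul_eq_mul] at k1
  -- The coefficient `2 tan'` of `|∇θ|⁴` splits into `2` for the first square and `2 tan²` for the
  -- second, with no remainder.
  have ht : 1 / Real.cos (θ u t) ^ 2 = 1 + Real.tan (θ u t) ^ 2 := by
    rw [Real.tan_eq_sin_div_cos]
    field_simp
    linarith [Real.sin_sq_add_cos_sq (θ u t)]
  rw [ht]
  have e1 : 2 / (n : ℝ) * (lap g (fun w => f w t) u - g u W W) ^ 2
      = 2 * ((lap g (fun w => f w t) u + -1 * g u W W) ^ 2 / n) := by ring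
  rw [e1]
  nlinarith [k1, k3, hric, hlap]

/-- The equation of the logarithm of a positive solution. -/
theorem log_equation {ψ : E → ℝ → ℝ} {t a : ℝ}
    (hψ : ∀ v ∈ U, ContDiffAt ℝ ∞ (fun q : E × ℝ => ψ q.1 q.2) (v, t))
    (pos : ∀ v ∈ U, 0 < ψ v t)
    (eψ : HasDerivAt (ψ u) (lap g (fun w => ψ w t) u + a * ψ u t * Real.log (ψ u t)) t) :
    deriv (fun s => Real.log (ψ u s)) t = lap g (fun w => Real.log (ψ w t)) u
      + g u (grad g (fun w => Real.log (ψ w t)) u) (grad g (fun w => Real.log (ψ w t)) u)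
      + a * Real.log (ψ u t) := by
  have sψ : ∀ v ∈ U, ContDiffAt ℝ ∞ (fun w => ψ w t) v := fun v hv => contDiffAt_slice (hψ v hv)
  have hne : ψ u t ≠ 0 := (pos u hu).ne'
  rw [(eψ.log hne).deriv, hg.lap_comp hu (η' := fun x => x⁻¹) sψ
    (fun v hv => Real.hasDerivAt_log (pos v hv).ne') (hasDerivAt_inv hne),
    grad_comp ((sψ u hu).differentiableAt (by simp)) (Real.hasDerivAt_log hne)]
  simp only [map_smul, smul_apply, smul_eq_mul]
  field_simp
  ring

/-- The equation of the angle `arcsin (φ / ψ)` of two positive solutions `φ < ψ`. -/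
theorem angle_equation {φ ψ : E → ℝ → ℝ} {t a : ℝ}
    (hφ : ∀ v ∈ U, ContDiffAt ℝ ∞ (fun q : E × ℝ => φ q.1 q.2) (v, t))
    (hψ : ∀ v ∈ U, ContDiffAt ℝ ∞ (fun q : E × ℝ => ψ q.1 q.2) (v, t))
    (pos : ∀ v ∈ U, 0 < φ v t) (lt : ∀ v ∈ U, φ v t < ψ v t)
    (eφ : HasDerivAt (φ u) (lap g (fun w => φ w t) u + a * φ u t * Real.log (φ u t)) t)
    (eψ : HasDerivAt (ψ u) (lap g (fun w => ψ w t) u + a * ψ u t * Real.log (ψ u t)) t) :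
    (∀ v ∈ U, ContDiffAt ℝ ∞ (fun q : E × ℝ => Real.arcsin (φ q.1 q.2 / ψ q.1 q.2)) (v, t)) ∧
    deriv (fun s => Real.arcsin (φ u s / ψ u s)) t
      = lap g (fun w => Real.arcsin (φ w t / ψ w t)) u
      + 2 * g u (grad g (fun w => Real.log (ψ w t)) u)
          (grad g (fun w => Real.arcsin (φ w t / ψ w t)) u)
      - Real.tan (Real.arcsin (φ u t / ψ u t))
        * g u (grad g (fun w => Real.arcsin (φ w t / ψ w t)) u)
            (grad g (fun w => Real.arcsin (φ w t / ψ w t)) u)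
      + a * (Real.tan (Real.arcsin (φ u t / ψ u t))
        * Real.log (Real.sin (Real.arcsin (φ u t / ψ u t)))) := by
  have posψ : ∀ v ∈ U, 0 < ψ v t := fun v hv => (pos v hv).trans (lt v hv)
  have h0 : ∀ v ∈ U, 0 < φ v t / ψ v t := fun v hv => div_pos (pos v hv) (posψ v hv)
  have h1 : ∀ v ∈ U, φ v t / ψ v t < 1 := fun v hv => (div_lt_one (posψ v hv)).2 (lt v hv)
  have hs : ∀ v ∈ U,
      ContDiffAt ℝ ∞ (fun q : E × ℝ => Real.arcsin (φ q.1 q.2 / ψ q.1 q.2)) (v, t) := by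
    intro v hv
    have := (Real.contDiffAt_arcsin (n := ∞) (x := φ v t / ψ v t) (by linarith [h0 v hv])
      (h1 v hv).ne)
    exact ContDiffAt.comp (v, t) (f := fun q : E × ℝ => φ q.1 q.2 / ψ q.1 q.2) this
      ((hφ v hv).div (hψ v hv) (posψ v hv).ne')
  refine ⟨hs, ?_⟩
  set θ : E → ℝ → ℝ := fun v s => Real.arcsin (φ v s / ψ v s) with hθ
  have sφ : ∀ v ∈ U, ContDiffAt ℝ ∞ (fun w => φ w t) v := fun v hv => contDiffAt_slice (hφ v hv)
  have sψ : ∀ v ∈ U, ContDiffAt ℝ ∞ (fun w => ψ w t) v := fun v hv => contDiffAt_slice (hψ v hv)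
  have sθ : ∀ v ∈ U, ContDiffAt ℝ ∞ (fun w => θ w t) v :=
    fun v hv => contDiffAt_slice (F := θ) (hs v hv)
  have hsin : ∀ v ∈ U, Real.sin (θ v t) = φ v t / ψ v t := fun v hv =>
    Real.sin_arcsin (by linarith [h0 v hv]) (h1 v hv).le
  -- The equation of `φ` is expanded through this product and solved for `θ_t`, so arcsine is never
  -- differentiated explicitly.
  have hφeq : ∀ v ∈ U, φ v t = ψ v t * Real.sin (θ v t) := fun v hv => by
    rw [hsin v hv, mul_div_cancel₀ _ (posψ v hv).ne']
  have hne : ψ u t ≠ 0 := (posψ u hu).ne'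
  have hcos : 0 < Real.cos (θ u t) := by
    refine Real.cos_pos_of_mem_Ioo ⟨?_, ?_⟩
    · exact Real.neg_pi_div_two_lt_arcsin.2 (by linarith [h0 u hu])
    · exact Real.arcsin_lt_pi_div_two.2 (h1 u hu)
  have hsinpos : 0 < Real.sin (θ u t) := by rw [hsin u hu]; exact h0 u hu
  have hlapφ : lap g (fun w => φ w t) u = ψ u t * (Real.cos (θ u t) * lap g (fun w => θ w t) u
        + -Real.sin (θ u t) * g u (grad g (fun w => θ w t) u) (grad g (fun w => θ w t) u))
      + Real.sin (θ u t) * lap g (fun w => ψ w t) u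
      + 2 * g u (grad g (fun w => ψ w t) u) (Real.cos (θ u t) • grad g (fun w => θ w t) u) := by
    rw [lap_congr (G := fun w => ψ w t * Real.sin (θ w t))
      (by filter_upwards [hg.mem_nhds hu] with v hv using hφeq v hv),
      hg.lap_mul hu (G := fun w => Real.sin (θ w t)) sψ
        (fun v hv => Real.contDiff_sin.contDiffAt.comp v (sθ v hv)),
      hg.lap_comp hu (η := Real.sin) (η' := Real.cos) sθ (fun v _ => Real.hasDerivAt_sin _)
        (Real.hasDerivAt_cos _),
      grad_comp (η := Real.sin) ((sθ u hu).differentiableAt (by simp)) (Real.hasDerivAt_sin _)]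
  have hgradlog : grad g (fun w => Real.log (ψ w t)) u = (ψ u t)⁻¹ • grad g (fun w => ψ w t) u :=
    grad_comp ((sψ u hu).differentiableAt (by simp)) (Real.hasDerivAt_log hne)
  have hθd : HasDerivAt (θ u) (deriv (θ u) t) t :=
    ((contDiffAt_time (F := θ) (hs u hu)).differentiableAt (by simp)).hasDerivAt
  have hφd : HasDerivAt (φ u) ((lap g (fun w => ψ w t) u + a * ψ u t * Real.log (ψ u t))
      * Real.sin (θ u t) + ψ u t * (Real.cos (θ u t) * deriv (θ u) t)) t := by
    refine (eψ.mul hθd.sin).congr_of_eventuallyEq ?_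
    have c1 : ∀ᶠ s in nhds t, 0 < φ u s := eφ.continuousAt.eventually (lt_mem_nhds (pos u hu))
    have c2 : ∀ᶠ s in nhds t, 0 < ψ u s := eψ.continuousAt.eventually (lt_mem_nhds (posψ u hu))
    have c3 : ∀ᶠ s in nhds t, φ u s < ψ u s :=
      eφ.continuousAt.eventually_lt eψ.continuousAt (lt u hu)
    filter_upwards [c1, c2, c3] with s s1 s2 s3
    have q0 : 0 < φ u s / ψ u s := div_pos s1 s2
    have : Real.sin (θ u s) = φ u s / ψ u s :=
      Real.sin_arcsin (by linarith) ((div_le_one s2).2 s3.le)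
    rw [Pi.mul_apply, this, mul_div_cancel₀ _ s2.ne']
  have huniq := eφ.unique hφd
  have hlogφ : Real.log (φ u t) = Real.log (ψ u t) + Real.log (Real.sin (θ u t)) := by
    rw [hφeq u hu, Real.log_mul hne hsinpos.ne']
  rw [hlapφ, hlogφ, hφeq u hu] at huniq
  rw [hgradlog]
  change deriv (θ u) t = lap g (fun w => θ w t) u
    + 2 * g u ((ψ u t)⁻¹ • grad g (fun w => ψ w t) u) (grad g (fun w => θ w t) u)
    - Real.tan (θ u t) * g u (grad g (fun w => θ w t) u) (grad g (fun w => θ w t) u)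
    + a * (Real.tan (θ u t) * Real.log (Real.sin (θ u t)))
  rw [Real.tan_eq_sin_div_cos]
  simp only [map_smul, smul_apply, smul_eq_mul] at huniq ⊢
  field_simp
  linarith

end IsMetricOn

end LocalMetric
end LocalEvolutionEquations

/-! ### Invariance of the Laplacian under local isometries. -/

noncomputable section LocalIsometries
set_option maxSynthPendingDepth 3
namespace LocalMetric
variable {E : Type*} [NormedAddCommGroup E] [NormedSpace ℝ E] [FiniteDimensional ℝ E]

/-- `Φ` is a smooth local isometry from `(W, g')` to `(U, g)`. -/
structure IsIsometryOn (g' : E → E →L[ℝ] E →L[ℝ] ℝ) (W : Set E) (g : E → E →L[ℝ] E →L[ℝ] ℝ)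
    (U : Set E) (Φ : E → E) : Prop where
  mapsTo : ∀ v ∈ W, Φ v ∈ U
  smooth : ∀ v ∈ W, ContDiffAt ℝ ∞ Φ v
  pullback : ∀ v ∈ W, ∀ X Y, g' v X Y = g (Φ v) (fderiv ℝ Φ v X) (fderiv ℝ Φ v Y)

namespace IsIsometryOn

variable {g g' : E → E →L[ℝ] E →L[ℝ] ℝ} {U W : Set E} {Φ : E → E}
  (hΦ : IsIsometryOn g' W g U Φ) (hg : IsMetricOn g U) (hg' : IsMetricOn g' W) {v : E} (hv : v ∈ W)

include hΦ hg hg' hv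

-- Vectors with the same image under `dΦ` pair identically in the pulled-back metric, so `dΦ` is
-- injective, hence invertible in equal dimensions.
omit hg in
lemma exists_inverse : ∃ M : E →L[ℝ] E, M ∘L fderiv ℝ Φ v = ContinuousLinearMap.id ℝ E ∧
    fderiv ℝ Φ v ∘L M = ContinuousLinearMap.id ℝ E := by
  have hinj : Function.Injective (fderiv ℝ Φ v : E →ₗ[ℝ] E) := fun X Y h =>
    hg'.ext hv fun Z => by
      have : fderiv ℝ Φ v X = fderiv ℝ Φ v Y := h
      rw [hΦ.pullback v hv, hΦ.pullback v hv, this]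
  let e := (LinearEquiv.ofInjectiveEndo _ hinj).toContinuousLinearEquiv
  have he : ∀ X, e X = fderiv ℝ Φ v X := fun X => rfl
  refine ⟨e.symm, ?_, ?_⟩
  · ext X
    simp [← he]
  · ext X
    simp [← he]

lemma ext_of_pairing {X Y : E}
    (h : ∀ Z, g (Φ v) X (fderiv ℝ Φ v Z) = g (Φ v) Y (fderiv ℝ Φ v Z)) : X = Y := by
  obtain ⟨M, -, hM⟩ := hΦ.exists_inverse hg' hv
  refine hg.ext (hΦ.mapsTo v hv) fun Z => ?_
  have := congr($hM Z)
  simp only [ContinuousLinearMap.comp_apply, ContinuousLinearMap.id_apply] at this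
  rw [← this]
  exact h _

omit [FiniteDimensional ℝ E] in
lemma fderiv_pullback (X Y Z : E) : fderiv ℝ g' v X Y Z
    = fderiv ℝ g (Φ v) (fderiv ℝ Φ v X) (fderiv ℝ Φ v Y) (fderiv ℝ Φ v Z)
      + g (Φ v) (fderiv ℝ (fderiv ℝ Φ) v X Y) (fderiv ℝ Φ v Z)
      + g (Φ v) (fderiv ℝ Φ v Y) (fderiv ℝ (fderiv ℝ Φ) v X Z) := by
  have h1 : HasFDerivAt (fun w => g' w Y Z) _ v :=
    ((((hg'.smooth v hv).differentiableAt (by simp)).hasFDerivAt.clm_apply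
      (hasFDerivAt_const Y v)).clm_apply (hasFDerivAt_const Z v))
  have hd : HasFDerivAt (fderiv ℝ Φ) _ v :=
    (((hΦ.smooth v hv).fderiv_right (m := ∞) (by simp)).differentiableAt (by simp)).hasFDerivAt
  have hgd : HasFDerivAt (fun w => g (Φ w)) _ v :=
    ((hg.smooth _ (hΦ.mapsTo v hv)).differentiableAt (by simp)).hasFDerivAt.comp v
      ((hΦ.smooth v hv).differentiableAt (by simp)).hasFDerivAt
  have h2 := (hgd.clm_apply (hd.clm_apply (hasFDerivAt_const Y v))).clm_apply
    (hd.clm_apply (hasFDerivAt_const Z v))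
  have h3 := h2.congr_of_eventuallyEq (f₁ := fun w => g' w Y Z) (by
    filter_upwards [hg'.mem_nhds hv] with w hw using hΦ.pullback w hw Y Z)
  have := congr($(h1.unique h3) X)
  simp at this
  rw [this]
  ring

/-- The transformation law of the Christoffel map. -/
lemma fderiv_chris (X Y : E) : fderiv ℝ Φ v (chris g' v X Y)
    = chris g (Φ v) (fderiv ℝ Φ v X) (fderiv ℝ Φ v Y) + fderiv ℝ (fderiv ℝ Φ) v X Y := by
  have hsym : ∀ X Y, fderiv ℝ (fderiv ℝ Φ) v X Y = fderiv ℝ (fderiv ℝ Φ) v Y X :=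
    ((hΦ.smooth v hv).isSymmSndFDerivAt (by simp; norm_cast)).eq
  have hu := hΦ.mapsTo v hv
  refine hΦ.ext_of_pairing hg hg' hv fun Z => ?_
  rw [← hΦ.pullback v hv, hg'.apply_chris hv, map_add, add_apply, hg.apply_chris hu,
    koszul_apply, koszul_apply]
  -- The Koszul formula of the pullback has six second-derivative terms; symmetry of `D²Φ` cancels
  -- all of them except `g(D²Φ(X, Y), dΦ Z)`.
  simp only [hΦ.fderiv_pullback hg hg' hv]
  rw [hsym Y X, hsym Z X, hsym Z Y, hg.symm _ hu (fderiv ℝ Φ v Y),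
    hg.symm _ hu (fderiv ℝ Φ v X) (fderiv ℝ (fderiv ℝ Φ) v Y Z)]
  ring

lemma fderiv_grad {F : E → ℝ} (hF : ContDiffAt ℝ ∞ F (Φ v)) :
    fderiv ℝ Φ v (grad g' (fun w => F (Φ w)) v) = grad g F (Φ v) := by
  refine hΦ.ext_of_pairing hg hg' hv fun Z => ?_
  have h : HasFDerivAt (fun w => F (Φ w)) _ v :=
    (hF.differentiableAt (by simp)).hasFDerivAt.comp v
      ((hΦ.smooth v hv).differentiableAt (by simp)).hasFDerivAt
  rw [← hΦ.pullback v hv, hg'.apply_grad hv, hg.apply_grad (hΦ.mapsTo v hv), h.fderiv]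
  rfl

/-- The Laplacian is invariant under isometries. -/
theorem lap_comp {F : E → ℝ} (hF : ∀ u ∈ U, ContDiffAt ℝ ∞ F u) :
    lap g' (fun w => F (Φ w)) v = lap g F (Φ v) := by
  have hu := hΦ.mapsTo v hv
  have hFs : ∀ w ∈ W, ContDiffAt ℝ ∞ (fun w => F (Φ w)) w := fun w hw =>
    (hF _ (hΦ.mapsTo w hw)).comp w (hΦ.smooth w hw)
  have hΦd := ((hΦ.smooth v hv).differentiableAt (by simp)).hasFDerivAt
  have hd : HasFDerivAt (fderiv ℝ Φ) _ v :=
    (((hΦ.smooth v hv).fderiv_right (m := ∞) (by simp)).differentiableAt (by simp)).hasFDerivAt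
  have h1 : HasFDerivAt (fun w => fderiv ℝ Φ w (grad g' (fun w => F (Φ w)) w)) _ v :=
    hd.clm_apply ((hg'.contDiffAt_grad hv (hFs v hv)).differentiableAt (by simp)).hasFDerivAt
  have h2 : HasFDerivAt (fun w => grad g F (Φ w)) _ v :=
    ((hg.contDiffAt_grad hu (hF _ hu)).differentiableAt (by simp)).hasFDerivAt.comp v hΦd
  have h3 := h2.congr_of_eventuallyEq
    (f₁ := fun w => fderiv ℝ Φ w (grad g' (fun w => F (Φ w)) w)) (by
      filter_upwards [hg'.mem_nhds hv] with w hw using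
        hΦ.fderiv_grad hg hg' hw (hF _ (hΦ.mapsTo w hw)))
  -- Differentiating `dΦ(grad') = grad ∘ Φ` yields a term `D²Φ`, which the transformation law of the
  -- Christoffel map removes. The Hessians are thus conjugate by `dΦ`, with equal traces.
  have key : fderiv ℝ Φ v ∘L hess g' (fun w => F (Φ w)) v = hess g F (Φ v) ∘L fderiv ℝ Φ v := by
    ext1 X
    have := congr($(h1.unique h3) X)
    simp only [add_apply, ContinuousLinearMap.comp_apply, ContinuousLinearMap.flip_apply] at this
    simp only [ContinuousLinearMap.comp_apply, hess_apply, map_add]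
    rw [hΦ.fderiv_chris hg hg' hv, hΦ.fderiv_grad hg hg' hv (hF _ hu), ← this]
    abel
  obtain ⟨M, hM1, hM2⟩ := hΦ.exists_inverse hg' hv
  have : hess g' (fun w => F (Φ w)) v = M ∘L (hess g F (Φ v) ∘L fderiv ℝ Φ v) := by
    rw [← key, ← ContinuousLinearMap.comp_assoc, hM1, ContinuousLinearMap.id_comp]
  rw [lap, this, tr_comp_comm, ContinuousLinearMap.comp_assoc, hM2, ContinuousLinearMap.comp_id,
    lap]

end IsIsometryOn

end LocalMetric
end LocalIsometries

/-! ### The Riemannian metric read in a chart. -/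

noncomputable section RiemannianCharts
set_option maxSynthPendingDepth 3
namespace HarnackGeometry

variable {n : ℕ}

/-- The `i`-th coordinate on `ℝⁿ`. -/
def coordForm (i : Fin n) : EuclideanSpace ℝ (Fin n) →L[ℝ] ℝ := EuclideanSpace.proj i

@[simp] lemma coordForm_apply (i : Fin n) (X : EuclideanSpace ℝ (Fin n)) : coordForm i X = X i :=
  rfl

variable {M : Type*} [MetricSpace M] [ChartedSpace (EuclideanSpace ℝ (Fin n)) M]

/-- The derivative of the inverse chart at `p`, applied to a coordinate vector. -/
def chartPush (p : M) (u X : EuclideanSpace ℝ (Fin n)) :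
    TangentSpace (𝓡 n) ((extChartAt (𝓡 n) p).symm u) :=
  mfderiv 𝓘(ℝ, EuclideanSpace ℝ (Fin n)) (𝓡 n) (extChartAt (𝓡 n) p).symm u X

lemma chartPush_add (p : M) (u X Y : EuclideanSpace ℝ (Fin n)) :
    chartPush p u (X + Y) = chartPush p u X + chartPush p u Y :=
  map_add (mfderiv 𝓘(ℝ, EuclideanSpace ℝ (Fin n)) (𝓡 n) (extChartAt (𝓡 n) p).symm u) X Y

lemma chartPush_smul (p : M) (u X : EuclideanSpace ℝ (Fin n)) (c : ℝ) :
    chartPush p u (c • X) = c • chartPush p u X :=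
  map_smul (mfderiv 𝓘(ℝ, EuclideanSpace ℝ (Fin n)) (𝓡 n) (extChartAt (𝓡 n) p).symm u) c X

lemma chartPush_zero (p : M) (u : EuclideanSpace ℝ (Fin n)) :
    chartPush p u 0 = 0 :=
  map_zero (mfderiv 𝓘(ℝ, EuclideanSpace ℝ (Fin n)) (𝓡 n) (extChartAt (𝓡 n) p).symm u)

lemma chartPush_sum (p : M) (u X : EuclideanSpace ℝ (Fin n)) :
    chartPush p u X = ∑ i, X i • chartPush p u (stdVec i) := by
  have h : X = ∑ i, X i • stdVec i := by
    ext k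
    simp [stdVec, Pi.single_apply]
  have hs : ∀ s : Finset (Fin n), chartPush p u (∑ i ∈ s, X i • stdVec i)
      = ∑ i ∈ s, X i • chartPush p u (stdVec i) := by
    intro s
    classical
    induction s using Finset.induction_on with
    | empty => exact (chartPush_zero p u).trans Finset.sum_empty.symm
    | insert i s hi ih => rw [Finset.sum_insert hi, Finset.sum_insert hi, chartPush_add, ih,
        chartPush_smul]
  conv_lhs => rw [h]
  exact hs _

lemma mdifferentiableAt_chart_symm [IsManifold (𝓡 n) ∞ M] {p : M} {u : EuclideanSpace ℝ (Fin n)}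
    (hu : u ∈ (extChartAt (𝓡 n) p).target) :
    MDifferentiableAt 𝓘(ℝ, EuclideanSpace ℝ (Fin n)) (𝓡 n) (extChartAt (𝓡 n) p).symm u :=
  ((contMDiffOn_extChartAt_symm (n := ∞) p).contMDiffAt
    ((isOpen_extChartAt_target p).mem_nhds hu)).mdifferentiableAt (by simp)

lemma mdifferentiableAt_chart [IsManifold (𝓡 n) ∞ M] {p x : M}
    (hx : x ∈ (extChartAt (𝓡 n) p).source) :
    MDifferentiableAt (𝓡 n) 𝓘(ℝ, EuclideanSpace ℝ (Fin n)) (extChartAt (𝓡 n) p) x :=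
  mdifferentiableAt_extChartAt (by rwa [extChartAt_source] at hx)

/-- The chart derivative, valued in `ℝⁿ`. -/
def chartPull (p x : M) (v : TangentSpace (𝓡 n) x) : EuclideanSpace ℝ (Fin n) :=
  mfderiv (𝓡 n) 𝓘(ℝ, EuclideanSpace ℝ (Fin n)) (extChartAt (𝓡 n) p) x v

lemma chartPush_chartPull [IsManifold (𝓡 n) ∞ M] {p : M} {u : EuclideanSpace ℝ (Fin n)}
    (hu : u ∈ (extChartAt (𝓡 n) p).target)
    (v : TangentSpace (𝓡 n) ((extChartAt (𝓡 n) p).symm u)) :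
    chartPush p u (chartPull p _ v) = v := by
  have := congr($(mfderivWithin_extChartAt_symm_comp_mfderiv_extChartAt (I := 𝓡 n) hu) v)
  rw [ModelWithCorners.range_eq_univ, mfderivWithin_univ] at this
  exact this

lemma chartPull_chartPush [IsManifold (𝓡 n) ∞ M] {p : M} {u : EuclideanSpace ℝ (Fin n)}
    (hu : u ∈ (extChartAt (𝓡 n) p).target) (X : EuclideanSpace ℝ (Fin n)) :
    chartPull p _ (chartPush p u X) = X := by
  have := congr($(mfderiv_extChartAt_comp_mfderivWithin_extChartAt_symm (I := 𝓡 n) hu) X)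
  rw [ModelWithCorners.range_eq_univ, mfderivWithin_univ] at this
  exact this

variable [Bundle.RiemannianBundle (fun x : M => TangentSpace (𝓡 n) x)]

/-- The metric in the chart at `p`, as a field of bilinear forms. -/
def chartMetric (p : M) (u : EuclideanSpace ℝ (Fin n)) :
    EuclideanSpace ℝ (Fin n) →L[ℝ] EuclideanSpace ℝ (Fin n) →L[ℝ] ℝ :=
  ∑ i, ∑ j, metricMatrix p u i j •
    (coordForm i).smulRight (coordForm j)

lemma chartMetric_apply' (p : M) (u X Y : EuclideanSpace ℝ (Fin n)) :
    chartMetric p u X Y = ∑ i, ∑ j, metricMatrix p u i j * (X i * Y j) := by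
  simp [chartMetric]

lemma chartMetric_stdVec (p : M) (u : EuclideanSpace ℝ (Fin n)) (i j : Fin n) :
    chartMetric p u (stdVec i) (stdVec j) = metricMatrix p u i j := by
  simp [chartMetric_apply', stdVec]

lemma chartMetric_apply (p : M) (u X Y : EuclideanSpace ℝ (Fin n)) :
    chartMetric p u X Y = inner ℝ (chartPush p u X) (chartPush p u Y) := by
  rw [chartMetric_apply', chartPush_sum p u X, chartPush_sum p u Y, sum_inner]
  refine Finset.sum_congr rfl fun i _ => ?_
  rw [inner_sum]
  refine Finset.sum_congr rfl fun j _ => ?_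
  rw [real_inner_smul_left, real_inner_smul_right]
  change inner ℝ (chartPush p u (stdVec i)) (chartPush p u (stdVec j)) * _ = _
  ring

variable [IsManifold (𝓡 n) ∞ M] [IsContMDiffRiemannianBundle (𝓡 n) ∞ (EuclideanSpace ℝ (Fin n))
      (fun x : M => TangentSpace (𝓡 n) x)]

/-- The coordinate fields are images of constant fields under the tangent map of the inverse chart,
hence smooth, and a smooth bundle metric pairs smooth fields smoothly. -/
lemma contDiffOn_metricMatrix (p : M) (i j : Fin n) :
    ContDiffOn ℝ ∞ (fun u => metricMatrix p u i j) (extChartAt (𝓡 n) p).target := by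
  have hT := (contMDiffOn_extChartAt_symm (I := 𝓡 n) (n := ∞) p).contMDiffOn_tangentMapWithin
    (m := ∞) (by simp) (isOpen_extChartAt_target p).uniqueMDiffOn
  have hv : ∀ i : Fin n, ContMDiffOn 𝓘(ℝ, EuclideanSpace ℝ (Fin n)) (𝓡 n).tangent ∞
      (fun u => (⟨_, coordVec p u i⟩ : TangentBundle (𝓡 n) M)) (extChartAt (𝓡 n) p).target := by
    intro i
    have hc : ContMDiffOn 𝓘(ℝ, EuclideanSpace ℝ (Fin n))
        (𝓘(ℝ, EuclideanSpace ℝ (Fin n)).tangent) ∞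
        (fun u => (⟨u, stdVec i⟩ : TangentBundle 𝓘(ℝ, EuclideanSpace ℝ (Fin n))
          (EuclideanSpace ℝ (Fin n)))) (extChartAt (𝓡 n) p).target :=
      contMDiffOn_vectorSpace_iff_contDiffOn.2 contDiffOn_const
    refine (hT.comp hc fun u hu => hu).congr fun u hu => ?_
    simp only [Function.comp_apply, tangentMapWithin]
    rw [mfderivWithin_of_isOpen (isOpen_extChartAt_target p) hu]
    rfl
  exact contMDiffOn_iff_contDiffOn.1 ((hv i).inner_bundle (hv j))

/-- The bridge from the manifold to the calculus on open sets. Definiteness holds because the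
derivative of the inverse chart has the chart derivative as a left inverse. -/
theorem isMetricOn_chartMetric (p : M) :
    LocalMetric.IsMetricOn (chartMetric p) (extChartAt (𝓡 n) p).target where
  isOpen := isOpen_extChartAt_target p
  smooth u hu := by
    unfold chartMetric
    refine ContDiffAt.sum fun i _ => ContDiffAt.sum fun j _ => ?_
    exact ((contDiffOn_metricMatrix p i j).contDiffAt
      ((isOpen_extChartAt_target p).mem_nhds hu)).smul contDiffAt_const
  symm u _ X Y := by rw [chartMetric_apply, chartMetric_apply, real_inner_comm]
  pos u hu X hX := by
    rw [chartMetric_apply]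
    refine real_inner_self_pos.2 fun h => hX ?_
    rw [← chartPull_chartPush hu X, h]
    exact map_zero (mfderiv (𝓡 n) 𝓘(ℝ, EuclideanSpace ℝ (Fin n)) (extChartAt (𝓡 n) p) _)

end HarnackGeometry
end RiemannianCharts

/-! ### Agreement with the index formulas for the Laplacian and the Ricci tensor. -/

noncomputable section ClassicalCoordinates
set_option maxSynthPendingDepth 3
namespace HarnackGeometry

variable {n : ℕ}

lemma sum_smul_stdVec (X : EuclideanSpace ℝ (Fin n)) : ∑ i, X i • stdVec i = X := by
  ext k
  simp [stdVec, Pi.single_apply]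

lemma sum_stdVec_left (k : Fin n) (c : Fin n → ℝ) : ∑ i, (stdVec k) i * c i = c k := by
  simp [stdVec]

lemma linear_eq_sum {W : Type*} [NormedAddCommGroup W] [NormedSpace ℝ W]
    (A : EuclideanSpace ℝ (Fin n) →L[ℝ] W) (X : EuclideanSpace ℝ (Fin n)) :
    A X = ∑ i, X i • A (stdVec i) := by
  conv_lhs => rw [← sum_smul_stdVec X]
  rw [map_sum]
  exact Finset.sum_congr rfl fun i _ => map_smul _ _ _

lemma bilinear_eq_sum {W : Type*} [NormedAddCommGroup W] [NormedSpace ℝ W]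
    (B : EuclideanSpace ℝ (Fin n) →L[ℝ] EuclideanSpace ℝ (Fin n) →L[ℝ] W)
    (X Y : EuclideanSpace ℝ (Fin n)) :
    B X Y = ∑ i, ∑ j, (X i * Y j) • B (stdVec i) (stdVec j) := by
  rw [linear_eq_sum B X, sum_apply]
  refine Finset.sum_congr rfl fun i _ => ?_
  rw [smul_apply, linear_eq_sum (B (stdVec i)) Y, Finset.smul_sum]
  exact Finset.sum_congr rfl fun j _ => smul_smul _ _ _

lemma form_eq_sum (l : EuclideanSpace ℝ (Fin n) →L[ℝ] ℝ) :
    l = ∑ i, l (stdVec i) • coordForm i := by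
  ext X
  rw [linear_eq_sum l X, sum_apply]
  exact Finset.sum_congr rfl fun i _ => by simp [mul_comm]

lemma tr_eq_sum (A : EuclideanSpace ℝ (Fin n) →L[ℝ] EuclideanSpace ℝ (Fin n)) :
    LocalMetric.tr _ A = ∑ i, (A (stdVec i)) i := by
  rw [LocalMetric.tr_apply,
    LinearMap.trace_eq_matrix_trace ℝ (EuclideanSpace.basisFun (Fin n) ℝ).toBasis, Matrix.trace]
  refine Finset.sum_congr rfl fun i _ => ?_
  rw [Matrix.diag_apply, LinearMap.toMatrix_apply]
  simp [stdVec]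

lemma fderiv_coord_apply {g : EuclideanSpace ℝ (Fin n) → EuclideanSpace ℝ (Fin n) →L[ℝ]
      EuclideanSpace ℝ (Fin n) →L[ℝ] EuclideanSpace ℝ (Fin n)} {u : EuclideanSpace ℝ (Fin n)}
    (hg : DifferentiableAt ℝ g u) (Z X Y : EuclideanSpace ℝ (Fin n)) (k : Fin n) :
    (fderiv ℝ g u Z X Y) k = fderiv ℝ (fun v => (g v X Y) k) u Z := by
  have h : HasFDerivAt (fun v => g v X Y) _ u :=
    (hg.hasFDerivAt.clm_apply (hasFDerivAt_const X u)).clm_apply (hasFDerivAt_const Y u)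
  have h2 : HasFDerivAt (fun v => coordForm k (g v X Y)) _ u :=
    (coordForm k).hasFDerivAt.comp u h
  have h3 := h2.fderiv
  simp only [coordForm_apply] at h3
  rw [h3]
  simp

variable {M : Type*} [MetricSpace M] [ChartedSpace (EuclideanSpace ℝ (Fin n)) M]
  [Bundle.RiemannianBundle (fun x : M => TangentSpace (𝓡 n) x)]

lemma metricMatrix_symm (p : M) (u : EuclideanSpace ℝ (Fin n)) (i j : Fin n) :
    metricMatrix p u i j = metricMatrix p u j i := by
  simp only [metricMatrix, Matrix.of_apply]
  exact real_inner_comm _ _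

lemma christoffel_symm (p : M) (k i j : Fin n) : christoffel p k i j = christoffel p k j i := by
  ext u
  unfold christoffel
  congr 1
  refine Finset.sum_congr rfl fun l _ => ?_
  have h : (fun v => metricMatrix p v i j) = fun v => metricMatrix p v j i :=
    funext fun v => metricMatrix_symm p v i j
  rw [h]
  ring

variable [IsManifold (𝓡 n) ∞ M] [IsContMDiffRiemannianBundle (𝓡 n) ∞ (EuclideanSpace ℝ (Fin n))
      (fun x : M => TangentSpace (𝓡 n) x)] {p : M} {u : EuclideanSpace ℝ (Fin n)}
  (hu : u ∈ (extChartAt (𝓡 n) p).target)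

include hu

/-- The columns of `(gⁱʲ)` are the vectors dual to the coordinate forms; this translates the matrix
inverse of the index formulas into the inverse of the linear map. -/
lemma metricMatrix_inv (i j : Fin n) :
    (metricMatrix p u)⁻¹ i j = ((chartMetric p u).inverse (coordForm j)) i := by
  have hg := isMetricOn_chartMetric (n := n) p
  have h : metricMatrix p u * Matrix.of (fun i j => ((chartMetric p u).inverse (coordForm j)) i)
      = 1 := by
    ext i j
    have h1 := congr($(hg.apply_inverse hu (coordForm j)) (stdVec i))
    rw [hg.symm u hu, linear_eq_sum (chartMetric p u (stdVec i))] at h1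
    simp only [chartMetric_stdVec, coordForm_apply, smul_eq_mul] at h1
    rw [Matrix.mul_apply]
    simp only [Matrix.of_apply]
    rw [Finset.sum_congr rfl fun k _ => mul_comm _ _, h1]
    simp [stdVec, Matrix.one_apply, eq_comm]
  rw [Matrix.inv_eq_right_inv h, Matrix.of_apply]

lemma inverse_eq_sum (l : EuclideanSpace ℝ (Fin n) →L[ℝ] ℝ) (k : Fin n) :
    ((chartMetric p u).inverse l) k = ∑ m, (metricMatrix p u)⁻¹ k m * l (stdVec m) := by
  conv_lhs => rw [form_eq_sum l]
  rw [map_sum, ← coordForm_apply, map_sum]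
  refine Finset.sum_congr rfl fun m _ => ?_
  rw [metricMatrix_inv hu, map_smul, map_smul, coordForm_apply, smul_eq_mul, mul_comm]

lemma partialDeriv_metricMatrix (i j l : Fin n) :
    partialDeriv i (fun v => metricMatrix p v j l) u
      = fderiv ℝ (chartMetric p) u (stdVec i) (stdVec j) (stdVec l) := by
  have hd : DifferentiableAt ℝ (chartMetric p) u :=
    ((isMetricOn_chartMetric p).smooth u hu).differentiableAt (by simp)
  have h : HasFDerivAt (fun v => chartMetric p v (stdVec j) (stdVec l)) _ u :=
    (hd.hasFDerivAt.clm_apply (hasFDerivAt_const (stdVec j) u)).clm_apply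
      (hasFDerivAt_const (stdVec l) u)
  simp only [chartMetric_stdVec] at h
  rw [partialDeriv, h.fderiv]
  simp

lemma chris_stdVec (k i j : Fin n) :
    (LocalMetric.chris (chartMetric p) u (stdVec i) (stdVec j)) k = christoffel p k i j u := by
  have h : LocalMetric.chris (chartMetric p) u (stdVec i) (stdVec j)
      = (chartMetric p u).inverse (LocalMetric.koszul (chartMetric p) u (stdVec i) (stdVec j)) :=
    rfl
  rw [h, inverse_eq_sum hu, christoffel, Finset.mul_sum]
  refine Finset.sum_congr rfl fun l _ => ?_
  rw [LocalMetric.koszul_apply, partialDeriv_metricMatrix hu, partialDeriv_metricMatrix hu,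
    partialDeriv_metricMatrix hu]
  ring

lemma chris_apply_coord (X Y : EuclideanSpace ℝ (Fin n)) (k : Fin n) :
    (LocalMetric.chris (chartMetric p) u X Y) k = ∑ i, ∑ j, X i * Y j * christoffel p k i j u := by
  rw [bilinear_eq_sum, ← coordForm_apply, map_sum]
  refine Finset.sum_congr rfl fun i _ => ?_
  rw [map_sum]
  refine Finset.sum_congr rfl fun j _ => ?_
  rw [map_smul, coordForm_apply, chris_stdVec hu, smul_eq_mul]

lemma fderiv_chris_stdVec (k i j m : Fin n) :
    (fderiv ℝ (LocalMetric.chris (chartMetric p)) u (stdVec m) (stdVec i) (stdVec j)) k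
      = partialDeriv m (christoffel p k i j) u := by
  have hg := isMetricOn_chartMetric (n := n) p
  rw [fderiv_coord_apply ((hg.contDiffAt_chris hu).differentiableAt (by simp)), partialDeriv]
  have : (fun v => (LocalMetric.chris (chartMetric p) v (stdVec i) (stdVec j)) k)
      =ᶠ[nhds u] christoffel p k i j := by
    filter_upwards [hg.mem_nhds hu] with v hv using chris_stdVec hv k i j
  rw [this.fderiv_eq]

lemma fderiv_chris_coord (Z X Y : EuclideanSpace ℝ (Fin n)) (k : Fin n) :
    (fderiv ℝ (LocalMetric.chris (chartMetric p)) u Z X Y) k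
      = ∑ i, ∑ j, X i * Y j * ∑ m, Z m * partialDeriv m (christoffel p k i j) u := by
  rw [bilinear_eq_sum, ← coordForm_apply, map_sum]
  refine Finset.sum_congr rfl fun i _ => ?_
  rw [map_sum]
  refine Finset.sum_congr rfl fun j _ => ?_
  rw [map_smul, smul_eq_mul, linear_eq_sum (fderiv ℝ (LocalMetric.chris (chartMetric p)) u) Z,
    sum_apply, sum_apply, map_sum]
  congr 1
  refine Finset.sum_congr rfl fun m _ => ?_
  rw [smul_apply, smul_apply, map_smul, coordForm_apply, fderiv_chris_stdVec hu, smul_eq_mul]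

/-- The Ricci curvature in coordinates. -/
theorem ric_eq_sum (V : EuclideanSpace ℝ (Fin n)) :
    LocalMetric.ric (chartMetric p) u V = ∑ i, ∑ j, ricciComponent p i j u * V i * V j := by
  -- One diagonal entry of `X ↦ R(X, V)V`; summing over `k` contracts it to Ricci. The symmetry of
  -- the lower Christoffel indices brings the terms into the order used by `ricciComponent`.
  have hk : ∀ k, (LocalMetric.jacobi (chartMetric p) u V (stdVec k)) k = ∑ i, ∑ j, V i * V j *
      ((partialDeriv k (christoffel p k i j) u - partialDeriv j (christoffel p k i k) u)
        + ∑ l, (christoffel p k k l u * christoffel p l i j u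
          - christoffel p k j l u * christoffel p l i k u)) := by
    intro k
    have e : (LocalMetric.jacobi (chartMetric p) u V (stdVec k)) k
        = (fderiv ℝ (LocalMetric.chris (chartMetric p)) u (stdVec k) V V) k
          - (fderiv ℝ (LocalMetric.chris (chartMetric p)) u V (stdVec k) V) k
          + (LocalMetric.chris (chartMetric p) u (stdVec k)
              (LocalMetric.chris (chartMetric p) u V V)) k
          - (LocalMetric.chris (chartMetric p) u V
              (LocalMetric.chris (chartMetric p) u (stdVec k) V)) k := by
      simp [LocalMetric.jacobi]
    have e1 : (fderiv ℝ (LocalMetric.chris (chartMetric p)) u (stdVec k) V V) k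
        = ∑ i, ∑ j, V i * V j * partialDeriv k (christoffel p k i j) u := by
      rw [fderiv_chris_coord hu]
      simp only [sum_stdVec_left]
    have e2 : (fderiv ℝ (LocalMetric.chris (chartMetric p)) u V (stdVec k) V) k
        = ∑ i, ∑ j, V i * V j * partialDeriv j (christoffel p k i k) u := by
      rw [fderiv_chris_coord hu]
      simp only [mul_assoc, ← Finset.mul_sum, sum_stdVec_left]
      simp only [christoffel_symm p k k]
    have e3 : (LocalMetric.chris (chartMetric p) u (stdVec k)
          (LocalMetric.chris (chartMetric p) u V V)) k
        = ∑ i, ∑ j, V i * V j * ∑ l, christoffel p k k l u * christoffel p l i j u := by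
      rw [chris_apply_coord hu]
      simp only [mul_assoc, ← Finset.mul_sum, sum_stdVec_left, chris_apply_coord hu V V]
      simp only [Finset.sum_mul, Finset.mul_sum]
      rw [Finset.sum_comm]
      refine Finset.sum_congr rfl fun i _ => ?_
      rw [Finset.sum_comm]
      refine Finset.sum_congr rfl fun j _ => Finset.sum_congr rfl fun l _ => ?_
      ring
    have e4 : (LocalMetric.chris (chartMetric p) u V
          (LocalMetric.chris (chartMetric p) u (stdVec k) V)) k
        = ∑ i, ∑ j, V i * V j * ∑ l, christoffel p k j l u * christoffel p l i k u := by
      rw [chris_apply_coord hu, Finset.sum_comm, Finset.sum_comm (f := fun i j => V i * V j * _)]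
      have h5 : ∀ l, (LocalMetric.chris (chartMetric p) u (stdVec k) V) l
          = ∑ i, V i * christoffel p l i k u := by
        intro l
        rw [chris_apply_coord hu]
        simp only [mul_assoc, ← Finset.mul_sum, sum_stdVec_left]
        simp only [christoffel_symm p l k]
      rw [Finset.sum_comm]
      refine Finset.sum_congr rfl fun j _ => ?_
      simp only [h5, Finset.mul_sum, Finset.sum_mul]
      rw [Finset.sum_comm]
      refine Finset.sum_congr rfl fun i _ => Finset.sum_congr rfl fun l _ => ?_
      ring
    rw [e, e1, e2, e3, e4]
    simp only [← Finset.sum_sub_distrib, ← Finset.sum_add_distrib]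
    refine Finset.sum_congr rfl fun i _ => Finset.sum_congr rfl fun j _ => ?_
    rw [Finset.sum_sub_distrib]
    ring
  rw [LocalMetric.ric, tr_eq_sum, Finset.sum_congr rfl fun k _ => hk k, Finset.sum_comm]
  refine Finset.sum_congr rfl fun i _ => ?_
  rw [Finset.sum_comm]
  refine Finset.sum_congr rfl fun j _ => ?_
  rw [ricciComponent, ← Finset.sum_add_distrib, Finset.sum_mul, Finset.sum_mul]
  refine Finset.sum_congr rfl fun k _ => ?_
  ring

/-- The Laplacian in coordinates. -/
theorem lap_eq_sum {F : EuclideanSpace ℝ (Fin n) → ℝ} (hF : ContDiffAt ℝ ∞ F u) :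
    LocalMetric.lap (chartMetric p) F u = ∑ i, ∑ j, (metricMatrix p u)⁻¹ i j *
      (partialDeriv i (partialDeriv j F) u - ∑ k, christoffel p k i j u * partialDeriv k F u) := by
  have hg := isMetricOn_chartMetric (n := n) p
  -- Raising an index by `g⁻¹` turns the trace of the endomorphism into the contraction of `gⁱʲ`
  -- with the Hessian form.
  have hA : ∀ i, LocalMetric.hess (chartMetric p) F u (stdVec i)
      = (chartMetric p u).inverse
        (chartMetric p u (LocalMetric.hess (chartMetric p) F u (stdVec i))) := by
    intro i
    refine hg.ext hu fun Z => ?_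
    rw [hg.apply_inverse hu]
  rw [LocalMetric.lap, tr_eq_sum]
  refine Finset.sum_congr rfl fun i _ => ?_
  rw [hA, inverse_eq_sum hu]
  refine Finset.sum_congr rfl fun j _ => ?_
  rw [hg.apply_hess hu hF, linear_eq_sum (fderiv ℝ F u)]
  have hd : DifferentiableAt ℝ (fderiv ℝ F) u :=
    (hF.fderiv_right (m := ∞) (by simp)).differentiableAt (by simp)
  have h1 : partialDeriv i (partialDeriv j F) u
      = fderiv ℝ (fderiv ℝ F) u (stdVec i) (stdVec j) := by
    have : HasFDerivAt (partialDeriv j F) _ u :=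
      hd.hasFDerivAt.clm_apply (hasFDerivAt_const (stdVec j) u)
    rw [partialDeriv, this.fderiv]
    simp
  rw [h1]
  congr 2
  refine Finset.sum_congr rfl fun k _ => ?_
  rw [chris_stdVec hu, smul_eq_mul, partialDeriv]

end HarnackGeometry
end ClassicalCoordinates

/-! ### Independence of the chart. -/

noncomputable section ChartInvariance
set_option maxSynthPendingDepth 3
namespace HarnackGeometry

variable {n : ℕ} {M : Type*} [MetricSpace M] [ChartedSpace (EuclideanSpace ℝ (Fin n)) M]
  [IsManifold (𝓡 n) ∞ M]

lemma exists_chartPull_eq {p y : M} (hy : y ∈ (extChartAt (𝓡 n) p).source)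
    (V : EuclideanSpace ℝ (Fin n)) : ∃ v : TangentSpace (𝓡 n) y, chartPull p y v = V := by
  obtain ⟨u, hu, rfl⟩ : ∃ u ∈ (extChartAt (𝓡 n) p).target, (extChartAt (𝓡 n) p).symm u = y :=
    ⟨_, (extChartAt (𝓡 n) p).map_source hy, (extChartAt (𝓡 n) p).left_inv hy⟩
  exact ⟨chartPush p u V, chartPull_chartPush hu V⟩

lemma contDiffAt_comp_chart_symm {F : M → ℝ} (hF : ContMDiff (𝓡 n) 𝓘(ℝ, ℝ) ∞ F) (p : M)
    {u : EuclideanSpace ℝ (Fin n)} (hu : u ∈ (extChartAt (𝓡 n) p).target) :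
    ContDiffAt ℝ ∞ (fun v => F ((extChartAt (𝓡 n) p).symm v)) u := by
  have h := ((contMDiffOn_extChartAt_symm (I := 𝓡 n) (n := ∞) p).contMDiffAt
    ((isOpen_extChartAt_target p).mem_nhds hu))
  exact contMDiffAt_iff_contDiffAt.1 (hF.contMDiffAt.comp u h)

lemma contDiffAt_comp_chart_symm_prod {F : M → ℝ → ℝ}
    (hF : ContMDiffOn ((𝓡 n).prod 𝓘(ℝ, ℝ)) 𝓘(ℝ, ℝ) ∞ (fun p : M × ℝ => F p.1 p.2)
      (Set.univ ×ˢ Set.Ioi 0)) (p : M)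
    {u : EuclideanSpace ℝ (Fin n)} (hu : u ∈ (extChartAt (𝓡 n) p).target) {t : ℝ} (ht : 0 < t) :
    ContDiffAt ℝ ∞ (fun q : EuclideanSpace ℝ (Fin n) × ℝ =>
      F ((extChartAt (𝓡 n) p).symm q.1) q.2) (u, t) := by
  have h := ((contMDiffOn_extChartAt_symm (I := 𝓡 n) (n := ∞) p).contMDiffAt
    ((isOpen_extChartAt_target p).mem_nhds hu))
  have h1 : ContMDiffAt 𝓘(ℝ, EuclideanSpace ℝ (Fin n) × ℝ) (𝓡 n) ∞
      (fun q : EuclideanSpace ℝ (Fin n) × ℝ => (extChartAt (𝓡 n) p).symm q.1) (u, t) :=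
    ContMDiffAt.comp (x := (u, t)) (f := fun q : EuclideanSpace ℝ (Fin n) × ℝ => q.1) h
      contDiffAt_fst.contMDiffAt
  have h2 : ContMDiffAt 𝓘(ℝ, EuclideanSpace ℝ (Fin n) × ℝ) 𝓘(ℝ, ℝ) ∞
      (fun q : EuclideanSpace ℝ (Fin n) × ℝ => q.2) (u, t) := contDiffAt_snd.contMDiffAt
  have h3 : ContMDiffAt ((𝓡 n).prod 𝓘(ℝ, ℝ)) 𝓘(ℝ, ℝ) ∞ (fun p : M × ℝ => F p.1 p.2)
      ((extChartAt (𝓡 n) p).symm u, t) :=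
    hF.contMDiffAt ((isOpen_univ.prod isOpen_Ioi).mem_nhds ⟨trivial, ht⟩)
  exact contMDiffAt_iff_contDiffAt.1 (ContMDiffAt.comp (x := (u, t))
    (f := fun q : EuclideanSpace ℝ (Fin n) × ℝ => ((extChartAt (𝓡 n) p).symm q.1, q.2))
    (g := fun p : M × ℝ => F p.1 p.2) h3 (h1.prodMk h2))

variable [Bundle.RiemannianBundle (fun x : M => TangentSpace (𝓡 n) x)]

lemma chartMetric_chartPull {p y : M} (hy : y ∈ (extChartAt (𝓡 n) p).source)
    (v w : TangentSpace (𝓡 n) y) :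
    chartMetric p (extChartAt (𝓡 n) p y) (chartPull p y v) (chartPull p y w) = inner ℝ v w := by
  obtain ⟨u, hu, rfl⟩ : ∃ u ∈ (extChartAt (𝓡 n) p).target, (extChartAt (𝓡 n) p).symm u = y :=
    ⟨_, (extChartAt (𝓡 n) p).map_source hy, (extChartAt (𝓡 n) p).left_inv hy⟩
  rw [(extChartAt (𝓡 n) p).right_inv hu, chartMetric_apply, chartPush_chartPull hu,
    chartPush_chartPull hu]

/-- The transition maps are isometries of the chart metrics. -/
theorem isIsometryOn_transition (p q : M) :
    LocalMetric.IsIsometryOn (chartMetric q)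
      ((extChartAt (𝓡 n) q).target ∩ (extChartAt (𝓡 n) q).symm ⁻¹' (extChartAt (𝓡 n) p).source)
      (chartMetric p) (extChartAt (𝓡 n) p).target
      (fun v => extChartAt (𝓡 n) p ((extChartAt (𝓡 n) q).symm v)) where
  mapsTo v hv := (extChartAt (𝓡 n) p).map_source hv.2
  smooth v hv := by
    have h := ((contMDiffOn_extChartAt_symm (I := 𝓡 n) (n := ∞) q).contMDiffAt
      ((isOpen_extChartAt_target q).mem_nhds hv.1))
    have h2 : ContMDiffAt (𝓡 n) 𝓘(ℝ, EuclideanSpace ℝ (Fin n)) ∞ (extChartAt (𝓡 n) p)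
        ((extChartAt (𝓡 n) q).symm v) :=
      contMDiffAt_extChartAt' (by simpa using hv.2)
    exact contMDiffAt_iff_contDiffAt.1 (h2.comp v h)
  pullback v hv X Y := by
    have hd : ∀ X, fderiv ℝ (fun v => extChartAt (𝓡 n) p ((extChartAt (𝓡 n) q).symm v)) v X
        = chartPull p _ (chartPush q v X) := by
      intro X
      have := mfderiv_comp v (mdifferentiableAt_chart (n := n) (p := p) hv.2)
        (mdifferentiableAt_chart_symm (n := n) (p := q) hv.1)
      rw [mfderiv_eq_fderiv] at this
      exact congr($this X)
    rw [hd, hd, chartMetric_chartPull hv.2, chartMetric_apply]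

variable [IsContMDiffRiemannianBundle (𝓡 n) ∞ (EuclideanSpace ℝ (Fin n))
      (fun x : M => TangentSpace (𝓡 n) x)]

/-- The Laplacian can be computed in any chart. -/
theorem laplacian_eq_lap {F : M → ℝ} (hF : ContMDiff (𝓡 n) 𝓘(ℝ, ℝ) ∞ F) {p : M}
    {u : EuclideanSpace ℝ (Fin n)} (hu : u ∈ (extChartAt (𝓡 n) p).target) :
    laplacian n F ((extChartAt (𝓡 n) p).symm u)
      = LocalMetric.lap (chartMetric p) (fun v => F ((extChartAt (𝓡 n) p).symm v)) u := by
  set x := (extChartAt (𝓡 n) p).symm u with hx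
  have hxp : x ∈ (extChartAt (𝓡 n) p).source := (extChartAt (𝓡 n) p).map_target hu
  have hv : extChartAt (𝓡 n) x x ∈ (extChartAt (𝓡 n) x).target := mem_extChartAt_target x
  have hvx : (extChartAt (𝓡 n) x).symm (extChartAt (𝓡 n) x x) = x := extChartAt_to_inv x
  have h1 := lap_eq_sum hv (contDiffAt_comp_chart_symm hF x hv)
  have h2 : laplacian n F x = LocalMetric.lap (chartMetric x)
      (fun v => F ((extChartAt (𝓡 n) x).symm v)) (extChartAt (𝓡 n) x x) := h1.symm
  -- `laplacian` at `x` is computed in the chart centred at `x`, so its chart moves with the point.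
  -- The transition to the fixed chart at `p` is an isometry and preserves the value.
  have hiso := isIsometryOn_transition (n := n) p x
  have hW : IsOpen ((extChartAt (𝓡 n) x).target ∩
      (extChartAt (𝓡 n) x).symm ⁻¹' (extChartAt (𝓡 n) p).source) :=
    (continuousOn_extChartAt_symm x).isOpen_inter_preimage (isOpen_extChartAt_target x)
      (isOpen_extChartAt_source p)
  have hvW : extChartAt (𝓡 n) x x ∈ (extChartAt (𝓡 n) x).target ∩
      (extChartAt (𝓡 n) x).symm ⁻¹' (extChartAt (𝓡 n) p).source :=
    ⟨hv, by rw [Set.mem_preimage, hvx]; exact hxp⟩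
  have h3 := hiso.lap_comp (isMetricOn_chartMetric p)
    ((isMetricOn_chartMetric x).mono hW Set.inter_subset_left) hvW
    (F := fun v => F ((extChartAt (𝓡 n) p).symm v))
    (fun u hu => contDiffAt_comp_chart_symm hF p hu)
  simp only [hvx] at h3
  have hΦ : extChartAt (𝓡 n) p x = u := (extChartAt (𝓡 n) p).right_inv hu
  rw [hΦ] at h3
  rw [h2, ← h3]
  refine LocalMetric.lap_congr ?_
  filter_upwards [hW.mem_nhds hvW] with w hw
  rw [(extChartAt (𝓡 n) p).left_inv hw.2]

/-- The squared norm of the gradient in a chart. -/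
theorem gradNormSq_eq {F : M → ℝ} (hF : ContMDiff (𝓡 n) 𝓘(ℝ, ℝ) ∞ F) {p : M}
    {u : EuclideanSpace ℝ (Fin n)} (hu : u ∈ (extChartAt (𝓡 n) p).target) :
    gradNormSq n F ((extChartAt (𝓡 n) p).symm u)
      = chartMetric p u
          (LocalMetric.grad (chartMetric p) (fun v => F ((extChartAt (𝓡 n) p).symm v)) u)
          (LocalMetric.grad (chartMetric p) (fun v => F ((extChartAt (𝓡 n) p).symm v)) u) := by
  set V := LocalMetric.grad (chartMetric p) (fun v => F ((extChartAt (𝓡 n) p).symm v)) u with hV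
  -- The pushed-forward coordinate gradient represents the differential, so the operator norm of
  -- `dF` is the length of that vector.
  have hL : mvfderiv (𝓡 n) F ((extChartAt (𝓡 n) p).symm u) = innerSL ℝ (chartPush p u V) := by
    ext w
    have h0 := mfderiv_comp u (hF.mdifferentiableAt (x := (extChartAt (𝓡 n) p).symm u) (by simp))
      (mdifferentiableAt_chart_symm (n := n) (p := p) hu)
    rw [mfderiv_eq_fderiv] at h0
    have h1 : fderiv ℝ (fun v => F ((extChartAt (𝓡 n) p).symm v)) u (chartPull p _ w)
        = mvfderiv (𝓡 n) F ((extChartAt (𝓡 n) p).symm u) (chartPush p u (chartPull p _ w)) :=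
      congr($h0 (chartPull p _ w))
    rw [chartPush_chartPull hu, ← (isMetricOn_chartMetric p).apply_grad hu, ← hV,
      chartMetric_apply, chartPush_chartPull hu] at h1
    rw [← h1, innerSL_apply_apply]
  rw [gradNormSq, hL, innerSL_apply_norm, chartMetric_apply, real_inner_self_eq_norm_sq]

/-- A lower Ricci bound, in the chart at a point. -/
lemma ricciBound_chart {κ : ℝ} (h : RicciBoundedBelow n M κ) (x : M)
    (V : EuclideanSpace ℝ (Fin n)) :
    κ * chartMetric x (extChartAt (𝓡 n) x x) V V
      ≤ LocalMetric.ric (chartMetric x) (extChartAt (𝓡 n) x x) V := by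
  have hx : x ∈ (extChartAt (𝓡 n) x).source := mem_extChartAt_source x
  obtain ⟨v, rfl⟩ := exists_chartPull_eq hx V
  have h1 := h x v
  rw [chartMetric_chartPull hx, real_inner_self_eq_norm_sq, ric_eq_sum (mem_extChartAt_target x)]
  exact h1

end HarnackGeometry
end ChartInvariance

/-! ### The maximum principle against a Riccati barrier. -/

noncomputable section ParabolicComparison
set_option maxSynthPendingDepth 3
namespace HarnackGeometry

/-- The second derivative at a local minimum is nonnegative. -/
lemma second_fderiv_nonneg_of_isLocalMin {E : Type*} [NormedAddCommGroup E] [NormedSpace ℝ E]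
    {F : E → ℝ} {u : E} (hF : ContDiffAt ℝ ∞ F u) (hmin : IsLocalMin F u) (X : E) :
    0 ≤ fderiv ℝ (fderiv ℝ F) u X X := by
  set r : ℝ → ℝ := fun s => F (u + s • X) with hr
  have hline : ∀ s : ℝ, HasDerivAt (fun s : ℝ => u + s • X) X s := fun s => by
    simpa using ((hasDerivAt_id s).smul_const X).const_add u
  have hc : Filter.Tendsto (fun s : ℝ => u + s • X) (nhds 0) (nhds u) := by
    have := (hline 0).continuousAt
    simpa [ContinuousAt] using this
  have hev : ∀ᶠ v in nhds u, DifferentiableAt ℝ F v := by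
    filter_upwards [(hF.of_le (m := 1) (by simp)).eventually (by simp)] with q hq using
      hq.differentiableAt (by simp)
  have hd : ∀ᶠ s in nhds (0 : ℝ), HasDerivAt r (fderiv ℝ F (u + s • X) X) s := by
    filter_upwards [hc.eventually hev] with s hs using hs.hasFDerivAt.comp_hasDerivAt s (hline s)
  have hd2 : DifferentiableAt ℝ (fderiv ℝ F) u :=
    (hF.fderiv_right (m := ∞) (by simp)).differentiableAt (by simp)
  have h2 : HasDerivAt (deriv r) (fderiv ℝ (fderiv ℝ F) u X X) 0 := by
    have h3 : HasDerivAt (fun s : ℝ => fderiv ℝ F (u + s • X)) (fderiv ℝ (fderiv ℝ F) u X) 0 := by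
      refine HasFDerivAt.comp_hasDerivAt (l := fderiv ℝ F) 0 ?_ (hline 0)
      simpa using hd2.hasFDerivAt
    have h4 := h3.clm_apply (hasDerivAt_const (0 : ℝ) X)
    simp only [map_zero, add_zero] at h4
    refine h4.congr_of_eventuallyEq ?_
    filter_upwards [hd] with s hs using hs.deriv
  have hrmin : IsLocalMin r 0 := by
    have := hc.eventually hmin
    filter_upwards [this] with s hs
    simpa [hr] using hs
  -- A negative second derivative along the line would make the point a local maximum too. The
  -- restriction is then locally constant, with vanishing second derivative.
  by_contra! hneg
  have hmax : IsLocalMax r 0 := isLocalMax_of_deriv_deriv_neg (by rw [h2.deriv]; exact hneg)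
    hrmin.deriv_eq_zero hd.self_of_nhds.continuousAt
  have hconst : r =ᶠ[nhds 0] fun _ => r 0 := by
    filter_upwards [hrmin, hmax] with s h1 h2 using le_antisymm h2 h1
  have hzero : deriv r =ᶠ[nhds 0] fun _ => 0 := by
    filter_upwards [hconst.eventuallyEq_nhds] with s hs
    rw [hs.deriv_eq, deriv_const]
  have := h2.deriv
  rw [hzero.deriv_eq, deriv_const] at this
  exact hneg.ne this.symm

/-- The derivative at the right endpoint of an interval on which a function is minimal there. -/
lemma deriv_nonpos_of_min_left {r : ℝ → ℝ} {d b t : ℝ} (hr : HasDerivAt r d t) (hb : b < t)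
    (hmin : ∀ s ∈ Set.Icc b t, r t ≤ r s) : d ≤ 0 := by
  have h : Filter.Tendsto (slope r t) (nhdsWithin t (Set.Iio t)) (nhds d) :=
    (hasDerivAt_iff_tendsto_slope.1 hr).mono_left
      (nhdsWithin_mono t fun s (hs : s < t) => hs.ne)
  refine le_of_tendsto h ?_
  filter_upwards [Ioo_mem_nhdsLT hb] with s hs
  rw [slope_def_field]
  exact div_nonpos_of_nonneg_of_nonpos (sub_nonneg.2 (hmin s ⟨hs.1.le, hs.2.le⟩))
    (by linarith [hs.2])

/-- Dividing by `a` makes the quantity positive for both signs of `a`, so neither the barrier nor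
its logarithmic primitive needs a case distinction later. -/
lemma one_sub_exp_div_pos {a s : ℝ} (ha : a ≠ 0) (hs : 0 < s) :
    0 < (1 - Real.exp (-a * s)) / a := by
  rcases ha.lt_or_gt with h | h
  · refine div_pos_of_neg_of_neg ?_ h
    have : 1 < Real.exp (-a * s) := Real.one_lt_exp_iff.2 (by nlinarith)
    linarith
  · refine div_pos ?_ h
    have : Real.exp (-a * s) < 1 := Real.exp_lt_one_iff.2 (by nlinarith)
    linarith

lemma one_sub_exp_ne {a s : ℝ} (ha : a ≠ 0) (hs : 0 < s) : 1 - Real.exp (-a * s) ≠ 0 := by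
  intro h
  have := one_sub_exp_div_pos ha hs
  rw [h, zero_div] at this
  exact this.false

/-- The comparison function `-(n/2) a / (1 - e^{-at})`. -/
def riccatiBarrier (n : ℕ) (a s : ℝ) : ℝ := -(n / 2 * (a / (1 - Real.exp (-a * s))))

lemma riccatiBarrier_nonpos (n : ℕ) {a s : ℝ} (ha : a ≠ 0) (hs : 0 < s) :
    riccatiBarrier n a s ≤ 0 := by
  have h := one_sub_exp_div_pos ha hs
  have h2 : 0 < a / (1 - Real.exp (-a * s)) := by rw [← inv_div]; exact inv_pos.2 h
  have : (0 : ℝ) ≤ n / 2 * (a / (1 - Real.exp (-a * s))) := by positivity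
  rw [riccatiBarrier]
  linarith

lemma hasDerivAt_riccatiBarrier {n : ℕ} (hn : n ≠ 0) {a s : ℝ} (ha : a ≠ 0) (hs : 0 < s) :
    HasDerivAt (riccatiBarrier n a)
      (2 / n * riccatiBarrier n a s ^ 2 + a * riccatiBarrier n a s) s := by
  have hne := one_sub_exp_ne ha hs
  have h1 : HasDerivAt (fun s => 1 - Real.exp (-a * s)) (-(Real.exp (-a * s) * (-a))) s := by
    have := ((hasDerivAt_id s).const_mul (-a)).exp.const_sub 1
    simpa using this
  have h2 := (((hasDerivAt_const s a).fun_div h1 hne).const_mul ((n : ℝ) / 2)).fun_neg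
  refine h2.congr_deriv ?_
  have hn' : (n : ℝ) ≠ 0 := Nat.cast_ne_zero.2 hn
  rw [riccatiBarrier]
  field_simp
  ring

/-- The blow-up replaces an initial condition: nothing is assumed about the solutions as `t → 0`. -/
lemma tendsto_riccatiBarrier {n : ℕ} (hn : n ≠ 0) {a : ℝ} (ha : a ≠ 0) :
    Filter.Tendsto (riccatiBarrier n a) (nhdsWithin 0 (Set.Ioi 0)) Filter.atBot := by
  have hc : Filter.Tendsto (fun s => (1 - Real.exp (-a * s)) / a) (nhdsWithin 0 (Set.Ioi 0))
      (nhdsWithin 0 (Set.Ioi 0)) := by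
    refine tendsto_nhdsWithin_iff.2 ⟨?_, ?_⟩
    · have : Continuous fun s : ℝ => (1 - Real.exp (-a * s)) / a := by fun_prop
      have h := (this.tendsto 0).mono_left (nhdsWithin_le_nhds (s := Set.Ioi 0))
      simpa using h
    · filter_upwards [self_mem_nhdsWithin] with s hs using one_sub_exp_div_pos ha hs
  have h := hc.inv_tendsto_nhdsGT_zero.const_mul_atTop (show (0 : ℝ) < n / 2 by positivity)
  refine (Filter.tendsto_neg_atTop_atBot.comp h).congr fun s => ?_
  simp [riccatiBarrier]

/-- A function that satisfies `∂P/∂t ≥ (2/n) P² + a P` at its spatial minima lies above the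
Riccati barrier. -/
theorem riccatiBarrier_le {M : Type*} [TopologicalSpace M] [CompactSpace M] {n : ℕ} (hn : n ≠ 0)
    {a : ℝ} (ha : a ≠ 0) {P : M → ℝ → ℝ}
    (hP : ContinuousOn (fun q : M × ℝ => P q.1 q.2) (Set.univ ×ˢ Set.Ioi 0))
    (hmin : ∀ x t, 0 < t → (∀ y, P x t ≤ P y t) →
      ∃ d, HasDerivAt (P x) d t ∧ 2 / n * P x t ^ 2 + a * P x t ≤ d)
    (x : M) {t : ℝ} (ht : 0 < t) : riccatiBarrier n a t ≤ P x t := by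
  -- The barrier is delayed by `ε`, so that it blows up at a positive time, where `P` is bounded on
  -- the compact manifold. The delay is removed at the end by continuity.
  have key : ∀ ε ∈ Set.Ioo 0 t, riccatiBarrier n a (t - ε) ≤ P x t := by
    intro ε hε
    by_contra! hlt
    have : Nonempty M := ⟨x⟩
    obtain ⟨q, -, hq⟩ := (isCompact_univ.prod (isCompact_Icc (a := ε) (b := t))).exists_isMinOn
      ⟨(x, t), ⟨trivial, hε.2.le, le_rfl⟩⟩
      (hP.mono (Set.prod_mono_right fun s hs => hε.1.trans_le hs.1))
    -- `δ` is so small that at time `ε + δ` the barrier is below the minimum of `P` over the whole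
    -- slab. The weighted difference can then be negative only after the starting time.
    obtain ⟨δ, hδ1, hδ2⟩ := (((tendsto_riccatiBarrier hn ha).eventually_lt_atBot
      (P q.1 q.2)).and (Ioo_mem_nhdsGT (sub_pos.2 hε.2))).exists
    have hbd : ∀ y, riccatiBarrier n a δ < P y (ε + δ) := fun y =>
      hδ1.trans_le (hq (show (y, ε + δ) ∈ Set.univ ×ˢ Set.Icc ε t from
        ⟨trivial, by linarith [hδ2.1], by linarith [hδ2.2]⟩))
    -- The weight `e^{-Cs}` with `C > a` makes the linear reaction term strictly favourable whatever
    -- the sign of `a`.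
    set C : ℝ := |a| + 1 with hC
    have hyd : ∀ s ∈ Set.Icc (ε + δ) t, HasDerivAt (fun s => riccatiBarrier n a (s - ε))
        (2 / n * riccatiBarrier n a (s - ε) ^ 2 + a * riccatiBarrier n a (s - ε)) s := by
      intro s hs
      have h0 : 0 < s - ε := by linarith [hs.1, hδ2.1]
      exact (hasDerivAt_riccatiBarrier hn ha h0).comp_sub_const s ε
    have hwc : ContinuousOn (fun q : M × ℝ =>
        Real.exp (-C * q.2) * (P q.1 q.2 - riccatiBarrier n a (q.2 - ε)))
        (Set.univ ×ˢ Set.Icc (ε + δ) t) := by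
      refine ContinuousOn.mul (by fun_prop) (ContinuousOn.sub ?_ ?_)
      · exact hP.mono (Set.prod_mono_right fun s hs => by
          have := hs.1
          exact (show (0 : ℝ) < s by linarith [hδ2.1, hε.1]))
      · intro q hq
        exact ((hyd q.2 hq.2).continuousAt.comp
          (f := fun q : M × ℝ => q.2) continuousAt_snd).continuousWithinAt
    obtain ⟨⟨x₀, t₀⟩, ⟨-, ht₀⟩, hmin₀⟩ := (isCompact_univ.prod
      (isCompact_Icc (a := ε + δ) (b := t))).exists_isMinOn
      ⟨(x, t), ⟨trivial, by linarith [hδ2.2], le_rfl⟩⟩ hwc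
    simp only at ht₀
    have hw : ∀ y, ∀ s ∈ Set.Icc (ε + δ) t,
        Real.exp (-C * t₀) * (P x₀ t₀ - riccatiBarrier n a (t₀ - ε))
          ≤ Real.exp (-C * s) * (P y s - riccatiBarrier n a (s - ε)) := fun y s hs =>
      hmin₀ (show (y, s) ∈ Set.univ ×ˢ Set.Icc (ε + δ) t from ⟨trivial, hs⟩)
    have hneg : P x₀ t₀ - riccatiBarrier n a (t₀ - ε) < 0 := by
      have h1 := hw x t ⟨by linarith [hδ2.2], le_rfl⟩
      have h2 : Real.exp (-C * t) * (P x t - riccatiBarrier n a (t - ε)) < 0 :=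
        mul_neg_of_pos_of_neg (Real.exp_pos _) (by linarith)
      by_contra! h3
      have : 0 ≤ Real.exp (-C * t₀) * (P x₀ t₀ - riccatiBarrier n a (t₀ - ε)) := by positivity
      linarith
    have hlt₀ : ε + δ < t₀ := by
      refine lt_of_le_of_ne ht₀.1 fun h => ?_
      have := hbd x₀
      rw [← h, add_sub_cancel_left] at hneg
      linarith
    have ht₀pos : 0 < t₀ := by linarith [hδ2.1, hε.1]
    obtain ⟨d, hd, hd2⟩ := hmin x₀ t₀ ht₀pos fun y => by
      have := (mul_le_mul_iff_of_pos_left (Real.exp_pos _)).1 (hw y t₀ ht₀)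
      linarith
    have hexp : HasDerivAt (fun s => Real.exp (-C * s)) (Real.exp (-C * t₀) * -C) t₀ := by
      have := ((hasDerivAt_id t₀).const_mul (-C)).exp
      simpa using this
    have hw' := hexp.fun_mul (hd.fun_sub (hyd t₀ ht₀))
    have hle := deriv_nonpos_of_min_left hw' hlt₀
      fun s hs => hw x₀ s ⟨hs.1, hs.2.trans ht₀.2⟩
    set y := riccatiBarrier n a (t₀ - ε) with hy
    have hy0 : y ≤ 0 := riccatiBarrier_nonpos n ha (by linarith [hδ2.1])
    have hle2 : d - (2 / n * y ^ 2 + a * y) ≤ C * (P x₀ t₀ - y) := by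
      have : Real.exp (-C * t₀) * (d - (2 / n * y ^ 2 + a * y) - C * (P x₀ t₀ - y)) ≤ 0 := by
        linarith
      have := nonpos_of_mul_nonpos_right this (Real.exp_pos _)
      linarith
    -- The difference of the two Riccati right-hand sides factors through `P - y`. Since `P < y ≤ 0`
    -- and `a < C`, both factors are negative, which is the contradiction.
    have hfac : (P x₀ t₀ - y) * (2 / n * (P x₀ t₀ + y) + a - C) ≤ 0 := by linarith
    have h2n : (0 : ℝ) < 2 / n := by positivity
    have hlast : 2 / n * (P x₀ t₀ + y) + a - C < 0 := by
      have h1 : 2 / n * (P x₀ t₀ + y) ≤ 0 :=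
        mul_nonpos_of_nonneg_of_nonpos h2n.le (by linarith)
      linarith [le_abs_self a]
    nlinarith [mul_pos_of_neg_of_neg hneg hlast]
  have hcont : Filter.Tendsto (fun ε => riccatiBarrier n a (t - ε)) (nhdsWithin 0 (Set.Ioi 0))
      (nhds (riccatiBarrier n a t)) := by
    have h := (hasDerivAt_riccatiBarrier hn ha ht).continuousAt
    have h2 : ContinuousAt (fun ε => riccatiBarrier n a (t - ε)) 0 := by
      refine ContinuousAt.comp (g := riccatiBarrier n a) (by simpa using h) (by fun_prop)
    have h3 := h2.tendsto.mono_left (nhdsWithin_le_nhds (s := Set.Ioi 0))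
    simpa using h3
  refine le_of_tendsto hcont ?_
  filter_upwards [Ioo_mem_nhdsGT ht] with ε hε using key ε hε

end HarnackGeometry
end ParabolicComparison

/-! ### The differential Harnack inequality. -/

noncomputable section DifferentialHarnack
set_option maxSynthPendingDepth 3
namespace HarnackGeometry

variable {n : ℕ} {M : Type*} [MetricSpace M] [ChartedSpace (EuclideanSpace ℝ (Fin n)) M]

/-- Joint smoothness in space and positive time. -/
abbrev IsSmoothFlow (F : M → ℝ → ℝ) : Prop :=
  ContMDiffOn ((𝓡 n).prod 𝓘(ℝ, ℝ)) 𝓘(ℝ, ℝ) ∞ (fun p : M × ℝ => F p.1 p.2) (Set.univ ×ˢ Set.Ioi 0)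

lemma contMDiff_slice {F : M → ℝ → ℝ} (hF : IsSmoothFlow (n := n) F) {t : ℝ} (ht : 0 < t) :
    ContMDiff (𝓡 n) 𝓘(ℝ, ℝ) ∞ (fun x => F x t) := by
  have h : ContMDiff (𝓡 n) ((𝓡 n).prod 𝓘(ℝ, ℝ)) ∞ (fun x : M => (x, t)) :=
    contMDiff_id.prodMk contMDiff_const
  exact hF.comp_contMDiff h fun x => ⟨trivial, ht⟩

lemma IsSmoothFlow.comp₂ {F G : M → ℝ → ℝ} (hF : IsSmoothFlow (n := n) F)
    (hG : IsSmoothFlow (n := n) G) {Θ : ℝ × ℝ → ℝ}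
    (hΘ : ∀ x t, 0 < t → ContDiffAt ℝ ∞ Θ (F x t, G x t)) :
    IsSmoothFlow (n := n) (fun x t => Θ (F x t, G x t)) := by
  intro q hq
  have h1 := (hF q hq).prodMk_space (hG q hq)
  exact ((hΘ q.1 q.2 hq.2).contMDiffAt).comp_contMDiffWithinAt q h1

lemma isSmoothFlow_log {ψ : M → ℝ → ℝ} (hψ : IsSmoothFlow (n := n) ψ)
    (pos : ∀ x t, 0 < t → 0 < ψ x t) : IsSmoothFlow (n := n) (fun x t => Real.log (ψ x t)) :=
  hψ.comp₂ hψ (Θ := fun z => Real.log z.1) fun x t ht =>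
    contDiffAt_fst.log (pos x t ht).ne'

lemma isSmoothFlow_div {φ ψ : M → ℝ → ℝ} (hφ : IsSmoothFlow (n := n) φ)
    (hψ : IsSmoothFlow (n := n) ψ) (pos : ∀ x t, 0 < t → 0 < ψ x t) :
    IsSmoothFlow (n := n) (fun x t => φ x t / ψ x t) :=
  hφ.comp₂ hψ (Θ := fun z => z.1 / z.2) fun x t ht =>
    contDiffAt_fst.div contDiffAt_snd (pos x t ht).ne'

lemma isSmoothFlow_arcsin {h : M → ℝ → ℝ} (hh : IsSmoothFlow (n := n) h)
    (pos : ∀ x t, 0 < t → 0 < h x t) (lt : ∀ x t, 0 < t → h x t < 1) :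
    IsSmoothFlow (n := n) (fun x t => Real.arcsin (h x t)) :=
  hh.comp₂ hh (Θ := fun z => Real.arcsin z.1) fun x t ht =>
    ContDiffAt.comp (f := fun z : ℝ × ℝ => z.1) (g := Real.arcsin) (h x t, h x t)
      (Real.contDiffAt_arcsin (by linarith [pos x t ht]) (lt x t ht).ne) contDiffAt_fst

/-- Continuity can be checked in the charts. -/
lemma continuousOn_of_chart {G : M → ℝ → ℝ}
    (h : ∀ (p : M) (t : ℝ), 0 < t → ContinuousAt (fun q : EuclideanSpace ℝ (Fin n) × ℝ =>
      G ((extChartAt (𝓡 n) p).symm q.1) q.2) (extChartAt (𝓡 n) p p, t)) :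
    ContinuousOn (fun q : M × ℝ => G q.1 q.2) (Set.univ ×ˢ Set.Ioi 0) := by
  rintro ⟨p, t⟩ ⟨-, ht⟩
  refine ContinuousAt.continuousWithinAt ?_
  have h1 : ContinuousAt (fun q : M × ℝ => (extChartAt (𝓡 n) p q.1, q.2)) (p, t) :=
    ((continuousAt_extChartAt p).comp (f := fun q : M × ℝ => q.1) continuousAt_fst).prodMk
      continuousAt_snd
  have h2 := ContinuousAt.comp (f := fun q : M × ℝ => (extChartAt (𝓡 n) p q.1, q.2)) (x := (p, t))
    (h p t ht) h1
  refine h2.congr ?_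
  have h3 : ∀ᶠ q : M × ℝ in nhds (p, t), q.1 ∈ (extChartAt (𝓡 n) p).source :=
    continuousAt_fst.eventually (extChartAt_source_mem_nhds p)
  filter_upwards [h3] with q hq
  simp only [Function.comp_apply]
  rw [(extChartAt (𝓡 n) p).left_inv hq]

lemma isSmoothFlow_angle {a : ℝ} {φ ψ : M → ℝ → ℝ}
    [Bundle.RiemannianBundle (fun x : M => TangentSpace (𝓡 n) x)]
    (hφ : IsPositiveSolution n a φ) (hψ : IsPositiveSolution n a ψ)
    (hlt : ∀ x t, 0 < t → φ x t < ψ x t) :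
    IsSmoothFlow (n := n) (fun x t => Real.arcsin (φ x t / ψ x t)) :=
  isSmoothFlow_arcsin (isSmoothFlow_div hφ.smooth hψ.smooth hψ.pos)
    (fun x t ht => div_pos (hφ.pos x t ht) (hψ.pos x t ht))
    (fun x t ht => (div_lt_one (hψ.pos x t ht)).2 (hlt x t ht))

lemma eventually_chart_time (p : M) {u : EuclideanSpace ℝ (Fin n)}
    (hu : u ∈ (extChartAt (𝓡 n) p).target) {t : ℝ} (ht : 0 < t) :
    ∀ᶠ q : EuclideanSpace ℝ (Fin n) × ℝ in nhds (u, t),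
      q.1 ∈ (extChartAt (𝓡 n) p).target ∧ 0 < q.2 :=
  ((isOpen_extChartAt_target p).prod isOpen_Ioi).mem_nhds (show (u, t) ∈ _ from ⟨hu, ht⟩)

variable [IsManifold (𝓡 n) ∞ M] [Bundle.RiemannianBundle (fun x : M => TangentSpace (𝓡 n) x)]
  [IsContMDiffRiemannianBundle (𝓡 n) ∞ (EuclideanSpace ℝ (Fin n))
      (fun x : M => TangentSpace (𝓡 n) x)]

/-- The definition changes chart from point to point; near each `p` it is rewritten in the single
chart at `p`, where smoothness is visible. -/
lemma continuousOn_laplacian {F : M → ℝ → ℝ} (hF : IsSmoothFlow (n := n) F) :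
    ContinuousOn (fun q : M × ℝ => laplacian n (fun y => F y q.2) q.1)
      (Set.univ ×ˢ Set.Ioi 0) := by
  refine continuousOn_of_chart (n := n) (G := fun x t => laplacian n (fun y => F y t) x)
    fun p t ht => ?_
  have hu : extChartAt (𝓡 n) p p ∈ (extChartAt (𝓡 n) p).target := mem_extChartAt_target p
  have h := ((isMetricOn_chartMetric p).contDiffAt_lap_slice hu
    (F := fun v s => F ((extChartAt (𝓡 n) p).symm v) s)
    (contDiffAt_comp_chart_symm_prod hF p hu ht)).continuousAt
  refine h.congr ?_
  filter_upwards [eventually_chart_time p hu ht] with q hq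
  exact (laplacian_eq_lap (contMDiff_slice hF hq.2) hq.1).symm

lemma continuousOn_gradNormSq {F : M → ℝ → ℝ} (hF : IsSmoothFlow (n := n) F) :
    ContinuousOn (fun q : M × ℝ => gradNormSq n (fun y => F y q.2) q.1)
      (Set.univ ×ˢ Set.Ioi 0) := by
  refine continuousOn_of_chart (n := n) (G := fun x t => gradNormSq n (fun y => F y t) x)
    fun p t ht => ?_
  have hu : extChartAt (𝓡 n) p p ∈ (extChartAt (𝓡 n) p).target := mem_extChartAt_target p
  have h := ((isMetricOn_chartMetric p).contDiffAt_pairing_slice hu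
    (F := fun v s => F ((extChartAt (𝓡 n) p).symm v) s)
    (G := fun v s => F ((extChartAt (𝓡 n) p).symm v) s)
    (contDiffAt_comp_chart_symm_prod hF p hu ht)
    (contDiffAt_comp_chart_symm_prod hF p hu ht)).continuousAt
  refine h.congr ?_
  filter_upwards [eventually_chart_time p hu ht] with q hq
  exact (gradNormSq_eq (contMDiff_slice hF hq.2) hq.1).symm

/-- `|∇ arcsin h|² = |∇h|² / (1 - h²)`. -/
lemma gradNormSq_arcsin {h : M → ℝ} (hh : ContMDiff (𝓡 n) 𝓘(ℝ, ℝ) ∞ h)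
    (pos : ∀ x, 0 < h x) (lt : ∀ x, h x < 1)
    (hs : ContMDiff (𝓡 n) 𝓘(ℝ, ℝ) ∞ (fun x => Real.arcsin (h x))) (x : M) :
    gradNormSq n (fun y => Real.arcsin (h y)) x = gradNormSq n h x / (1 - h x ^ 2) := by
  have hu : extChartAt (𝓡 n) x x ∈ (extChartAt (𝓡 n) x).target := mem_extChartAt_target x
  have hx : (extChartAt (𝓡 n) x).symm (extChartAt (𝓡 n) x x) = x := extChartAt_to_inv x
  have h1 := gradNormSq_eq hs hu
  have h2 := gradNormSq_eq hh hu
  rw [hx] at h1 h2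
  have h3 : 0 < 1 - h x ^ 2 := by nlinarith [pos x, lt x]
  have h4 := LocalMetric.grad_comp (g := chartMetric x)
    ((contDiffAt_comp_chart_symm hh x hu).differentiableAt (by simp))
    (Real.hasDerivAt_arcsin (x := h ((extChartAt (𝓡 n) x).symm (extChartAt (𝓡 n) x x)))
      (by rw [hx]; linarith [pos x]) (by rw [hx]; exact (lt x).ne))
  rw [h1, h2, h4, hx]
  simp only [map_smul, smul_apply, smul_eq_mul]
  rw [← mul_assoc, div_mul_div_comm, Real.mul_self_sqrt h3.le]
  ring

variable {a : ℝ} {φ ψ : M → ℝ → ℝ}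

lemma equation_chart {w : M → ℝ → ℝ} (hw : IsPositiveSolution n a w) {p : M}
    {u : EuclideanSpace ℝ (Fin n)} (hu : u ∈ (extChartAt (𝓡 n) p).target) {t : ℝ} (ht : 0 < t) :
    HasDerivAt (fun s => w ((extChartAt (𝓡 n) p).symm u) s)
      (LocalMetric.lap (chartMetric p) (fun v => w ((extChartAt (𝓡 n) p).symm v) t) u
        + a * w ((extChartAt (𝓡 n) p).symm u) t
          * Real.log (w ((extChartAt (𝓡 n) p).symm u) t)) t := by
  have h := hw.equation ((extChartAt (𝓡 n) p).symm u) t ht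
  rwa [laplacian_eq_lap (contMDiff_slice hw.smooth ht) hu] at h

/-- The Harnack quantity `Δ ln ψ - |∇ arcsin (φ / ψ)|²`. -/
def harnackQuantity (n : ℕ) {M : Type*} [MetricSpace M]
    [ChartedSpace (EuclideanSpace ℝ (Fin n)) M]
    [Bundle.RiemannianBundle (fun x : M => TangentSpace (𝓡 n) x)] (φ ψ : M → ℝ → ℝ)
    (x : M) (t : ℝ) : ℝ :=
  laplacian n (fun y => Real.log (ψ y t)) x
    - gradNormSq n (fun y => Real.arcsin (φ y t / ψ y t)) x

variable (hφ : IsPositiveSolution n a φ) (hψ : IsPositiveSolution n a ψ)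
  (hlt : ∀ x t, 0 < t → φ x t < ψ x t)

include hφ hψ hlt

/-- Returns from the angle, suited to the evolution equation, to the ratio `h` that appears in the
final integrand. -/
lemma harnackQuantity_eq {x : M} {t : ℝ} (ht : 0 < t) :
    harnackQuantity n φ ψ x t = laplacian n (fun y => Real.log (ψ y t)) x
      - gradNormSq n (fun y => φ y t / ψ y t) x / (1 - (φ x t / ψ x t) ^ 2) := by
  rw [harnackQuantity, gradNormSq_arcsin
    (contMDiff_slice (isSmoothFlow_div hφ.smooth hψ.smooth hψ.pos) ht)
    (fun x => div_pos (hφ.pos x t ht) (hψ.pos x t ht))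
    (fun x => (div_lt_one (hψ.pos x t ht)).2 (hlt x t ht))
    (contMDiff_slice (isSmoothFlow_angle hφ hψ hlt) ht)]

lemma continuousOn_harnackQuantity :
    ContinuousOn (fun q : M × ℝ => harnackQuantity n φ ψ q.1 q.2) (Set.univ ×ˢ Set.Ioi 0) :=
  ContinuousOn.sub
    (f := fun q : M × ℝ => laplacian n (fun y => Real.log (ψ y q.2)) q.1)
    (g := fun q : M × ℝ => gradNormSq n (fun y => Real.arcsin (φ y q.2 / ψ y q.2)) q.1)
    (continuousOn_laplacian (F := fun x t => Real.log (ψ x t))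
      (isSmoothFlow_log hψ.smooth hψ.pos))
    (continuousOn_gradNormSq (F := fun x t => Real.arcsin (φ x t / ψ x t))
      (isSmoothFlow_angle hφ hψ hlt))

lemma harnackQuantity_chart {p : M} {u : EuclideanSpace ℝ (Fin n)}
    (hu : u ∈ (extChartAt (𝓡 n) p).target) {t : ℝ} (ht : 0 < t) :
    harnackQuantity n φ ψ ((extChartAt (𝓡 n) p).symm u) t
      = LocalMetric.lap (chartMetric p)
          (fun v => Real.log (ψ ((extChartAt (𝓡 n) p).symm v) t)) u
        - chartMetric p u (LocalMetric.grad (chartMetric p) (fun v => Real.arcsin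
            (φ ((extChartAt (𝓡 n) p).symm v) t / ψ ((extChartAt (𝓡 n) p).symm v) t)) u)
          (LocalMetric.grad (chartMetric p) (fun v => Real.arcsin
            (φ ((extChartAt (𝓡 n) p).symm v) t / ψ ((extChartAt (𝓡 n) p).symm v) t)) u) := by
  rw [harnackQuantity, laplacian_eq_lap
    (contMDiff_slice (isSmoothFlow_log hψ.smooth hψ.pos) ht) hu,
    gradNormSq_eq (contMDiff_slice (isSmoothFlow_angle hφ hψ hlt) ht) hu]

/-- The parabolic inequality for the Harnack quantity at its spatial minima. -/
theorem harnackQuantity_evolution (hn : n ≠ 0)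
    (hcurv : ∀ x t, 0 < t → ∀ V W : EuclideanSpace ℝ (Fin n),
      0 ≤ 2 * LocalMetric.ric (chartMetric x) (extChartAt (𝓡 n) x x) V
        + 2 * LocalMetric.ric (chartMetric x) (extChartAt (𝓡 n) x x) W
        + a * chartMetric x (extChartAt (𝓡 n) x x) W W
          * (1 - 2 * (1 + Real.log (φ x t / ψ x t) / (1 - (φ x t / ψ x t) ^ 2))))
    (x : M) {t : ℝ} (ht : 0 < t)
    (hmin : ∀ y, harnackQuantity n φ ψ x t ≤ harnackQuantity n φ ψ y t) :
    ∃ d, HasDerivAt (harnackQuantity n φ ψ x) d t ∧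
      2 / n * harnackQuantity n φ ψ x t ^ 2 + a * harnackQuantity n φ ψ x t ≤ d := by
  have hg := isMetricOn_chartMetric (n := n) x
  set U := (extChartAt (𝓡 n) x).target with hU
  -- The chart is centred at the minimum point. Curvature is needed only there, so invariance of
  -- Ricci under changes of chart is not required.
  obtain ⟨u, hue⟩ : ∃ u, u = extChartAt (𝓡 n) x x := ⟨_, rfl⟩
  have hu : u ∈ U := hue ▸ mem_extChartAt_target x
  have hx : (extChartAt (𝓡 n) x).symm u = x := hue ▸ extChartAt_to_inv x
  obtain ⟨f, hf⟩ : ∃ f : EuclideanSpace ℝ (Fin n) → ℝ → ℝ,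
      f = fun v s => Real.log (ψ ((extChartAt (𝓡 n) x).symm v) s) := ⟨_, rfl⟩
  obtain ⟨θ, hθ⟩ : ∃ θ : EuclideanSpace ℝ (Fin n) → ℝ → ℝ,
      θ = fun v s => Real.arcsin (φ ((extChartAt (𝓡 n) x).symm v) s
        / ψ ((extChartAt (𝓡 n) x).symm v) s) := ⟨_, rfl⟩
  have hP : ∀ v ∈ U, ∀ s, 0 < s → harnackQuantity n φ ψ ((extChartAt (𝓡 n) x).symm v) s
      = LocalMetric.lap (chartMetric x) (fun w => f w s) v
        - chartMetric x v (LocalMetric.grad (chartMetric x) (fun w => θ w s) v)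
          (LocalMetric.grad (chartMetric x) (fun w => θ w s) v) := by
    intro v hv s hs
    rw [harnackQuantity_chart hφ hψ hlt hv hs, hf, hθ]
  have hsφ : ∀ v ∈ U, ContDiffAt ℝ ∞ (fun q : EuclideanSpace ℝ (Fin n) × ℝ =>
      φ ((extChartAt (𝓡 n) x).symm q.1) q.2) (v, t) := fun v hv =>
    contDiffAt_comp_chart_symm_prod (F := φ) hφ.smooth x hv ht
  have hsψ : ∀ v ∈ U, ContDiffAt ℝ ∞ (fun q : EuclideanSpace ℝ (Fin n) × ℝ =>
      ψ ((extChartAt (𝓡 n) x).symm q.1) q.2) (v, t) := fun v hv =>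
    contDiffAt_comp_chart_symm_prod (F := ψ) hψ.smooth x hv ht
  have hsf : ∀ v ∈ U, ContDiffAt ℝ ∞ (fun q : EuclideanSpace ℝ (Fin n) × ℝ =>
      f q.1 q.2) (v, t) := fun v hv => by
    rw [hf]
    exact contDiffAt_comp_chart_symm_prod (F := fun x t => Real.log (ψ x t))
      (isSmoothFlow_log hψ.smooth hψ.pos) x hv ht
  have hang := fun v (hv : v ∈ U) =>
    hg.angle_equation hv (φ := fun v s => φ ((extChartAt (𝓡 n) x).symm v) s)
      (ψ := fun v s => ψ ((extChartAt (𝓡 n) x).symm v) s) hsφ hsψ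
      (fun v _ => hφ.pos _ t ht) (fun v _ => hlt _ t ht)
      (equation_chart hφ hv ht) (equation_chart hψ hv ht)
  have hsθ : ∀ v ∈ U, ContDiffAt ℝ ∞ (fun q : EuclideanSpace ℝ (Fin n) × ℝ =>
      θ q.1 q.2) (v, t) := by
    rw [hθ]
    exact (hang u hu).1
  have ef : ∀ v ∈ U, deriv (f v) t = LocalMetric.lap (chartMetric x) (fun w => f w t) v
      + chartMetric x v (LocalMetric.grad (chartMetric x) (fun w => f w t) v)
        (LocalMetric.grad (chartMetric x) (fun w => f w t) v) + a * f v t := by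
    intro v hv
    rw [hf]
    exact hg.log_equation hv (ψ := fun v s => ψ ((extChartAt (𝓡 n) x).symm v) s) hsψ
      (fun v _ => hψ.pos _ t ht) (equation_chart hψ hv ht)
  have eθ : ∀ v ∈ U, deriv (θ v) t = LocalMetric.lap (chartMetric x) (fun w => θ w t) v
      + 2 * chartMetric x v (LocalMetric.grad (chartMetric x) (fun w => f w t) v)
          (LocalMetric.grad (chartMetric x) (fun w => θ w t) v)
      - Real.tan (θ v t) * chartMetric x v (LocalMetric.grad (chartMetric x) (fun w => θ w t) v)
          (LocalMetric.grad (chartMetric x) (fun w => θ w t) v)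
      + a * (Real.tan (θ v t) * Real.log (Real.sin (θ v t))) := by
    intro v hv
    rw [hf, hθ]
    exact (hang v hv).2
  have h0 : 0 < φ x t / ψ x t := div_pos (hφ.pos x t ht) (hψ.pos x t ht)
  have h1 : φ x t / ψ x t < 1 := (div_lt_one (hψ.pos x t ht)).2 (hlt x t ht)
  have hθu : θ u t = Real.arcsin (φ x t / ψ x t) := by
    have h2 : θ u t = Real.arcsin (φ ((extChartAt (𝓡 n) x).symm u) t
        / ψ ((extChartAt (𝓡 n) x).symm u) t) := by rw [hθ]
    rw [h2, hx]
  have hPs : ContDiffAt ℝ ∞ (fun v => LocalMetric.lap (chartMetric x) (fun w => f w t) v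
        - chartMetric x v (LocalMetric.grad (chartMetric x) (fun w => θ w t) v)
          (LocalMetric.grad (chartMetric x) (fun w => θ w t) v)) u :=
    (hg.contDiffAt_lap hu (LocalMetric.contDiffAt_slice (hsf u hu))).sub
      (hg.contDiffAt_pairing hu (LocalMetric.contDiffAt_slice (hsθ u hu))
        (LocalMetric.contDiffAt_slice (hsθ u hu)))
  have hPmin : IsLocalMin (fun v => LocalMetric.lap (chartMetric x) (fun w => f w t) v
        - chartMetric x v (LocalMetric.grad (chartMetric x) (fun w => θ w t) v)
          (LocalMetric.grad (chartMetric x) (fun w => θ w t) v)) u := by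
    filter_upwards [hg.mem_nhds hu] with v hv
    rw [← hP u hu t ht, ← hP v hv t ht, hx]
    exact hmin _
  have hcurv' := hcurv x t ht (LocalMetric.grad (chartMetric x) (fun w => f w t) u)
    (LocalMetric.grad (chartMetric x) (fun w => θ w t) u)
  rw [← hue] at hcurv'
  clear hf hθ
  obtain ⟨d, hd1, hd2⟩ := hg.evolution_lower_bound hu
    (finrank_euclideanSpace_fin (𝕜 := ℝ) (n := n)) hn hsf hsθ ef eθ
    (by
      rw [hθu]
      exact ⟨Real.arcsin_pos.2 h0, Real.arcsin_lt_pi_div_two.2 h1⟩)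
    hPmin.fderiv_eq_zero
    (hg.lap_nonneg hu hPs hPmin.fderiv_eq_zero (second_fderiv_nonneg_of_isLocalMin hPs hPmin))
    (by
      rw [hθu, Real.sin_arcsin (by linarith) h1.le, Real.cos_arcsin,
        Real.sq_sqrt (by nlinarith)]
      exact hcurv')
  rw [← hP u hu t ht, hx] at hd2
  refine ⟨d, hd1.congr_of_eventuallyEq ?_, hd2⟩
  filter_upwards [lt_mem_nhds ht] with s hs
  rw [← hP u hu s hs, hx]

omit hφ hψ hlt in
/-- The curvature terms have a sign under the hypotheses of the theorem. -/
theorem curvature_term_nonneg {φ ψ : M → ℝ → ℝ}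
    (posφ : ∀ x t, 0 < t → 0 < φ x t) (posψ : ∀ x t, 0 < t → 0 < ψ x t)
    (hcases :
      (0 < a ∧ (∀ x t, 0 < t → φ x t < ψ x t) ∧ RicciBoundedBelow n M 0) ∨
      (a < 0 ∧ ∃ c₀ K : ℝ, 0 < c₀ ∧ c₀ < 1 ∧
        (∀ x t, 0 < t → c₀ * ψ x t < φ x t ∧ φ x t < ψ x t) ∧
        -Real.log c₀ / (1 - c₀ ^ 2) - 1 / 2 ≤ K ∧ RicciBoundedBelow n M (-a * K)))
    (x : M) {t : ℝ} (ht : 0 < t) (V W : EuclideanSpace ℝ (Fin n)) :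
    0 ≤ 2 * LocalMetric.ric (chartMetric x) (extChartAt (𝓡 n) x x) V
        + 2 * LocalMetric.ric (chartMetric x) (extChartAt (𝓡 n) x x) W
        + a * chartMetric x (extChartAt (𝓡 n) x x) W W
          * (1 - 2 * (1 + Real.log (φ x t / ψ x t) / (1 - (φ x t / ψ x t) ^ 2))) := by
  have hg := isMetricOn_chartMetric (n := n) x
  have hu : extChartAt (𝓡 n) x x ∈ (extChartAt (𝓡 n) x).target := mem_extChartAt_target x
  have hW := hg.nonneg hu W
  have hV := hg.nonneg hu V
  set h := φ x t / ψ x t with hh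
  have h0 : 0 < h := div_pos (posφ x t ht) (posψ x t ht)
  rcases hcases with ⟨ha, hlt, hric⟩ | ⟨ha, c, K, hc0, hc1, hlt, hK, hric⟩
  · have h1 : h < 1 := (div_lt_one (posψ x t ht)).2 (hlt x t ht)
    have hl := LocalMetric.half_le_neg_log_div h0 h1
    rw [neg_div] at hl
    have rV := ricciBound_chart hric x V
    have rW := ricciBound_chart hric x W
    rw [zero_mul] at rV rW
    have : 0 ≤ a * chartMetric x (extChartAt (𝓡 n) x x) W W
        * (1 - 2 * (1 + Real.log h / (1 - h ^ 2))) :=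
      mul_nonneg (mul_nonneg ha.le hW) (by linarith)
    linarith
  · have h1 : h < 1 := (div_lt_one (posψ x t ht)).2 (hlt x t ht).2
    have hch : c ≤ h := (le_div_iff₀ (posψ x t ht)).2 (hlt x t ht).1.le
    have hl := LocalMetric.neg_log_div_antitone hc0 hch h1
    -- This forces `K ≥ 0`, so the Ricci term in the direction `V` is nonnegative and can be
    -- dropped.
    have hl2 := LocalMetric.half_le_neg_log_div hc0 hc1
    rw [neg_div] at hl
    have rV := ricciBound_chart hric x V
    have rW := ricciBound_chart hric x W
    have e1 : 0 ≤ -a * K * chartMetric x (extChartAt (𝓡 n) x x) V V :=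
      mul_nonneg (mul_nonneg (by linarith) (by linarith)) hV
    -- `2 Ric(W, W) ≥ -2aK|W|²` combined with the reaction term. The bracket is nonnegative because
    -- `-ln h / (1 - h²) ≤ -ln c / (1 - c²) ≤ K + 1/2`.
    have e2 : 0 ≤ -a * chartMetric x (extChartAt (𝓡 n) x x) W W
        * (2 * K + 1 + 2 * (Real.log h / (1 - h ^ 2))) :=
      mul_nonneg (mul_nonneg (by linarith) hW) (by linarith)
    linarith

/-- The differential Harnack inequality. -/
theorem riccatiBarrier_le_harnackQuantity [CompactSpace M] (ha : a ≠ 0)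
    (hcurv : ∀ x t, 0 < t → ∀ V W : EuclideanSpace ℝ (Fin n),
      0 ≤ 2 * LocalMetric.ric (chartMetric x) (extChartAt (𝓡 n) x x) V
        + 2 * LocalMetric.ric (chartMetric x) (extChartAt (𝓡 n) x x) W
        + a * chartMetric x (extChartAt (𝓡 n) x x) W W
          * (1 - 2 * (1 + Real.log (φ x t / ψ x t) / (1 - (φ x t / ψ x t) ^ 2))))
    (x : M) {t : ℝ} (ht : 0 < t) : riccatiBarrier n a t ≤ harnackQuantity n φ ψ x t := by
  -- The comparison needs `n ≠ 0`; in dimension zero both sides vanish.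
  rcases eq_or_ne n 0 with rfl | hn
  · have hu : extChartAt (𝓡 0) x x ∈ (extChartAt (𝓡 0) x).target := mem_extChartAt_target x
    have h := harnackQuantity_chart hφ hψ hlt hu ht
    have hx : (extChartAt (𝓡 0) x).symm (extChartAt (𝓡 0) x x) = x := extChartAt_to_inv x
    have hz : ∀ V : EuclideanSpace ℝ (Fin 0), V = 0 := fun V => Subsingleton.elim _ _
    have htr : ∀ A : EuclideanSpace ℝ (Fin 0) →L[ℝ] EuclideanSpace ℝ (Fin 0),
        LocalMetric.tr _ A = 0 := fun A => by
      rw [show A = 0 from ContinuousLinearMap.ext fun V => hz _, map_zero]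
    rw [hx, LocalMetric.lap, htr, hz (LocalMetric.grad _ _ _), map_zero] at h
    rw [h]
    simp [riccatiBarrier]
  · exact riccatiBarrier_le hn ha (continuousOn_harnackQuantity hφ hψ hlt)
      (fun x t ht hmin => harnackQuantity_evolution hφ hψ hlt hn hcurv x ht hmin) x ht

end HarnackGeometry
end DifferentialHarnack

/-! ### Existence of minimal geodesics and Lipschitz bounds from the differential. -/

noncomputable section MinimalGeodesics
set_option maxSynthPendingDepth 3
namespace HarnackGeometry

open Filter Topology MeasureTheory Set

/-- In a compact space, almost minimizing curves parametrized proportionally to arc length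
subconverge to a minimal geodesic. -/
lemma exists_isMinimalGeodesic_of_approx {X : Type*} [MetricSpace X] [CompactSpace X] (x y : X)
    (h : ∀ δ : ℝ, 0 < δ → ∃ σ : ℝ → X, σ 0 = x ∧ σ 1 = y ∧ ∀ r ∈ Icc (0 : ℝ) 1,
      ∀ s ∈ Icc (0 : ℝ) 1, dist (σ r) (σ s) ≤ |r - s| * (dist x y + δ)) :
    ∃ σ : ℝ → X, IsMinimalGeodesic x y σ := by
  choose σ h0 h1 hσ using fun k : ℕ => h (1 / (k + 1)) (by positivity)
  -- An ultrafilter gives limits at all parameters simultaneously, in place of a diagonal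
  -- subsequence.
  have hlim : ∀ r : ℝ, ∃ z : X, Tendsto (fun k => σ k r) (hyperfilter ℕ) (𝓝 z) := fun r => by
    obtain ⟨z, -, hz⟩ := isCompact_univ.ultrafilter_le_nhds
      ((hyperfilter ℕ).map fun k => σ k r) (by simp)
    exact ⟨z, hz⟩
  choose τ hτ using hlim
  have e0 : τ 0 = x := tendsto_nhds_unique (hτ 0) (by simp [h0])
  have e1 : τ 1 = y := tendsto_nhds_unique (hτ 1) (by simp [h1])
  have hle : ∀ r ∈ Icc (0 : ℝ) 1, ∀ s ∈ Icc (0 : ℝ) 1,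
      dist (τ r) (τ s) ≤ |r - s| * dist x y := by
    intro r hr s hs
    have ht : Tendsto (fun k : ℕ => |r - s| * (dist x y + 1 / ((k : ℝ) + 1))) (hyperfilter ℕ)
        (𝓝 (|r - s| * (dist x y + 0))) :=
      (tendsto_one_div_add_atTop_nhds_zero_nat.mono_left Nat.hyperfilter_le_atTop).const_add _
        |>.const_mul _
    rw [add_zero] at ht
    exact le_of_tendsto_of_tendsto ((hτ r).dist (hτ s)) ht
      (Eventually.of_forall fun k => hσ k r hr s hs)
  -- The upper bounds on the three pieces `[0, r]`, `[r, s]`, `[s, 1]` add up to `dist x y`, so the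
  -- triangle inequality forces equality in each.
  have hmono : ∀ r ∈ Icc (0 : ℝ) 1, ∀ s ∈ Icc (0 : ℝ) 1, r ≤ s →
      dist (τ r) (τ s) = (s - r) * dist x y := by
    intro r hr s hs hrs
    have i0 := hle 0 ⟨le_rfl, zero_le_one⟩ r hr
    have i1 := hle r hr s hs
    have i2 := hle s hs 1 ⟨zero_le_one, le_rfl⟩
    rw [e0, abs_of_nonpos (by linarith [hr.1])] at i0
    rw [e1, abs_of_nonpos (by linarith [hs.2])] at i2
    rw [abs_of_nonpos (by linarith)] at i1
    have i3 := dist_triangle4 x (τ r) (τ s) y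
    linarith
  refine ⟨τ, e0, e1, fun r hr s hs => ?_⟩
  rcases le_total r s with hrs | hrs
  · rw [hmono r hr s hs hrs, abs_of_nonpos (by linarith), neg_sub]
  · rw [dist_comm, hmono s hs r hr hrs, abs_of_nonneg (by linarith)]

variable {n : ℕ} {M : Type*} [MetricSpace M] [ChartedSpace (EuclideanSpace ℝ (Fin n)) M]
  [Bundle.RiemannianBundle (fun x : M => TangentSpace (𝓡 n) x)]

/-- The length of a curve of finite length depends continuously on its endpoint. -/
lemma continuousOn_pathELength {γ : ℝ → M} {a b : ℝ}
    (h : Manifold.pathELength (𝓡 n) γ a b ≠ ⊤) :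
    ContinuousOn (fun t => (Manifold.pathELength (𝓡 n) γ a t).toReal) (Icc a b) := by
  have hfin : ∀ t ∈ Icc a b, Manifold.pathELength (𝓡 n) γ a t ≠ ⊤ := fun t ht =>
    ne_top_of_le_ne_top h (Manifold.pathELength_mono le_rfl ht.2)
  have hsub : ∀ s ∈ Icc a b, ∀ t ∈ Icc a b, s ≤ t →
      (Manifold.pathELength (𝓡 n) γ a t).toReal - (Manifold.pathELength (𝓡 n) γ a s).toReal
        = (Manifold.pathELength (𝓡 n) γ s t).toReal := fun s hs t ht hst => by
    have hst' := ne_top_of_le_ne_top (hfin t ht) (Manifold.pathELength_mono hs.1 le_rfl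
      (I := 𝓡 n) (γ := γ))
    rw [← Manifold.pathELength_add hs.1 hst, ENNReal.toReal_add (hfin s hs) hst']
    ring
  intro t ht
  -- Absolute continuity of the integral: the speed is integrable on `[a, b]` and the interval
  -- between `s` and `t` shrinks to measure zero.
  have hz : Tendsto (fun s => Manifold.pathELength (𝓡 n) γ (min s t) (max s t))
      (𝓝[Icc a b] t) (𝓝 0) := by
    have hrw : ∀ s ∈ Icc a b, Manifold.pathELength (𝓡 n) γ (min s t) (max s t)
        = ∫⁻ r in Icc (min s t) (max s t), ‖mfderiv 𝓘(ℝ, ℝ) (𝓡 n) γ r 1‖ₑ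
            ∂(volume.restrict (Icc a b)) := fun s hs => by
      rw [Manifold.pathELength_eq_lintegral_mfderiv_Icc,
        Measure.restrict_restrict measurableSet_Icc, inter_eq_left.2]
      exact Icc_subset_Icc (le_min hs.1 ht.1) (max_le hs.2 ht.2)
    have hvol : Tendsto ((volume.restrict (Icc a b)) ∘ fun s => Icc (min s t) (max s t))
        (𝓝[Icc a b] t) (𝓝 0) := by
      have h1 : Tendsto (fun s => ENNReal.ofReal (max s t - min s t)) (𝓝[Icc a b] t)
          (𝓝 (ENNReal.ofReal (max t t - min t t))) :=
        (ENNReal.continuous_ofReal.comp (by fun_prop :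
          Continuous fun s => max s t - min s t)).continuousAt.mono_left nhdsWithin_le_nhds
      simp only [max_self, min_self, sub_self, ENNReal.ofReal_zero] at h1
      refine tendsto_of_tendsto_of_tendsto_of_le_of_le tendsto_const_nhds h1
        (fun _ => zero_le) fun s => ?_
      exact (Measure.restrict_apply_le _ _).trans (by rw [Real.volume_Icc])
    rw [Manifold.pathELength_eq_lintegral_mfderiv_Icc] at h
    refine (tendsto_setLIntegral_zero h hvol).congr' ?_
    filter_upwards [self_mem_nhdsWithin] with s hs using (hrw s hs).symm
  have hz' := (ENNReal.tendsto_toReal ENNReal.zero_ne_top).comp hz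
  rw [ENNReal.toReal_zero] at hz'
  rw [ContinuousWithinAt, tendsto_iff_dist_tendsto_zero]
  refine hz'.congr' ?_
  filter_upwards [self_mem_nhdsWithin] with s hs
  rw [Real.dist_eq, Function.comp_apply]
  rcases le_total s t with hst | hst
  · rw [min_eq_left hst, max_eq_right hst, ← hsub s hs t ht hst, abs_sub_comm, abs_of_nonneg]
    rw [hsub s hs t ht hst]
    exact ENNReal.toReal_nonneg
  · rw [min_eq_right hst, max_eq_left hst, ← hsub t ht s hs hst, abs_of_nonneg]
    rw [hsub t ht s hs hst]
    exact ENNReal.toReal_nonneg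

variable [IsRiemannianManifold (𝓡 n) M]

lemma edist_le_pathELength {γ : ℝ → M} (hγ : ContMDiffOn 𝓘(ℝ, ℝ) (𝓡 n) 1 γ (Icc 0 1)) {s t : ℝ}
    (hs : 0 ≤ s) (hst : s ≤ t) (ht : t ≤ 1) :
    edist (γ s) (γ t) ≤ Manifold.pathELength (𝓡 n) γ s t := by
  rw [IsRiemannianManifold.out (I := 𝓡 n)]
  exact Manifold.riemannianEDist_le_pathELength (hγ.mono (Icc_subset_Icc hs ht)) rfl rfl hst

/-- Curves joining two points whose length almost realizes the distance. -/
lemma exists_curve_length_lt (x y : M) {δ : ℝ} (hδ : 0 < δ) :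
    ∃ γ : ℝ → M, γ 0 = x ∧ γ 1 = y ∧ ContMDiffOn 𝓘(ℝ, ℝ) (𝓡 n) 1 γ (Icc 0 1) ∧
      Manifold.pathELength (𝓡 n) γ 0 1 < ENNReal.ofReal (dist x y + δ) := by
  refine Manifold.exists_lt_of_riemannianEDist_lt ?_
  rw [← IsRiemannianManifold.out (I := 𝓡 n), edist_dist]
  exact (ENNReal.ofReal_lt_ofReal_iff (by positivity)).2 (by linarith)

/-- The Hopf–Rinow theorem for compact manifolds. -/
theorem exists_isMinimalGeodesic (n : ℕ) {M : Type*} [MetricSpace M] [CompactSpace M]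
    [ChartedSpace (EuclideanSpace ℝ (Fin n)) M]
    [Bundle.RiemannianBundle (fun x : M => TangentSpace (𝓡 n) x)]
    [IsRiemannianManifold (𝓡 n) M] (x y : M) :
    ∃ σ : ℝ → M, IsMinimalGeodesic x y σ := by
  refine exists_isMinimalGeodesic_of_approx x y fun δ hδ => ?_
  obtain ⟨γ, h0, h1, hγ, hlen⟩ := exists_curve_length_lt (n := n) x y hδ
  have hfin : Manifold.pathELength (𝓡 n) γ 0 1 ≠ ⊤ := hlen.ne_top
  set ℓ : ℝ → ℝ := fun t => (Manifold.pathELength (𝓡 n) γ 0 t).toReal with hℓ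
  have hL : ℓ 1 ≤ dist x y + δ := by
    have := ENNReal.toReal_mono ENNReal.ofReal_ne_top hlen.le
    rwa [ENNReal.toReal_ofReal (by positivity)] at this
  have hL0 : 0 ≤ ℓ 1 := ENNReal.toReal_nonneg
  have hl0 : ℓ 0 = 0 := by simp [hℓ]
  have hbase : ∀ s t, 0 ≤ s → s ≤ t → t ≤ 1 → dist (γ s) (γ t) ≤ ℓ t - ℓ s := by
    intro s t hs hst ht
    have hf : Manifold.pathELength (𝓡 n) γ 0 t ≠ ⊤ :=
      ne_top_of_le_ne_top hfin (Manifold.pathELength_mono le_rfl ht)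
    have hf1 := ne_top_of_le_ne_top hf (Manifold.pathELength_mono le_rfl hst (I := 𝓡 n) (γ := γ))
    have hf2 := ne_top_of_le_ne_top hf (Manifold.pathELength_mono hs le_rfl (I := 𝓡 n) (γ := γ))
    have h := ENNReal.toReal_mono hf2 (edist_le_pathELength hγ hs hst ht)
    have hadd : ℓ t = ℓ s + (Manifold.pathELength (𝓡 n) γ s t).toReal := by
      simp only [hℓ]
      rw [← ENNReal.toReal_add hf1 hf2, Manifold.pathELength_add hs hst]
    rw [← dist_edist] at h
    linarith
  have hdist : ∀ s ∈ Icc (0 : ℝ) 1, ∀ t ∈ Icc (0 : ℝ) 1, dist (γ s) (γ t) ≤ |ℓ s - ℓ t| := by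
    intro s hs t ht
    rcases le_total s t with hst | hst
    · have := hbase s t hs.1 hst ht.2
      rw [abs_sub_comm]
      exact this.trans (le_abs_self _)
    · rw [dist_comm]
      exact (hbase t s ht.1 hst hs.2).trans (le_abs_self _)
  -- A right inverse of normalized arc length. It may not be unique where the curve rests, but
  -- `hdist` makes the choice harmless. The endpoints are prescribed so that the new curve still
  -- starts at `x` and ends at `y`.
  have hpar : ∀ r : ℝ, ∃ t, r ∈ Icc (0 : ℝ) 1 →
      t ∈ Icc (0 : ℝ) 1 ∧ ℓ t = r * ℓ 1 ∧ (r = 0 → t = 0) ∧ (r = 1 → t = 1) := by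
    intro r
    by_cases hr0 : r = 0
    · exact ⟨0, fun _ => ⟨by simp, by simp [hr0, hl0], by simp, by simp [hr0]⟩⟩
    by_cases hr1 : r = 1
    · exact ⟨1, fun _ => ⟨by simp, by simp [hr1], by simp [hr1], by simp⟩⟩
    by_cases hr : r ∈ Icc (0 : ℝ) 1
    · obtain ⟨t, ht, hte⟩ := intermediate_value_Icc zero_le_one (continuousOn_pathELength hfin)
        (show r * ℓ 1 ∈ Icc (ℓ 0) (ℓ 1) from
          ⟨by rw [hl0]; exact mul_nonneg hr.1 hL0, mul_le_of_le_one_left hL0 hr.2⟩)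
      exact ⟨t, fun _ => ⟨ht, hte, fun h => absurd h hr0, fun h => absurd h hr1⟩⟩
    · exact ⟨0, fun h => absurd h hr⟩
  choose p hp using hpar
  refine ⟨fun r => γ (p r), ?_, ?_, fun r hr s hs => ?_⟩
  · simp only [(hp 0 (by simp)).2.2.1, h0]
  · simp only [(hp 1 (by simp)).2.2.2, h1]
  · refine (hdist _ (hp r hr).1 _ (hp s hs).1).trans ?_
    rw [(hp r hr).2.1, (hp s hs).2.1, ← sub_mul, abs_mul, abs_of_nonneg hL0]
    exact mul_le_mul_of_nonneg_left hL (abs_nonneg _)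

/-- A function whose differential is bounded by `C` on a ball is `C`-Lipschitz at the centre. -/
lemma abs_sub_le_of_norm_mvfderiv_le [IsManifold (𝓡 n) 1 M] {F : M → ℝ}
    (hF : ContMDiff (𝓡 n) 𝓘(ℝ, ℝ) 1 F)
    {x : M} {r C : ℝ} (hC : 0 ≤ C) (h : ∀ z, dist x z < r → ‖mvfderiv (𝓡 n) F z‖ ≤ C)
    {y : M} (hy : dist x y < r) : |F y - F x| ≤ C * dist x y := by
  have key : ∀ δ : ℝ, 0 < δ → δ < r - dist x y → |F y - F x| ≤ C * (dist x y + δ) := by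
    intro δ hδ hδr
    obtain ⟨γ, h0, h1, hγ, hlen⟩ := exists_curve_length_lt (n := n) x y hδ
    -- Since `δ < r - dist x y`, the curve is shorter than `r` and cannot leave the ball where the
    -- differential is controlled.
    have hball : ∀ t ∈ Icc (0 : ℝ) 1, dist x (γ t) < r := by
      intro t ht
      have e := (edist_le_pathELength hγ le_rfl ht.1 ht.2).trans
        ((Manifold.pathELength_mono le_rfl ht.2).trans hlen.le)
      rw [h0, edist_dist, ENNReal.ofReal_le_ofReal_iff (by positivity)] at e
      linarith
    have hcd : ContDiffOn ℝ 1 (F ∘ γ) (Icc 0 1) :=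
      contMDiffOn_iff_contDiffOn.1 (hF.comp_contMDiffOn hγ)
    have hvar := enorm_sub_le_lintegral_derivWithin_Icc_of_contDiffOn_Icc hcd zero_le_one
    have hpt : ∀ t ∈ Icc (0 : ℝ) 1, ‖derivWithin (F ∘ γ) (Icc 0 1) t‖ₑ
        ≤ ENNReal.ofReal C * ‖mfderivWithin 𝓘(ℝ, ℝ) (𝓡 n) γ (Icc 0 1) t 1‖ₑ := by
      intro t ht
      have hu : UniqueMDiffWithinAt 𝓘(ℝ, ℝ) (Icc (0 : ℝ) 1) t :=
        (uniqueDiffOn_Icc zero_lt_one t ht).uniqueMDiffWithinAt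
      have hd : derivWithin (F ∘ γ) (Icc 0 1) t
          = mvfderiv (𝓡 n) F (γ t) (mfderivWithin 𝓘(ℝ, ℝ) (𝓡 n) γ (Icc 0 1) t 1) := by
        have h2 := mfderiv_comp_mfderivWithin t
          ((hF.mdifferentiable one_ne_zero) (γ t))
          ((hγ.mdifferentiableOn one_ne_zero) t ht) hu
        rw [← fderivWithin_derivWithin, ← mfderivWithin_eq_fderivWithin]
        exact DFunLike.congr_fun h2 1
      rw [hd, ← ofReal_norm, ← ofReal_norm, ← ENNReal.ofReal_mul hC]
      refine ENNReal.ofReal_le_ofReal ?_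
      exact (ContinuousLinearMap.le_opNorm _ _).trans
        (mul_le_mul_of_nonneg_right (h _ (hball t ht)) (norm_nonneg _))
    have hint : ‖(F ∘ γ) 1 - (F ∘ γ) 0‖ₑ ≤ ENNReal.ofReal C * ENNReal.ofReal (dist x y + δ) := by
      refine hvar.trans ((setLIntegral_mono' measurableSet_Icc hpt).trans ?_)
      rw [lintegral_const_mul' _ _ ENNReal.ofReal_ne_top,
        ← Manifold.pathELength_eq_lintegral_mfderivWithin_Icc]
      gcongr
    rw [← ENNReal.ofReal_mul hC, ← ofReal_norm, ENNReal.ofReal_le_ofReal_iff (by positivity),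
      Function.comp_apply, Function.comp_apply, h0, h1] at hint
    exact hint
  have hlim : Tendsto (fun δ : ℝ => C * (dist x y + δ)) (𝓝[>] 0) (𝓝 (C * (dist x y + 0))) :=
    ((by fun_prop : Continuous fun δ : ℝ => C * (dist x y + δ)).tendsto 0).mono_left
      nhdsWithin_le_nhds
  rw [add_zero] at hlim
  refine ge_of_tendsto hlim ?_
  filter_upwards [Ioo_mem_nhdsGT (show (0 : ℝ) < r - dist x y by linarith)] with δ hδ
  exact key δ hδ.1 hδ.2

end HarnackGeometry
end MinimalGeodesics

/-! ### Integration along the curve. -/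

noncomputable section IntegratedHarnack
set_option maxSynthPendingDepth 3
namespace HarnackGeometry

open Filter Topology Set

/-- The fraction `(e^{at} - e^{at₁}) / (e^{at₂} - e^{at₁})`. -/
def expFraction (a t₁ t₂ t : ℝ) : ℝ :=
  (Real.exp (a * t) - Real.exp (a * t₁)) / (Real.exp (a * t₂) - Real.exp (a * t₁))

lemma exp_sub_exp_ne {a t₁ t₂ : ℝ} (ha : a ≠ 0) (ht : t₁ < t₂) :
    Real.exp (a * t₂) - Real.exp (a * t₁) ≠ 0 := fun h =>
  ht.ne' (mul_left_cancel₀ ha (Real.exp_injective (sub_eq_zero.1 h)))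

lemma expFraction_mem_Icc {a t₁ t₂ t : ℝ} (ha : a ≠ 0) (ht : t ∈ Icc t₁ t₂) :
    expFraction a t₁ t₂ t ∈ Icc (0 : ℝ) 1 := by
  rw [expFraction]
  rcases ha.lt_or_gt with h | h
  · have h1 : Real.exp (a * t) ≤ Real.exp (a * t₁) := Real.exp_le_exp.2 (by nlinarith [ht.1])
    have h2 : Real.exp (a * t₂) ≤ Real.exp (a * t) := Real.exp_le_exp.2 (by nlinarith [ht.2])
    exact ⟨div_nonneg_of_nonpos (by linarith) (by linarith),
      div_le_one_of_ge (by linarith) (by linarith)⟩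
  · have h1 : Real.exp (a * t₁) ≤ Real.exp (a * t) := Real.exp_le_exp.2 (by nlinarith [ht.1])
    have h2 : Real.exp (a * t) ≤ Real.exp (a * t₂) := Real.exp_le_exp.2 (by nlinarith [ht.2])
    exact ⟨div_nonneg (by linarith) (by linarith), div_le_one_of_le₀ (by linarith) (by linarith)⟩

lemma hasDerivAt_exp_mul (a t : ℝ) :
    HasDerivAt (fun s => Real.exp (a * s)) (a * Real.exp (a * t)) t := by
  have h := ((hasDerivAt_id t).const_mul a).exp
  simpa [mul_comm] using h

lemma hasDerivAt_expFraction (a t₁ t₂ t : ℝ) :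
    HasDerivAt (expFraction a t₁ t₂)
      (a * Real.exp (a * t) / (Real.exp (a * t₂) - Real.exp (a * t₁))) t :=
  ((hasDerivAt_exp_mul a t).sub_const _).div_const _

/-- The derivative is `-(2/n) e^{-at}` times the barrier, so this primitive produces the logarithmic
term of the conclusion. -/
lemma hasDerivAt_log_one_sub_exp_div {a t : ℝ} (ha : a ≠ 0) (ht : 0 < t) :
    HasDerivAt (fun s => Real.log ((1 - Real.exp (-a * s)) / a))
      (Real.exp (-a * t) * (a / (1 - Real.exp (-a * t)))) t := by
  have h := (((hasDerivAt_exp_mul (-a) t).const_sub 1).div_const a).log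
    (one_sub_exp_div_pos ha ht).ne'
  refine h.congr_deriv ?_
  have := one_sub_exp_ne ha ht
  field_simp

lemma hasDerivAt_boundary {p l q : ℝ → ℝ} {p' l' c₀ c₁ c₂ c₃ t₁ t : ℝ} (hp : HasDerivAt p p' t)
    (hl : HasDerivAt l l' t) (hq : Continuous q) :
    HasDerivAt (fun t => c₀ + c₁ * p t + c₂ * (l t - c₃) - ∫ s in t₁..t, q s)
      (c₁ * p' + c₂ * l' - q t) t := by
  have h1 := intervalIntegral.integral_hasDerivAt_right
    (hq.intervalIntegrable t₁ t) (hq.stronglyMeasurableAtFilter _ _) hq.continuousAt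
  exact (((hp.const_mul c₁).const_add c₀).fun_add ((hl.sub_const c₃).const_mul c₂)).fun_sub h1

/-- Young's inequality for the rate of change along the curve. -/
lemma rate_le {a t E D g L P q v : ℝ} (hv : v = a * Real.exp (a * t) / E) (hg : 0 ≤ g)
    (hL : -P ≤ L - q) (y : ℝ) :
    Real.exp (-a * t) * (√g * (|v| * D))
      - (-a * Real.exp (-a * t) * y + Real.exp (-a * t) * (L + g + a * y))
      ≤ a / 4 * (D ^ 2 / E) * v + Real.exp (-a * t) * P - Real.exp (-a * t) * q := by
  have hyoung : √g * (|v| * D) - g ≤ v ^ 2 * D ^ 2 / 4 := by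
    have h1 := sq_nonneg (√g - |v| * D / 2)
    have h2 : (|v| * D) ^ 2 = v ^ 2 * D ^ 2 := by rw [mul_pow, sq_abs]
    have h3 := Real.sq_sqrt hg
    linarith
  have hw : Real.exp (-a * t) * Real.exp (a * t) = 1 := by
    rw [← Real.exp_add]
    simp
  -- The reason for the exponential parametrization: `e^{-at} v²` is a constant multiple of `v`, so
  -- the kinetic term integrates exactly.
  have hv2 : Real.exp (-a * t) * (v ^ 2 * D ^ 2 / 4) = a / 4 * (D ^ 2 / E) * v := by
    rw [show v ^ 2 = (a / E) * v * Real.exp (a * t) by rw [hv]; ring]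
    linear_combination (a / E * v * D ^ 2 / 4) * hw
  have hm := mul_le_mul_of_nonneg_left (add_le_add hyoung hL) (Real.exp_pos (-a * t)).le
  rw [← hv2]
  linarith

lemma continuousOn_of_dist_le {X : Type*} [MetricSpace X] {γ : ℝ → X} {p : ℝ → ℝ} {D : ℝ}
    {S : Set ℝ} (hp : Continuous p)
    (h : ∀ s ∈ S, ∀ t ∈ S, dist (γ t) (γ s) ≤ |p s - p t| * D) : ContinuousOn γ S := by
  intro t ht
  rw [ContinuousWithinAt, tendsto_iff_dist_tendsto_zero]
  have h1 : Tendsto (fun s => |p s - p t| * D) (𝓝[S] t) (𝓝 (|p t - p t| * D)) :=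
    ((by fun_prop : Continuous fun s => |p s - p t| * D).tendsto t).mono_left nhdsWithin_le_nhds
  rw [sub_self, abs_zero, zero_mul] at h1
  refine tendsto_of_tendsto_of_tendsto_of_le_of_le' tendsto_const_nhds h1
    (Eventually.of_forall fun _ => dist_nonneg) ?_
  filter_upwards [self_mem_nhdsWithin] with s hs
  rw [dist_comm]
  exact h s hs t ht

lemma _root_.ContinuousOn.along_curve {X : Type*} [TopologicalSpace X] {F : X → ℝ → ℝ}
    (hF : ContinuousOn (fun q : X × ℝ => F q.1 q.2) (univ ×ˢ Ioi 0)) {γ : ℝ → X} {S : Set ℝ}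
    (hγ : ContinuousOn γ S) (hS : ∀ t ∈ S, 0 < t) : ContinuousOn (fun t => F (γ t) t) S :=
  hF.comp (hγ.prodMk continuousOn_id) fun t h =>
    show (γ t, t) ∈ univ ×ˢ Ioi 0 from ⟨trivial, hS t h⟩

variable {n : ℕ} {M : Type*} [MetricSpace M] [ChartedSpace (EuclideanSpace ℝ (Fin n)) M]
  [IsManifold (𝓡 n) ∞ M] [Bundle.RiemannianBundle (fun x : M => TangentSpace (𝓡 n) x)]
  [IsContMDiffRiemannianBundle (𝓡 n) ∞ (EuclideanSpace ℝ (Fin n))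
      (fun x : M => TangentSpace (𝓡 n) x)]
  {a : ℝ} {φ ψ : M → ℝ → ℝ}

/-- The equation of `ln ψ`. -/
lemma hasDerivAt_log_solution (hψ : IsPositiveSolution n a ψ) (x : M) {t : ℝ} (ht : 0 < t) :
    HasDerivAt (fun s => Real.log (ψ x s)) (laplacian n (fun y => Real.log (ψ y t)) x
      + gradNormSq n (fun y => Real.log (ψ y t)) x + a * Real.log (ψ x t)) t := by
  have hu : extChartAt (𝓡 n) x x ∈ (extChartAt (𝓡 n) x).target := mem_extChartAt_target x
  have hx : (extChartAt (𝓡 n) x).symm (extChartAt (𝓡 n) x x) = x := extChartAt_to_inv x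
  have hs := contMDiff_slice (isSmoothFlow_log hψ.smooth hψ.pos) ht
  have h := (isMetricOn_chartMetric (n := n) x).log_equation hu
    (ψ := fun v s => ψ ((extChartAt (𝓡 n) x).symm v) s)
    (fun v hv => contDiffAt_comp_chart_symm_prod (F := ψ) hψ.smooth x hv ht)
    (fun v _ => hψ.pos _ t ht) (equation_chart hψ hu ht)
  rw [← laplacian_eq_lap hs hu, ← gradNormSq_eq hs hu, hx] at h
  rw [← h]
  exact ((hψ.equation x t ht).log (hψ.pos x t ht).ne').differentiableAt.hasDerivAt

/-- Upper bound for the right slopes of `-w f` along a Lipschitz curve. -/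
lemma eventually_slope_lt [IsRiemannianManifold (𝓡 n) M] {f : M → ℝ → ℝ}
    (hf : IsSmoothFlow (n := n) f)
    {γ : ℝ → M} {p w : ℝ → ℝ} {D v w' f' t T : ℝ} (ht : 0 < t) (htT : t < T)
    (hγ : ∀ s ∈ Icc t T, dist (γ t) (γ s) ≤ |p s - p t| * D) (hp : HasDerivAt p v t)
    (hw : HasDerivAt w w' t) (hwpos : ∀ s, 0 < w s) (hft : HasDerivAt (f (γ t)) f' t) {r : ℝ}
    (hr : w t * (√(gradNormSq n (fun y => f y t) (γ t)) * (|v| * D))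
      - (w' * f (γ t) t + w t * f') < r) :
    ∀ᶠ s in 𝓝[>] t, slope (fun s => -(w s * f (γ s) s)) t s < r := by
  set c := √(gradNormSq n (fun y => f y t) (γ t)) with hc
  -- The strict inequality leaves room for `C` slightly above `|∇f|`; by continuity `C` then bounds
  -- the gradient at all nearby points and times.
  obtain ⟨C, hcC, hC⟩ : ∃ C, c < C ∧ w t * (C * (|v| * D)) - (w' * f (γ t) t + w t * f') < r := by
    have h1 : Tendsto (fun C => w t * (C * (|v| * D)) - (w' * f (γ t) t + w t * f')) (𝓝[>] c)
        (𝓝 (w t * (c * (|v| * D)) - (w' * f (γ t) t + w t * f'))) :=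
      ((by fun_prop : Continuous fun C =>
        w t * (C * (|v| * D)) - (w' * f (γ t) t + w t * f')).tendsto c).mono_left
        nhdsWithin_le_nhds
    obtain ⟨C, h2, h3⟩ := ((h1.eventually (gt_mem_nhds hr)).and self_mem_nhdsWithin).exists
    exact ⟨C, h3, h2⟩
  have hC0 : 0 ≤ C := (Real.sqrt_nonneg _).trans hcC.le
  have hsq : gradNormSq n (fun y => f y t) (γ t) < C ^ 2 := (Real.sqrt_lt_sqrt_iff
    (sq_nonneg _)).1 (by rwa [Real.sqrt_sq hC0])
  have hcont : ∀ᶠ q : M × ℝ in 𝓝 (γ t, t), gradNormSq n (fun y => f y q.2) q.1 < C ^ 2 :=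
    ((continuousOn_gradNormSq hf).continuousAt
      ((isOpen_univ.prod isOpen_Ioi).mem_nhds
        (show (γ t, t) ∈ univ ×ˢ Ioi 0 from ⟨trivial, ht⟩))).eventually (gt_mem_nhds hsq)
  obtain ⟨ρ, hρ, hball⟩ := Metric.eventually_nhds_iff.1 hcont
  have e1 : ∀ᶠ s in 𝓝[>] t, s ∈ Ioo t T := Ioo_mem_nhdsGT htT
  have e2 : ∀ᶠ s in 𝓝[>] t, dist s t < ρ :=
    nhdsWithin_le_nhds (Metric.ball_mem_nhds t hρ)
  have e3 : ∀ᶠ s in 𝓝[>] t, |p s - p t| * D < ρ := by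
    have h1 : Tendsto (fun s => |p s - p t| * D) (𝓝 t) (𝓝 (|p t - p t| * D)) :=
      ((hp.continuousAt.sub continuousAt_const).abs.mul continuousAt_const)
    rw [sub_self, abs_zero, zero_mul] at h1
    exact (h1.eventually (gt_mem_nhds hρ)).filter_mono nhdsWithin_le_nhds
  have hlim : Tendsto (fun s => w s * (C * (|slope p t s| * D))
      - slope (fun s => w s * f (γ t) s) t s) (𝓝[>] t)
      (𝓝 (w t * (C * (|v| * D)) - (w' * f (γ t) t + w t * f'))) := by
    have hle : 𝓝[>] t ≤ 𝓝[≠] t := nhdsWithin_mono t fun s hs => ne_of_gt hs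
    have s1 := (hasDerivAt_iff_tendsto_slope.1 hp).mono_left hle
    have s2 := (hasDerivAt_iff_tendsto_slope.1 (hw.fun_mul hft)).mono_left hle
    have s3 := hw.continuousAt.tendsto.mono_left (nhdsWithin_le_nhds (s := Ioi t))
    exact (s3.mul ((s1.abs.mul_const D).const_mul C)).sub s2
  filter_upwards [e1, e2, e3, hlim.eventually (gt_mem_nhds hC)] with s hs1 hs2 hs3 hs4
  refine lt_of_le_of_lt ?_ hs4
  have hs0 : 0 < s - t := sub_pos.2 hs1.1
  have hdist := hγ s ⟨hs1.1.le, hs1.2.le⟩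
  -- The increment is split into a move in space at the fixed later time `s`, bounded by the
  -- Lipschitz estimate, and a move in time at the fixed point `γ t`. No derivative of `γ` is
  -- needed.
  have hlip := abs_sub_le_of_norm_mvfderiv_le (n := n) (F := fun y => f y s) (x := γ t) (y := γ s)
    ((contMDiff_slice hf (ht.trans hs1.1)).of_le (by simp)) hC0
    (fun z hz => by
      have h1 := hball (y := (z, s)) (by
        rw [Prod.dist_eq]
        exact max_lt (by rwa [dist_comm]) hs2)
      exact (sq_le_sq₀ (norm_nonneg _) hC0).1 h1.le)
    (hdist.trans_lt hs3)
  have habs : |p s - p t| = (s - t) * |slope p t s| := by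
    rw [slope_def_field, abs_div, abs_of_pos hs0]
    field_simp
  have hfin : -(f (γ s) s - f (γ t) s) ≤ C * ((s - t) * |slope p t s| * D) := by
    refine (neg_le_abs _).trans (hlip.trans ?_)
    rw [← habs]
    exact mul_le_mul_of_nonneg_left hdist hC0
  have hslope : slope (fun s => w s * f (γ t) s) t s * (s - t)
      = w s * f (γ t) s - w t * f (γ t) t := by
    rw [slope_def_field, div_mul_cancel₀ _ hs0.ne']
  rw [slope_def_field, div_le_iff₀ hs0, sub_mul, hslope]
  have := mul_le_mul_of_nonneg_left hfin (hwpos s).le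
  linarith

/-- The Harnack inequality along a curve moving on a minimal geodesic. -/
theorem integrated_harnack [IsRiemannianManifold (𝓡 n) M] (ha : a ≠ 0)
    (hφ : IsPositiveSolution n a φ) (hψ : IsPositiveSolution n a ψ)
    (hlt : ∀ x t, 0 < t → φ x t < ψ x t)
    (hH : ∀ x t, 0 < t → riccatiBarrier n a t ≤ harnackQuantity n φ ψ x t)
    {x₁ x₂ : M} {t₁ t₂ : ℝ} (ht₁ : 0 < t₁) (ht : t₁ < t₂) {σ γ : ℝ → M}
    (hσ : IsMinimalGeodesic x₁ x₂ σ)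
    (hγ : ∀ t ∈ Icc t₁ t₂, γ t = σ (expFraction a t₁ t₂ t)) :
    Real.exp (-a * t₁) * Real.log (ψ x₁ t₁) - Real.exp (-a * t₂) * Real.log (ψ x₂ t₂) ≤
        a / 4 * (dist x₁ x₂ ^ 2 / (Real.exp (a * t₂) - Real.exp (a * t₁)))
        + n / 2 * Real.log ((1 - Real.exp (-a * t₂)) / (1 - Real.exp (-a * t₁)))
        - ∫ t in t₁..t₂, Real.exp (-a * t) * (gradNormSq n (fun y => φ y t / ψ y t) (γ t)
              / (1 - (φ (γ t) t / ψ (γ t) t) ^ 2)) := by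
  set p := expFraction a t₁ t₂ with hp
  set D := dist x₁ x₂ with hD
  set E := Real.exp (a * t₂) - Real.exp (a * t₁) with hE
  have hE0 : E ≠ 0 := exp_sub_exp_ne ha ht
  have ht₂ : 0 < t₂ := ht₁.trans ht
  have hpd : ∀ t, HasDerivAt p (a * Real.exp (a * t) / E) t := hasDerivAt_expFraction a t₁ t₂
  have hpos : ∀ t ∈ Icc t₁ t₂, 0 < t := fun t h => ht₁.trans_le h.1
  have hdist : ∀ s ∈ Icc t₁ t₂, ∀ t ∈ Icc t₁ t₂, dist (γ t) (γ s) = |p s - p t| * D := by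
    intro s hs t ht
    rw [hγ s hs, hγ t ht, hσ.dist_eq _ (expFraction_mem_Icc ha ht) _ (expFraction_mem_Icc ha hs),
      abs_sub_comm]
  have hγc : ContinuousOn γ (Icc t₁ t₂) := continuousOn_of_dist_le
    (continuous_iff_continuousAt.2 fun t => (hpd t).continuousAt)
    fun s hs t ht => (hdist s hs t ht).le
  have hh1 : ∀ x t, 0 < t → 0 < 1 - (φ x t / ψ x t) ^ 2 := fun x t h => by
    have h0 : 0 < φ x t / ψ x t := div_pos (hφ.pos x t h) (hψ.pos x t h)
    have h1 : φ x t / ψ x t < 1 := (div_lt_one (hψ.pos x t h)).2 (hlt x t h)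
    nlinarith
  have hsh := isSmoothFlow_div hφ.smooth hψ.smooth hψ.pos
  have hsf := isSmoothFlow_log hψ.smooth hψ.pos
  have hg := (continuousOn_gradNormSq (F := fun x t => φ x t / ψ x t) hsh).along_curve hγc hpos
    (F := fun x t => gradNormSq n (fun y => φ y t / ψ y t) x)
  have hr := hsh.continuousOn.along_curve (F := fun x t => φ x t / ψ x t) hγc hpos
  have hl := hsf.continuousOn.along_curve (F := fun x t => Real.log (ψ x t)) hγc hpos
  have hexp : ContinuousOn (fun t => Real.exp (-a * t)) (Icc t₁ t₂) := by fun_prop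
  have hQc : ContinuousOn (fun t => Real.exp (-a * t) * (gradNormSq n (fun y => φ y t / ψ y t) (γ t)
      / (1 - (φ (γ t) t / ψ (γ t) t) ^ 2))) (Icc t₁ t₂) :=
    hexp.fun_mul (hg.div (continuousOn_const.sub (hr.pow 2))
      fun t h => (hh1 _ t (hpos t h)).ne')
  have hGc : ContinuousOn (fun t => -(Real.exp (-a * t) * Real.log (ψ (γ t) t))) (Icc t₁ t₂) :=
    (hexp.fun_mul hl).fun_neg
  set Q : ℝ → ℝ := fun t => Real.exp (-a * t) * (gradNormSq n (fun y => φ y t / ψ y t) (γ t)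
      / (1 - (φ (γ t) t / ψ (γ t) t) ^ 2)) with hQ
  set G : ℝ → ℝ := fun t => -(Real.exp (-a * t) * Real.log (ψ (γ t) t)) with hG
  -- The claimed bound as a function of the final time, equal to `G` at `t₁`. Extending `Q` by
  -- constants outside the interval makes `B` differentiable at the endpoints as well.
  set B : ℝ → ℝ := fun t => G t₁ + a / 4 * (D ^ 2 / E) * p t
    + n / 2 * (Real.log ((1 - Real.exp (-a * t)) / a) - Real.log ((1 - Real.exp (-a * t₁)) / a))
    - ∫ s in t₁..t, Q (projIcc t₁ t₂ ht.le s) with hB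
  have hQe : Continuous fun s => Q (projIcc t₁ t₂ ht.le s) :=
    (continuousOn_iff_continuous_domRestrict.1 hQc).comp continuous_projIcc
  have hBd : ∀ t ∈ Icc t₁ t₂, HasDerivAt B (a / 4 * (D ^ 2 / E) * (a * Real.exp (a * t) / E)
      + n / 2 * (Real.exp (-a * t) * (a / (1 - Real.exp (-a * t)))) - Q t) t := by
    intro t hti
    have h1 := hasDerivAt_boundary (c₀ := G t₁) (c₁ := a / 4 * (D ^ 2 / E)) (c₂ := n / 2)
      (c₃ := Real.log ((1 - Real.exp (-a * t₁)) / a)) (t₁ := t₁) (hpd t)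
      (hasDerivAt_log_one_sub_exp_div ha (hpos t hti)) hQe
    rwa [projIcc_of_mem ht.le hti] at h1
  have hp1 : p t₁ = 0 := by simp [hp, expFraction]
  have hp2 : p t₂ = 1 := by
    rw [hp, expFraction]
    exact div_self hE0
  -- `t ↦ ln ψ(γ(t), t)` is not known to be differentiable, so `G` is compared with `B` through its
  -- right slopes alone.
  have key := image_le_of_liminf_slope_right_le_deriv_boundary hGc (B := B)
    (by simp [hB, hp1])
    (fun t h => (hBd t h).continuousAt.continuousWithinAt)
    (fun t h => (hBd t (Ico_subset_Icc_self h)).hasDerivWithinAt)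
    (fun t h r hr => by
      have hti := Ico_subset_Icc_self h
      have ht0 := hpos t hti
      refine (eventually_slope_lt (f := fun x t => Real.log (ψ x t)) hsf ht0 h.2
        (fun s hs => (hdist s ⟨h.1.trans hs.1, hs.2⟩ t hti).le) (hpd t)
        (hasDerivAt_exp_mul (-a) t) (fun s => Real.exp_pos _)
        (hasDerivAt_log_solution hψ (γ t) ht0) (lt_of_le_of_lt ?_ hr)).frequently
      have hHt := hH (γ t) t ht0
      rw [harnackQuantity_eq hφ hψ hlt ht0, riccatiBarrier] at hHt
      refine (rate_le (E := E) (D := D) rfl (sq_nonneg _) hHt (Real.log (ψ (γ t) t))).trans_eq ?_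
      ring)
  have hfin := key (right_mem_Icc.2 ht.le)
  have hint : ∫ s in t₁..t₂, Q (projIcc t₁ t₂ ht.le s) = ∫ s in t₁..t₂, Q s := by
    refine intervalIntegral.integral_congr fun s hs => ?_
    rw [uIcc_of_le ht.le] at hs
    simp only [projIcc_of_mem ht.le hs]
  have hlog : Real.log ((1 - Real.exp (-a * t₂)) / (1 - Real.exp (-a * t₁)))
      = Real.log ((1 - Real.exp (-a * t₂)) / a) - Real.log ((1 - Real.exp (-a * t₁)) / a) := by
    rw [← Real.log_div (one_sub_exp_div_pos ha ht₂).ne' (one_sub_exp_div_pos ha ht₁).ne',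
      div_div_div_cancel_right₀ ha]
  have hγ1 : γ t₁ = x₁ := by rw [hγ t₁ (left_mem_Icc.2 ht.le), hp1, hσ.source]
  have hγ2 : γ t₂ = x₂ := by rw [hγ t₂ (right_mem_Icc.2 ht.le), hp2, hσ.target]
  simp only [hB, hG] at hfin
  rw [hint, hγ1, hγ2, hp2, mul_one] at hfin
  rw [hlog]
  linarith

end HarnackGeometry
end IntegratedHarnack

/-! ### The Harnack inequality in both cases. -/

theorem mainTheorem2 {n : ℕ} {M : Type*} [MetricSpace M] [CompactSpace M]
    [ChartedSpace (EuclideanSpace ℝ (Fin n)) M] [IsManifold (𝓡 n) ∞ M]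
    [Bundle.RiemannianBundle (fun x : M => TangentSpace (𝓡 n) x)]
    [IsContMDiffRiemannianBundle (𝓡 n) ∞ (EuclideanSpace ℝ (Fin n))
      (fun x : M => TangentSpace (𝓡 n) x)]
    [IsRiemannianManifold (𝓡 n) M]
    (a : ℝ) (φ ψ : M → ℝ → ℝ)
    (hφ : HarnackGeometry.IsPositiveSolution n a φ)
    (hψ : HarnackGeometry.IsPositiveSolution n a ψ)
    (hcases :
      (0 < a ∧ (∀ x t, 0 < t → φ x t < ψ x t) ∧ HarnackGeometry.RicciBoundedBelow n M 0) ∨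
      (a < 0 ∧ ∃ c₀ K : ℝ, 0 < c₀ ∧ c₀ < 1 ∧
        (∀ x t, 0 < t → c₀ * ψ x t < φ x t ∧ φ x t < ψ x t) ∧
        -Real.log c₀ / (1 - c₀ ^ 2) - 1 / 2 ≤ K ∧
        HarnackGeometry.RicciBoundedBelow n M (-a * K)))
    (x₁ x₂ : M) (t₁ t₂ : ℝ) (ht₁ : 0 < t₁) (ht : t₁ < t₂) :
    (∃ σ : ℝ → M, HarnackGeometry.IsMinimalGeodesic x₁ x₂ σ) ∧
    ∀ σ γ : ℝ → M, HarnackGeometry.IsMinimalGeodesic x₁ x₂ σ →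
      (∀ t ∈ Set.Icc t₁ t₂, γ t =
        σ ((Real.exp (a * t) - Real.exp (a * t₁)) / (Real.exp (a * t₂) - Real.exp (a * t₁)))) →
      Real.exp (-a * t₁) * Real.log (ψ x₁ t₁) - Real.exp (-a * t₂) * Real.log (ψ x₂ t₂) ≤
        a / 4 * (dist x₁ x₂ ^ 2 / (Real.exp (a * t₂) - Real.exp (a * t₁)))
        + n / 2 * Real.log ((1 - Real.exp (-a * t₂)) / (1 - Real.exp (-a * t₁)))
        - ∫ t in t₁..t₂, Real.exp (-a * t) *
            (HarnackGeometry.gradNormSq n (fun y => φ y t / ψ y t) (γ t)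
              / (1 - (φ (γ t) t / ψ (γ t) t) ^ 2)) := by
  have ha : a ≠ 0 := hcases.elim (fun h => h.1.ne') fun h => h.1.ne
  have hlt : ∀ x t, 0 < t → φ x t < ψ x t := by
    rcases hcases with h | ⟨-, c₀, K, -, -, h, -⟩
    · exact h.2.1
    · exact fun x t ht => (h x t ht).2
  refine ⟨HarnackGeometry.exists_isMinimalGeodesic n x₁ x₂, fun σ γ hσ hγ =>
    HarnackGeometry.integrated_harnack ha hφ hψ hlt (fun x t ht => ?_) ht₁ ht hσ hγ⟩
  exact HarnackGeometry.riccatiBarrier_le_harnackQuantity hφ hψ hlt ha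
    (fun x t ht V W =>
      HarnackGeometry.curvature_term_nonneg hφ.pos hψ.pos hcases x ht V W) x ht
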